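/- **Setting.** For a complex vector space $X$ let $M_\infty(X)=\bigcup_{n}M_n(X)$, where $M_n(X)\subseteq M_{n+1}(X)$ as upper left corner, and $M_\infty=M_\infty(\mathbb C)$. A *semi-matrix ordered operator space* (SMOS) is a complex vector space $X$ with * a conjugate linear involution $*$, extended to matrices by $(x^*)_{k,l}=(x_{l,k})^*$; * a norm on $M_\infty(X)$ (the matrix norm) for which $*$ is isometric and $$\|\alpha x\beta+\gamma y\delta\|\le\|\alpha\alpha^*+\gamma\gamma^*\|^{1/2}\,\|\beta^*\beta+\delta^*\delta\|^{1/2}\max\{\|x\|,\|y\|\}\qquad(x,y\in M_\infty(X);\ \alpha,\beta,\gamma,\delta\in M_\infty);$$ * a norm closed set $M_\infty(X)_+\ni 0$ of self-adjoint elements of $M_\infty(X)$ (the matrix cone) with $\alpha^*x\alpha+\beta^*y\beta\in M_\infty(X)_+$ for $x,y\in M_\infty(X)_+$ and $\alpha,\beta\in M_\infty$. Put $M_n(X)_+=M_n(X)\cap M_\infty(X)_+$, $X_+=M_1(X)_+$, and write $x\le y$ if $y-x$ is in the cone. The matrix cone need not be proper. If it is proper, i.e. $M_\infty(X)_+\cap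 -M_\infty(X)_+=\{0\}$, and there is a Hilbert space $H$ and a self-adjoint linear complete isometry $\Psi:X\to\mathcal B(H)$ such that a self-adjoint $x\in M_n(X)$ lies in $M_n(X)_+$ exactly when $\Psi^{(n)}(x)\ge0$ (for all $n$), then $X$ is an *operator system*; it is a *unital operator system* if $\Psi$ can be chosen with $\mathrm{id}_H\in\Psi(X)$. The dual $X^*$ carries the involution $f^*(x)=\overline{f(x^*)}$; an element $f\in M_n(X^*)$, regarded as a map $X\to M_n$, has as norm its completely bounded norm, and lies in $M_n(X^*)_+$ iff it is self-adjoint and completely positive. The bidual is $X^{**}=(X^*)^*$. The completion $\tilde X$ carries the extended involution and matrix norm, and its matrix cone is the norm closure of $M_\infty(X)_+$. Let $O_{\tilde X}^+=\{u\in\tilde X_+:\|u\|<1\}$. Let $a=\{a_i\}_{i\in I}$ be an increasing net in $X_+$. For $x\in M_n(X)$ and $t\ge0$ put $x^{t,i}=\begin{pmatrix}t(I_n\otimes a_i)&x\\x^*&t(I_n\otimes a_i)\end{pmatrix}$, and, with $\inf\emptyset=+\infty$, $$\|x\|_a=\inf\{t\ge0:\ x^{t,i}\in M_{2n}(X)_+\text{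 for some }i\},$$ $$\|x\|_a^w=\inf\{t\ge0:\ \lim_iF(x^{t,i})\in[0,+\infty]\text{ for every bounded self-adjoint positive linear functional }F\text{ on }M_{2n}(X)\}.$$ The net is *matrix norm defining* if $\|x\|=\|x\|_a$, and *weakly matrix norm defining* if $\|x\|=\|x\|_a^w$, for all $x\in M_\infty(X)$. It is an *approximate order unit* of $X_{\mathrm{sa}}=\{x\in X:x^*=x\}$ if for every $x\in X_{\mathrm{sa}}$ there are $t>0$ and $i$ with $-ta_i\le x\le ta_i$. Finally, $X$ is *approximately unital* if it has a weakly matrix norm defining increasing net. **Theorem.** Let $X$ be a SMOS with completion $\tilde X$. (a) Consider the statements * (U1) $X$ is approximately unital. * (U2) $X^{**}$ is a unital operator system. * (U3) There is an approximate order unit $\{u_i\}_{i\in I}$ of $\tilde X_{\mathrm{sa}}$ which is a subnet of $O_{\tilde X}^+$ (that is, it is an increasing net in $O_{\tilde X}^+$, and for every $w\in O_{\tilde X}^+$ one has $w\le u_i$ eventually) and which weakly defines the matrix norm of $\tilde X$. Then (U1) $\Rightarrow$ (U2) $\Rightarrow$ (U3), and (U3) implies that $\tilde X$ is approximately unital.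 If $X$ is complete, then (U1), (U2) and (U3) are equivalent. (b) If $X$ is approximately unital, then $X$ is an operator system. (c) Every matrix norm defining approximate order unit of $X_{\mathrm{sa}}$ is weakly matrix norm defining. -/

import Mathlib

open Filter Topology
open scoped ENNReal NNReal ComplexOrder

universe u v w

noncomputable section

/-- The product `α x β` of a vector-valued matrix `x ∈ M_m(X)` with scalar matrices
`α ∈ M_{n,m}` and `β ∈ M_{m,n}`. -/
def Matrix.sandwich {X : Type u} [AddCommGroup X] [Module ℂ X] {m n : ℕ}
    (α : Matrix (Fin n) (Fin m) ℂ) (x : Matrix (Fin m) (Fin m) X)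
    (β : Matrix (Fin m) (Fin n) ℂ) : Matrix (Fin n) (Fin n) X :=
  Matrix.of fun i j => ∑ k, ∑ l, (α i k * β l j) • x k l

/-- The `C⋆`-norm (operator norm on the Euclidean space `ℂ^ι`) of a square scalar matrix. -/
def Matrix.cstarNorm {ι : Type} [Fintype ι] [DecidableEq ι] (A : Matrix ι ι ℂ) : ℝ :=
  ‖Matrix.toEuclideanCLM (n := ι) (𝕜 := ℂ) A‖

/-- The `1 × 1`-matrix with entry `x`. -/
def Matrix.single₁ {X : Type u} (x : X) : Matrix (Fin 1) (Fin 1) X :=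
  Matrix.of fun _ _ => x

/-- The raw data of a semi-matrix ordered operator space on the normed space `X`: an involution,
a family of functions `‖·‖` on the matrix spaces `M_n(X)`, and a family of subsets `M_n(X)_+`.
The laws are stated in `MatrixOrderedData.IsSMOS`. -/
structure MatrixOrderedData (X : Type u) [NormedAddCommGroup X] [NormedSpace ℂ X] where
  /-- the (conjugate linear, continuous) involution of `X` -/
  invol : X →L⋆[ℂ] X
  /-- the matrix norm on `M_n(X)` -/
  matNorm : ∀ n : ℕ, Matrix (Fin n) (Fin n) X → ℝ
  /-- the matrix cone `M_n(X)_+` -/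
  cone : ∀ n : ℕ, Set (Matrix (Fin n) (Fin n) X)

namespace MatrixOrderedData

section Basic

variable {X : Type u} [NormedAddCommGroup X] [NormedSpace ℂ X] (S : MatrixOrderedData X)

/-- The induced involution on matrices: `(x*)_{k,l} = (x_{l,k})*`. -/
def adj {m n : Type*} (x : Matrix m n X) : Matrix n m X :=
  x.transpose.map S.invol

/-- Semi-matrix ordered operator spaces.  The space `M_∞(X)` is the union of the `M_n(X)`; a norm
on `M_∞(X)` and a cone in `M_∞(X)` are the same as the families of their restrictions to the
`M_n(X)`, and allowing rectangular scalar coefficients below makes the families compatible with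
the inclusions `M_n(X) ⊆ M_{n+1}(X)` into the upper left corner. -/
structure IsSMOS : Prop where
  /-- `*` is an involution -/
  invol_invol : ∀ x, S.invol (S.invol x) = x
  /-- the norm of `X` is the one of `M_1(X)` -/
  matNorm_one : ∀ x, S.matNorm 1 (Matrix.single₁ x) = ‖x‖
  matNorm_eq_zero_iff : ∀ n (x : Matrix (Fin n) (Fin n) X), S.matNorm n x = 0 ↔ x = 0
  matNorm_smul : ∀ n (c : ℂ) (x : Matrix (Fin n) (Fin n) X),
    S.matNorm n (c • x) = ‖c‖ * S.matNorm n x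
  matNorm_add_le : ∀ n (x y : Matrix (Fin n) (Fin n) X),
    S.matNorm n (x + y) ≤ S.matNorm n x + S.matNorm n y
  /-- the operator space axiom -/
  ruan : ∀ (n m k : ℕ) (x : Matrix (Fin m) (Fin m) X) (y : Matrix (Fin k) (Fin k) X)
    (α : Matrix (Fin n) (Fin m) ℂ) (β : Matrix (Fin m) (Fin n) ℂ)
    (γ : Matrix (Fin n) (Fin k) ℂ) (δ : Matrix (Fin k) (Fin n) ℂ),
    S.matNorm n (Matrix.sandwich α x β + Matrix.sandwich γ y δ) ≤
      √(Matrix.cstarNorm (α * α.conjTranspose + γ * γ.conjTranspose)) *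
        √(Matrix.cstarNorm (β.conjTranspose * β + δ.conjTranspose * δ)) *
        max (S.matNorm m x) (S.matNorm k y)
  /-- the involution on matrices is isometric -/
  matNorm_adj : ∀ n (x : Matrix (Fin n) (Fin n) X), S.matNorm n (S.adj x) = S.matNorm n x
  /-- the cone consists of self-adjoint elements -/
  cone_sa : ∀ n, ∀ x ∈ S.cone n, S.adj x = x
  zero_mem_cone : ∀ n, 0 ∈ S.cone n
  cone_conj : ∀ (n m k : ℕ), ∀ x ∈ S.cone m, ∀ y ∈ S.cone k,
    ∀ (α : Matrix (Fin m) (Fin n) ℂ) (β : Matrix (Fin k) (Fin n) ℂ),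
      Matrix.sandwich α.conjTranspose x α + Matrix.sandwich β.conjTranspose y β ∈ S.cone n
  /-- the cone is norm closed -/
  cone_closed : ∀ n (x : Matrix (Fin n) (Fin n) X),
    (∀ ε > 0, ∃ y ∈ S.cone n, S.matNorm n (x - y) < ε) → x ∈ S.cone n

/-- Matrix ordered operator spaces: the matrix cone is moreover proper. -/
structure IsMOS : Prop extends IsSMOS S where
  cone_proper : ∀ n (x : Matrix (Fin n) (Fin n) X), x ∈ S.cone n → -x ∈ S.cone n → x = 0

end Basic

/-! ### Morphisms, and the operator systems -/

/-- `φ` is a complete isometry: all `φ^{(n)}` are isometric. -/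
def IsCompleteIsometry {X : Type u} [NormedAddCommGroup X] [NormedSpace ℂ X]
    {Y : Type v} [NormedAddCommGroup Y] [NormedSpace ℂ Y]
    (S : MatrixOrderedData X) (T : MatrixOrderedData Y) (φ : X →ₗ[ℂ] Y) : Prop :=
  ∀ n (x : Matrix (Fin n) (Fin n) X), T.matNorm n (x.map φ) = S.matNorm n x

/-- `φ` is completely order monomorphic: it is self-adjoint and injective, and on self-adjoint
matrices the cone of `X` is the one induced from `Y`. -/
structure IsCompletelyOrderMonomorphic {X : Type u} [NormedAddCommGroup X] [NormedSpace ℂ X]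
    {Y : Type v} [NormedAddCommGroup Y] [NormedSpace ℂ Y]
    (S : MatrixOrderedData X) (T : MatrixOrderedData Y) (φ : X →ₗ[ℂ] Y) : Prop where
  map_invol : ∀ x, φ (S.invol x) = T.invol (φ x)
  injective : Function.Injective φ
  mem_cone_iff : ∀ n (x : Matrix (Fin n) (Fin n) X), S.adj x = x →
    (x ∈ S.cone n ↔ x.map φ ∈ T.cone n)

/-- The operator on the Hilbert space direct sum `H^n` given by a matrix of operators on `H`. -/
def blockOp {H : Type u} [NormedAddCommGroup H] [InnerProductSpace ℂ H] {n : ℕ}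
    (T : Matrix (Fin n) (Fin n) (H →L[ℂ] H)) :
    PiLp 2 (fun _ : Fin n => H) →L[ℂ] PiLp 2 (fun _ : Fin n => H) :=
  ((PiLp.continuousLinearEquiv 2 ℂ (fun _ : Fin n => H)).symm :
      (∀ _ : Fin n, H) →L[ℂ] PiLp 2 (fun _ : Fin n => H)) ∘L
    ContinuousLinearMap.pi fun k => ∑ l, T k l ∘L PiLp.proj 2 (fun _ : Fin n => H) l

/-- `B(H)` with the adjoint, the operator norms on `M_n(B(H)) = B(H^n)` and the cones of positive
operators in `M_n(B(H)) = B(H^n)`. -/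
def boundedOperators (H : Type u) [NormedAddCommGroup H] [InnerProductSpace ℂ H]
    [CompleteSpace H] : MatrixOrderedData (H →L[ℂ] H) where
  invol := (ContinuousLinearMap.adjoint (𝕜 := ℂ) (E := H) (F := H)).toContinuousLinearEquiv
  matNorm _ x := ‖blockOp x‖
  cone _ := {x | (blockOp x).IsPositive}

section OperatorSystem

variable {X : Type u} [NormedAddCommGroup X] [NormedSpace ℂ X] (S : MatrixOrderedData X)

/-- Operator systems (not necessarily unital or complete). -/
def IsOperatorSystem : Prop :=
  S.IsMOS ∧ ∃ (H : Type u) (_ : NormedAddCommGroup H) (_ : InnerProductSpace ℂ H)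
    (_ : CompleteSpace H) (Ψ : X →ₗ[ℂ] (H →L[ℂ] H)),
      IsCompletelyOrderMonomorphic S (boundedOperators H) Ψ ∧
      IsCompleteIsometry S (boundedOperators H) Ψ

/-- Unital operator systems: the image of some representation contains the identity. -/
def IsUnitalOperatorSystem : Prop :=
  S.IsMOS ∧ ∃ (H : Type u) (_ : NormedAddCommGroup H) (_ : InnerProductSpace ℂ H)
    (_ : CompleteSpace H) (Ψ : X →ₗ[ℂ] (H →L[ℂ] H)),
      IsCompletelyOrderMonomorphic S (boundedOperators H) Ψ ∧
      IsCompleteIsometry S (boundedOperators H) Ψ ∧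
      ∃ e : X, Ψ e = ContinuousLinearMap.id ℂ H

end OperatorSystem

/-! ### The dual and the completion -/

section Dual

variable {X : Type u} [NormedAddCommGroup X] [NormedSpace ℂ X] (S : MatrixOrderedData X)

/-- The adjoint `f*(x) = conj (f (x*))` of a bounded functional. -/
def dualStar (f : StrongDual ℂ X) : StrongDual ℂ X :=
  ((starL ℂ : ℂ ≃L⋆[ℂ] ℂ) : ℂ →L⋆[ℂ] ℂ).comp (f.comp S.invol)

/-- The involution `f ↦ f*` of the dual space. -/
def dualInvol : StrongDual ℂ X →L⋆[ℂ] StrongDual ℂ X :=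
  LinearMap.mkContinuous
    { toFun := S.dualStar
      map_add' := fun f g => by ext x; simp [dualStar]
      map_smul' := fun c f => by ext x; simp [dualStar] }
    ‖S.invol‖ (fun f => by
      refine ContinuousLinearMap.opNorm_le_bound _ (by positivity) fun x => ?_
      have h1 : ‖f (S.invol x)‖ ≤ ‖f‖ * (‖S.invol‖ * ‖x‖) :=
        (f.le_opNorm _).trans (by gcongr; exact S.invol.le_opNorm x)
      simpa [dualStar, mul_comm, mul_left_comm, mul_assoc] using h1)

/-- For `f ∈ M_n(X*)`, regarded as a map `X → M_n`, and `x ∈ M_m(X)`, this is the matrix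
`f^{(m)}(x) ∈ M_m(M_n) = M_{mn}`. -/
def amplify {m n : ℕ} (f : Matrix (Fin n) (Fin n) (StrongDual ℂ X))
    (x : Matrix (Fin m) (Fin m) X) : Matrix (Fin m × Fin n) (Fin m × Fin n) ℂ :=
  Matrix.of fun p q => f p.2 q.2 (x p.1 q.1)

/-- The dual `X*`: the matrix norm of `f ∈ M_n(X*)` is its completely bounded norm as a map
`X → M_n`, and `f` is in the matrix cone iff it is self-adjoint and completely positive. -/
def dual : MatrixOrderedData (StrongDual ℂ X) where
  invol := S.dualInvol
  matNorm _ f := sSup {r : ℝ | ∃ (m : ℕ) (x : Matrix (Fin m) (Fin m) X),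
    S.matNorm m x ≤ 1 ∧ r = Matrix.cstarNorm (amplify f x)}
  cone _ := {f | f.transpose.map S.dualInvol = f ∧
    ∀ m, ∀ x ∈ S.cone m, (amplify f x).PosSemidef}

/-- The bidual `X**`. -/
def bidual : MatrixOrderedData (StrongDual ℂ (StrongDual ℂ X)) := S.dual.dual

/-- The entrywise canonical map `M_n(X) → M_n(X̃)` into the completion. -/
def toCompletion {n : ℕ} (x : Matrix (Fin n) (Fin n) X) :
    Matrix (Fin n) (Fin n) (UniformSpace.Completion X) :=
  x.map ((↑) : X → UniformSpace.Completion X)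

/-- The completion `X̃`: the involution and the matrix norm are the continuous extensions of
those of `X`, and the matrix cone is the closure of the one of `X`. -/
def completion : MatrixOrderedData (UniformSpace.Completion X) where
  invol := ((UniformSpace.Completion.toComplL : X →L[ℂ] UniformSpace.Completion X).comp
    S.invol).extend (UniformSpace.Completion.toComplL : X →L[ℂ] UniformSpace.Completion X)
  matNorm n z := limUnder (comap toCompletion (𝓝 z)) (S.matNorm n)
  cone n := closure (toCompletion '' S.cone n)

end Dual

/-! ### Increasing nets and approximate units -/

section Nets

variable {X : Type u} [NormedAddCommGroup X] [NormedSpace ℂ X] (S : MatrixOrderedData X)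

/-- The cone `X_+ = M_1(X)_+`. -/
def posCone : Set X := {x | Matrix.single₁ x ∈ S.cone 1}

/-- The set `O_X^+` of elements of `X_+` with norm less than one. -/
def openPosBall : Set X := {x | x ∈ S.posCone ∧ ‖x‖ < 1}

/-- The order relation `x ≤ y` given by `y - x ∈ X_+`. -/
def le (x y : X) : Prop := y - x ∈ S.posCone

/-- The matrix `[t (I_n ⊗ a), x; x*, t (I_n ⊗ a)]` in `M_{2n}(X)`. -/
def unitBlock {n : ℕ} (t : ℝ) (a : X) (x : Matrix (Fin n) (Fin n) X) :
    Matrix (Fin (n + n)) (Fin (n + n)) X :=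
  Matrix.reindex finSumFinEquiv finSumFinEquiv
    (Matrix.fromBlocks (Matrix.diagonal fun _ => (t : ℂ) • a) x
      (S.adj x) (Matrix.diagonal fun _ => (t : ℂ) • a))

/-- `F ∈ M_n(X)*_+`: `F` is a bounded self-adjoint positive linear functional on `M_n(X)`.  (The
values of such an `F` on self-adjoint elements are real.) -/
structure IsPosFunctional {n : ℕ} (F : Matrix (Fin n) (Fin n) X →ₗ[ℂ] ℂ) : Prop where
  bounded : ∃ C : ℝ, ∀ x, ‖F x‖ ≤ C * S.matNorm n x
  selfAdjoint : ∀ x, F (S.adj x) = star (F x)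
  nonneg : ∀ x ∈ S.cone n, 0 ≤ (F x).re

variable {I : Type w} [Preorder I]

/-- `a` is an increasing net in `X_+` (over a directed set `I`). -/
structure IsIncreasingNet (a : I → X) : Prop where
  nonempty : Nonempty I
  directed : IsDirectedOrder I
  mem_posCone : ∀ i, a i ∈ S.posCone
  mono : ∀ i j, i ≤ j → S.le (a i) (a j)

/-- The quantity `‖x‖_a`, with values in `[0, ∞]`. -/
def netNorm (a : I → X) {n : ℕ} (x : Matrix (Fin n) (Fin n) X) : ℝ≥0∞ :=
  ⨅ (t : ℝ≥0) (_ : ∃ i, S.unitBlock t (a i) x ∈ S.cone (n + n)), (t : ℝ≥0∞)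

/-- The quantity `‖x‖_a^w`, with values in `[0, ∞]`. -/
def weakNetNorm (a : I → X) {n : ℕ} (x : Matrix (Fin n) (Fin n) X) : ℝ≥0∞ :=
  ⨅ (t : ℝ≥0) (_ : ∀ F : Matrix (Fin (n + n)) (Fin (n + n)) X →ₗ[ℂ] ℂ, S.IsPosFunctional F →
    ∃ L : EReal, 0 ≤ L ∧
      Tendsto (fun i => (((F (S.unitBlock t (a i) x)).re : ℝ) : EReal)) atTop (𝓝 L)), (t : ℝ≥0∞)

/-- `a` is a matrix norm defining increasing net. -/
def IsMatrixNormDefining (a : I → X) : Prop :=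
  S.IsIncreasingNet a ∧
    ∀ n (x : Matrix (Fin n) (Fin n) X), ENNReal.ofReal (S.matNorm n x) = S.netNorm a x

/-- `a` is a weakly matrix norm defining increasing net. -/
def IsWeaklyMatrixNormDefining (a : I → X) : Prop :=
  S.IsIncreasingNet a ∧
    ∀ n (x : Matrix (Fin n) (Fin n) X), ENNReal.ofReal (S.matNorm n x) = S.weakNetNorm a x

/-- `a` is an approximate order unit of `X_sa`. -/
def IsApproximateOrderUnit (a : I → X) : Prop :=
  S.IsIncreasingNet a ∧ ∀ x, S.invol x = x →
    ∃ t : ℝ, 0 < t ∧ ∃ i, S.le (-((t : ℂ) • a i)) x ∧ S.le x ((t : ℂ) • a i)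

/-- `a` is a subnet of the set `O_X^+`, directed by its order: it takes values in `O_X^+` and is
eventually above each element of `O_X^+`. -/
def IsSubnetOfOpenPosBall (a : I → X) : Prop :=
  (∀ i, a i ∈ S.openPosBall) ∧ ∀ y ∈ S.openPosBall, ∃ i₀, ∀ i, i₀ ≤ i → S.le y (a i)

end Nets

section ApproximatelyUnital

variable {X : Type u} [NormedAddCommGroup X] [NormedSpace ℂ X] (S : MatrixOrderedData X)

/-- `X` admits a weakly matrix norm defining increasing net.  (Replacing the index set of a net by
the range of the net changes none of the properties, so the universe of `X` suffices.) -/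
def IsApproximatelyUnital : Prop :=
  ∃ (I : Type u) (_ : Preorder I) (a : I → X), S.IsWeaklyMatrixNormDefining a

/-- There is an approximate order unit which is a subnet of `O_X^+` and weakly defines the matrix
norm. -/
def HasWeaklyDefiningUnitInOpenPosBall : Prop :=
  ∃ (I : Type u) (_ : Preorder I) (a : I → X),
    S.IsApproximateOrderUnit a ∧ S.IsSubnetOfOpenPosBall a ∧ S.IsWeaklyMatrixNormDefining a

end ApproximatelyUnital

end MatrixOrderedData

end

/-!
The theorem rests on one notion, the unit of the bidual as seen from `X` (`IsBidualUnit`): an element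
`e` of the unit ball of `X**` such that the norm of `x ∈ M_n(X)` is the smallest `t ≥ 0` for which
`[t e, x; x*, t e]` is positive in the bidual.  Positivity in the bidual is tested on the positive
elements of `M_{2n}(X*)`, so this is a statement about positive functionals on the spaces `M_{2n}(X)`.
Approximate unitality, the bidual being a unital operator system, and the existence of the approximate
order unit in the open unit ball are each equivalent to the existence of such an `e`.

*Nets.*  The elements of a weakly matrix norm defining net are contractions, hence the net has a weak*
cluster point `e`; by monotonicity it converges to `e` on positive functionals, and then the defining
property of `‖·‖_a^w` is that of `e` (`IsWeaklyMatrixNormDefining.exists_isBidualUnit`).  Conversely,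
any increasing net that converges to `e` on positive functionals is weakly matrix norm defining
(`IsBidualUnit.isWeaklyMatrixNormDefining`).

*The bidual.*  If the bidual is a unital operator system, then its identity is such an `e`, because
`X → X**` is completely isometric.  The latter (`IsSMOS.bidual_matNorm_toBidual`) is a part of the
proof of Ruan's theorem: a norming functional on `M_n(X)` is dominated by two functionals on the
scalar matrices, and dividing by their densities turns it into a complete contraction.  Conversely,
given `e`, represent `X**` on the direct sum of all unital completely positive maps `X → M_k`, the
elements `g ∈ M_k(X*)_+` with `e(g) = 1`.  They determine the cone of the bidual because a positive
functional can be normalized once `e(f)` is made invertible (`IsBidualUnit.mem_bidual_cone_of_unital`),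
and they determine its norm by a version of Paulsen's `2 × 2`-matrix trick: every contraction in
`M_m(X*)` is the corner of a positive element of `M_{2m}(X*)` with contractive diagonal
(`IsBidualUnit.exists_positive_extension`).  As `X` embeds into `X**` also as an ordered space
(`IsSMOS.mem_cone_of_forall_dual`), it is then an operator system.

*The open unit ball.*  The norm of a positive functional is its value at `e`, so the norm is additive
on positive functionals.  By duality, two self-adjoint elements of a ball have an approximate common
upper bound in that ball, and completeness yields an exact one in a slightly larger ball
(`IsBidualUnit.exists_upper_bound`).  Hence the open unit ball of the cone is directed, and as a net it
converges to `e` on positive functionals.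

*The completion.*  A space and its completion have the same dual, hence the same units
(`isBidualUnit_completion_iff`).

*Matrix norm defining nets.*  One inequality between `‖x‖_a` and `‖x‖_a^w` is plain.  For the other
one, the Hahn--Banach theorem gives a positive functional of norm at most one at which
`[t a_i, x; x*, t a_i]` takes values at most `t - ‖x‖`, uniformly in `i`
(`IsMatrixNormDefining.exists_functional`).

All separation arguments go through `exists_linearMap_le_of_cone`, where the bounds that a functional
has to satisfy are collected into one convex cone.
-/

noncomputable section

/-! ### Scalar coefficients and the pairing of a space with its dual -/

namespace Matrix

section Sandwich

variable {X : Type u} [AddCommGroup X] [Module ℂ X] {m n p : ℕ}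

lemma sandwich_apply (α : Matrix (Fin n) (Fin m) ℂ) (x : Matrix (Fin m) (Fin m) X)
    (β : Matrix (Fin m) (Fin n) ℂ) (i j : Fin n) :
    sandwich α x β i j = ∑ k, ∑ l, (α i k * β l j) • x k l := rfl

lemma sandwich_add (α : Matrix (Fin n) (Fin m) ℂ) (x y : Matrix (Fin m) (Fin m) X)
    (β : Matrix (Fin m) (Fin n) ℂ) :
    sandwich α (x + y) β = sandwich α x β + sandwich α y β := by
  ext i j; simp [sandwich_apply, Finset.sum_add_distrib]

lemma sandwich_smul (α : Matrix (Fin n) (Fin m) ℂ) (c : ℂ) (x : Matrix (Fin m) (Fin m) X)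
    (β : Matrix (Fin m) (Fin n) ℂ) :
    sandwich α (c • x) β = c • sandwich α x β := by
  ext i j; simp [sandwich_apply, Finset.smul_sum, smul_comm c]

@[simp] lemma sandwich_zero (α : Matrix (Fin n) (Fin m) ℂ) (β : Matrix (Fin m) (Fin n) ℂ) :
    sandwich α (0 : Matrix (Fin m) (Fin m) X) β = 0 := by
  ext i j; simp [sandwich_apply]

lemma add_sandwich (α α' : Matrix (Fin n) (Fin m) ℂ) (x : Matrix (Fin m) (Fin m) X)
    (β : Matrix (Fin m) (Fin n) ℂ) :
    sandwich (α + α') x β = sandwich α x β + sandwich α' x β := by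
  ext i j; simp [sandwich_apply, Finset.sum_add_distrib, add_mul, add_smul]

lemma sandwich_add_right (α : Matrix (Fin n) (Fin m) ℂ) (x : Matrix (Fin m) (Fin m) X)
    (β β' : Matrix (Fin m) (Fin n) ℂ) :
    sandwich α x (β + β') = sandwich α x β + sandwich α x β' := by
  ext i j; simp [sandwich_apply, Finset.sum_add_distrib, mul_add, add_smul]

lemma smul_sandwich (c : ℂ) (α : Matrix (Fin n) (Fin m) ℂ) (x : Matrix (Fin m) (Fin m) X)
    (β : Matrix (Fin m) (Fin n) ℂ) :
    sandwich (c • α) x β = c • sandwich α x β := by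
  ext i j; simp [sandwich_apply, Finset.smul_sum, smul_smul, mul_assoc]

lemma sandwich_smul_right (c : ℂ) (α : Matrix (Fin n) (Fin m) ℂ) (x : Matrix (Fin m) (Fin m) X)
    (β : Matrix (Fin m) (Fin n) ℂ) :
    sandwich α x (c • β) = c • sandwich α x β := by
  ext i j; simp [sandwich_apply, Finset.smul_sum, smul_smul, mul_left_comm]

@[simp] lemma sandwich_zero_right (x : Matrix (Fin m) (Fin m) X) (α : Matrix (Fin n) (Fin m) ℂ) :
    sandwich α x (0 : Matrix (Fin m) (Fin n) ℂ) = 0 := by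
  ext i j; simp [sandwich_apply]

@[simp] lemma one_sandwich_one (x : Matrix (Fin m) (Fin m) X) : sandwich 1 x 1 = x := by
  ext i j
  simp only [sandwich_apply, Matrix.one_apply]
  rw [Finset.sum_eq_single i (by intro k _ hk; simp [hk.symm]) (by simp),
    Finset.sum_eq_single j (by intro k _ hk; simp [hk]) (by simp)]
  simp

lemma sandwich_sandwich (α : Matrix (Fin p) (Fin n) ℂ) (β : Matrix (Fin n) (Fin m) ℂ)
    (x : Matrix (Fin m) (Fin m) X) (γ : Matrix (Fin m) (Fin n) ℂ) (δ : Matrix (Fin n) (Fin p) ℂ) :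
    sandwich α (sandwich β x γ) δ = sandwich (α * β) x (γ * δ) := by
  ext i j
  simp only [sandwich_apply, Matrix.mul_apply, Finset.smul_sum, smul_smul, Finset.sum_mul,
    Finset.mul_sum, Finset.sum_smul]
  rw [Finset.sum_congr rfl fun a _ => Finset.sum_comm, Finset.sum_comm]
  refine Finset.sum_congr rfl fun k _ => ?_
  rw [Finset.sum_congr rfl fun a _ => Finset.sum_comm, Finset.sum_comm]
  refine Finset.sum_congr rfl fun l _ => ?_
  rw [Finset.sum_comm]
  refine Finset.sum_congr rfl fun a _ => Finset.sum_congr rfl fun b _ => ?_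
  congr 1; ring

lemma sandwich_map {Y : Type v} [AddCommGroup Y] [Module ℂ Y] (φ : X →ₗ[ℂ] Y)
    (α : Matrix (Fin n) (Fin m) ℂ) (x : Matrix (Fin m) (Fin m) X) (β : Matrix (Fin m) (Fin n) ℂ) :
    (sandwich α x β).map φ = sandwich α (x.map φ) β := by
  ext i j; simp [sandwich_apply]

end Sandwich

end Matrix

namespace MatrixOrderedData

open Matrix

/-- The bilinear pairing of `M_n(X*)` with `M_n(X)`, identifying `M_n(X*)` with the space of bounded
functionals on `M_n(X)`. -/
def pair {X : Type u} [NormedAddCommGroup X] [NormedSpace ℂ X] {n : ℕ}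
    (f : Matrix (Fin n) (Fin n) (StrongDual ℂ X)) (x : Matrix (Fin n) (Fin n) X) : ℂ :=
  ∑ k, ∑ l, f k l (x k l)

section Pair

variable {X : Type u} [NormedAddCommGroup X] [NormedSpace ℂ X] (S : MatrixOrderedData X)
  {m n : ℕ}

lemma pair_add (f : Matrix (Fin n) (Fin n) (StrongDual ℂ X)) (x y : Matrix (Fin n) (Fin n) X) :
    pair f (x + y) = pair f x + pair f y := by
  simp [pair, Finset.sum_add_distrib]

lemma pair_sub (f : Matrix (Fin n) (Fin n) (StrongDual ℂ X)) (x y : Matrix (Fin n) (Fin n) X) :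
    pair f (x - y) = pair f x - pair f y := by
  simp [pair, Finset.sum_sub_distrib]

lemma pair_neg (f : Matrix (Fin n) (Fin n) (StrongDual ℂ X)) (x : Matrix (Fin n) (Fin n) X) :
    pair f (-x) = -pair f x := by
  simp [pair]

lemma pair_smul (f : Matrix (Fin n) (Fin n) (StrongDual ℂ X)) (c : ℂ)
    (x : Matrix (Fin n) (Fin n) X) : pair f (c • x) = c * pair f x := by
  simp [pair, Finset.mul_sum]

@[simp] lemma pair_zero (f : Matrix (Fin n) (Fin n) (StrongDual ℂ X)) : pair f 0 = 0 := by
  simp [pair]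

@[simp] lemma zero_pair (x : Matrix (Fin n) (Fin n) X) :
    pair (0 : Matrix (Fin n) (Fin n) (StrongDual ℂ X)) x = 0 := by
  simp [pair]

lemma add_pair (f g : Matrix (Fin n) (Fin n) (StrongDual ℂ X)) (x : Matrix (Fin n) (Fin n) X) :
    pair (f + g) x = pair f x + pair g x := by
  simp [pair, Finset.sum_add_distrib]

lemma sub_pair (f g : Matrix (Fin n) (Fin n) (StrongDual ℂ X)) (x : Matrix (Fin n) (Fin n) X) :
    pair (f - g) x = pair f x - pair g x := by
  simp [pair, Finset.sum_sub_distrib]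

lemma smul_pair (c : ℂ) (f : Matrix (Fin n) (Fin n) (StrongDual ℂ X))
    (x : Matrix (Fin n) (Fin n) X) : pair (c • f) x = c * pair f x := by
  simp [pair, Finset.mul_sum]

/-- Scalar coefficients move across the pairing as their transposes. -/
lemma pair_sandwich (f : Matrix (Fin n) (Fin n) (StrongDual ℂ X)) (α : Matrix (Fin n) (Fin m) ℂ)
    (x : Matrix (Fin m) (Fin m) X) (β : Matrix (Fin m) (Fin n) ℂ) :
    pair f (sandwich α x β) = pair (sandwich αᵀ f βᵀ) x := by
  simp only [pair, sandwich_apply, map_sum, map_smul, _root_.sum_apply,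
    _root_.smul_apply, transpose_apply, smul_eq_mul]
  rw [Finset.sum_congr rfl fun a _ => Finset.sum_comm, Finset.sum_comm]
  refine Finset.sum_congr rfl fun k _ => ?_
  rw [Finset.sum_congr rfl fun a _ => Finset.sum_comm, Finset.sum_comm]

lemma sandwich_pair (f : Matrix (Fin m) (Fin m) (StrongDual ℂ X)) (α : Matrix (Fin n) (Fin m) ℂ)
    (x : Matrix (Fin n) (Fin n) X) (β : Matrix (Fin m) (Fin n) ℂ) :
    pair (sandwich α f β) x = pair f (sandwich αᵀ x βᵀ) := by
  rw [pair_sandwich, transpose_transpose, transpose_transpose]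

@[simp] lemma adj_apply (x : Matrix (Fin m) (Fin n) X) (i : Fin n) (j : Fin m) :
    S.adj x i j = S.invol (x j i) := rfl

lemma adj_add (x y : Matrix (Fin m) (Fin n) X) : S.adj (x + y) = S.adj x + S.adj y := by
  ext; simp

lemma adj_sub (x y : Matrix (Fin m) (Fin n) X) : S.adj (x - y) = S.adj x - S.adj y := by
  ext; simp

lemma adj_neg (x : Matrix (Fin m) (Fin n) X) : S.adj (-x) = -S.adj x := by
  ext; simp

@[simp] lemma adj_zero : S.adj (0 : Matrix (Fin m) (Fin n) X) = 0 := by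
  ext; simp

lemma adj_smul (c : ℂ) (x : Matrix (Fin m) (Fin n) X) :
    S.adj (c • x) = star c • S.adj x := by
  ext; simp

lemma adj_real_smul (c : ℝ) (x : Matrix (Fin m) (Fin n) X) :
    S.adj ((c : ℂ) • x) = (c : ℂ) • S.adj x := by
  rw [adj_smul]; simp

lemma adj_sandwich (α : Matrix (Fin n) (Fin m) ℂ) (x : Matrix (Fin m) (Fin m) X)
    (β : Matrix (Fin m) (Fin n) ℂ) :
    S.adj (sandwich α x β) = sandwich βᴴ (S.adj x) αᴴ := by
  ext i j
  simp only [adj_apply, sandwich_apply, map_sum, map_smulₛₗ, conjTranspose_apply]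
  rw [Finset.sum_comm]
  refine Finset.sum_congr rfl fun k _ => Finset.sum_congr rfl fun l _ => ?_
  simp [mul_comm]

lemma pair_dual_adj (f : Matrix (Fin n) (Fin n) (StrongDual ℂ X)) (x : Matrix (Fin n) (Fin n) X) :
    pair (S.dual.adj f) x = star (pair f (S.adj x)) := by
  simp only [pair, star_sum]
  rw [Finset.sum_comm]
  refine Finset.sum_congr rfl fun k _ => Finset.sum_congr rfl fun l _ => ?_
  rfl

/-- A vector indexed by pairs, regarded as a matrix. -/
def toMat (η : Fin m × Fin n → ℂ) : Matrix (Fin m) (Fin n) ℂ := Matrix.of fun i j => η (i, j)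

/-- The sesquilinear form of `f^{(m)}(x)`, in terms of the pairing. -/
lemma dotProduct_amplify (f : Matrix (Fin n) (Fin n) (StrongDual ℂ X))
    (x : Matrix (Fin m) (Fin m) X) (η ξ : Fin m × Fin n → ℂ) :
    star η ⬝ᵥ (amplify f x *ᵥ ξ) = pair f (sandwich (toMat η)ᴴ x (toMat ξ)) := by
  simp only [dotProduct, mulVec, amplify, Fintype.sum_prod_type, pair, sandwich_apply, map_sum,
    map_smul, Matrix.of_apply, Pi.star_apply, Finset.mul_sum, conjTranspose_apply, toMat,
    smul_eq_mul]
  rw [Finset.sum_comm]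
  refine Finset.sum_congr rfl fun k _ => ?_
  rw [Finset.sum_congr rfl fun a _ => Finset.sum_comm, Finset.sum_comm]
  refine Finset.sum_congr rfl fun l _ => ?_
  refine Finset.sum_congr rfl fun i _ => Finset.sum_congr rfl fun j _ => ?_
  ring

end Pair

end MatrixOrderedData

/-! ### Hilbert--Schmidt and operator norms of scalar matrices -/

namespace Matrix

open scoped Matrix.Norms.L2Operator

/-- The square of the Hilbert--Schmidt norm of a scalar matrix. -/
def hsq {m n : Type*} [Fintype m] [Fintype n] (A : Matrix m n ℂ) : ℝ := ∑ i, ∑ j, ‖A i j‖ ^ 2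

section HS
variable {m n p q : Type*} [Fintype m] [Fintype n] [Fintype p] [Fintype q]

lemma hsq_nonneg (A : Matrix m n ℂ) : 0 ≤ hsq A := by unfold hsq; positivity

lemma hsq_transpose (A : Matrix m n ℂ) : hsq Aᵀ = hsq A := by
  unfold hsq; rw [Finset.sum_comm]; rfl

lemma hsq_conjTranspose (A : Matrix m n ℂ) : hsq Aᴴ = hsq A := by
  unfold hsq; rw [Finset.sum_comm]; simp

lemma hsq_smul (c : ℂ) (A : Matrix m n ℂ) : hsq (c • A) = ‖c‖ ^ 2 * hsq A := by
  simp [hsq, Finset.mul_sum, mul_pow]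

lemma hsq_eq_re_trace (A : Matrix m n ℂ) : hsq A = (Aᴴ * A).trace.re := by
  simp only [hsq, trace, diag_apply, mul_apply, conjTranspose_apply, Complex.re_sum]
  rw [Finset.sum_comm]
  refine Finset.sum_congr rfl fun i _ => Finset.sum_congr rfl fun j _ => ?_
  rw [← Complex.normSq_eq_norm_sq, Complex.star_def, ← Complex.normSq_eq_conj_mul_self]; simp

lemma cstarNorm_nonneg {ι : Type} [Fintype ι] [DecidableEq ι] (A : Matrix ι ι ℂ) :
    0 ≤ cstarNorm A := norm_nonneg _

variable {ι : Type} [Fintype ι] [DecidableEq ι]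

lemma norm_star_dotProduct_le (η ξ : m → ℂ) :
    ‖star η ⬝ᵥ ξ‖ ≤ √(∑ i, ‖η i‖ ^ 2) * √(∑ i, ‖ξ i‖ ^ 2) := by
  have h1 : star η ⬝ᵥ ξ = inner ℂ (WithLp.toLp 2 η) (WithLp.toLp 2 ξ) := by
    rw [EuclideanSpace.inner_eq_star_dotProduct, dotProduct_comm]
  rw [h1, ← EuclideanSpace.norm_eq (WithLp.toLp 2 η), ← EuclideanSpace.norm_eq (WithLp.toLp 2 ξ)]
  exact norm_inner_le_norm (𝕜 := ℂ) _ _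

lemma norm_dotProduct_le_cstarNorm (A : Matrix ι ι ℂ) (η ξ : ι → ℂ) :
    ‖star η ⬝ᵥ (A *ᵥ ξ)‖ ≤ cstarNorm A * √(∑ i, ‖η i‖ ^ 2) * √(∑ i, ‖ξ i‖ ^ 2) := by
  have h1 : star η ⬝ᵥ (A *ᵥ ξ) = inner ℂ (WithLp.toLp 2 η) (WithLp.toLp 2 (A *ᵥ ξ)) := by
    rw [EuclideanSpace.inner_eq_star_dotProduct, dotProduct_comm]
  have h2 := l2_opNorm_mulVec A (WithLp.toLp 2 ξ)
  have h3 := norm_inner_le_norm (𝕜 := ℂ) (WithLp.toLp 2 η) (WithLp.toLp 2 (A *ᵥ ξ))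
  rw [h1]
  refine h3.trans ?_
  rw [← EuclideanSpace.norm_eq (WithLp.toLp 2 η), ← EuclideanSpace.norm_eq (WithLp.toLp 2 ξ),
    mul_comm (cstarNorm A), mul_assoc]
  exact mul_le_mul_of_nonneg_left h2 (norm_nonneg _)

lemma cstarNorm_le_of_forall (A : Matrix ι ι ℂ) {c : ℝ} (hc : 0 ≤ c)
    (h : ∀ η ξ : ι → ℂ, ‖star η ⬝ᵥ (A *ᵥ ξ)‖ ≤ c * √(∑ i, ‖η i‖ ^ 2) * √(∑ i, ‖ξ i‖ ^ 2)) :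
    cstarNorm A ≤ c := by
  refine ContinuousLinearMap.opNorm_le_of_re_inner_le hc fun ξ η hξ hη => ?_
  have h1 := h η.ofLp ξ.ofLp
  rw [← EuclideanSpace.norm_eq, ← EuclideanSpace.norm_eq, hξ, hη, mul_one, mul_one] at h1
  refine le_trans ?_ h1
  rw [← inner_conj_symm, RCLike.conj_re]
  refine (RCLike.re_le_norm _).trans (le_of_eq ?_)
  rw [EuclideanSpace.inner_eq_star_dotProduct, dotProduct_comm]
  rfl

lemma norm_trace_conj_le (P : Matrix ι ι ℂ) (η : Matrix ι n ℂ) :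
    ‖(ηᴴ * P * η).trace‖ ≤ cstarNorm P * hsq η := by
  have : (ηᴴ * P * η).trace = ∑ j, star (fun i => η i j) ⬝ᵥ (P *ᵥ fun i => η i j) := by
    simp only [trace, diag_apply, Matrix.mul_assoc]
    rfl
  rw [this, ← hsq_transpose, hsq, Finset.mul_sum]
  refine (norm_sum_le _ _).trans (Finset.sum_le_sum fun j _ => ?_)
  refine (norm_dotProduct_le_cstarNorm P _ _).trans (le_of_eq ?_)
  rw [mul_assoc, Real.mul_self_sqrt (by positivity)]
  rfl

lemma hsq_mul_add_hsq_mul_le (α : Matrix m ι ℂ) (γ : Matrix p ι ℂ) (η : Matrix ι n ℂ) :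
    hsq (α * η) + hsq (γ * η) ≤ cstarNorm (αᴴ * α + γᴴ * γ) * hsq η := by
  refine le_trans (le_of_eq ?_) ((Complex.re_le_norm _).trans (norm_trace_conj_le _ η))
  rw [hsq_eq_re_trace, hsq_eq_re_trace, ← Complex.add_re, ← trace_add]
  congr 2
  simp only [conjTranspose_mul, Matrix.mul_add, Matrix.add_mul, Matrix.mul_assoc]

lemma hsq_add_hsq_mul_le (α : Matrix ι m ℂ) (γ : Matrix ι p ℂ) (η : Matrix n ι ℂ) :
    hsq (η * α) + hsq (η * γ) ≤ cstarNorm (α * αᴴ + γ * γᴴ) * hsq η := by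
  have := hsq_mul_add_hsq_mul_le αᴴ γᴴ ηᴴ
  rwa [← conjTranspose_mul, ← conjTranspose_mul, hsq_conjTranspose, hsq_conjTranspose,
    hsq_conjTranspose, conjTranspose_conjTranspose, conjTranspose_conjTranspose] at this

lemma cstarNorm_conjTranspose_mul_self_le_hsq (A : Matrix m ι ℂ) :
    cstarNorm (Aᴴ * A) ≤ hsq A := by
  have key : ∀ ξ : ι → ℂ, √(∑ i, ‖(A *ᵥ ξ) i‖ ^ 2) ≤ √(hsq A) * √(∑ i, ‖ξ i‖ ^ 2) := fun ξ => by
    rw [← Real.sqrt_mul (hsq_nonneg A), hsq, Finset.sum_mul]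
    refine Real.sqrt_le_sqrt (Finset.sum_le_sum fun i _ => ?_)
    have h := norm_star_dotProduct_le (star (A i)) ξ
    rw [star_star] at h
    have h2 := pow_le_pow_left₀ (norm_nonneg _) h 2
    rw [mul_pow, Real.sq_sqrt (by positivity), Real.sq_sqrt (by positivity)] at h2
    simpa [mulVec] using h2
  refine cstarNorm_le_of_forall _ (hsq_nonneg A) fun η ξ => ?_
  have h1 : star η ⬝ᵥ ((Aᴴ * A) *ᵥ ξ) = star (A *ᵥ η) ⬝ᵥ (A *ᵥ ξ) := by
    rw [star_mulVec, ← mulVec_mulVec, dotProduct_mulVec]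
  rw [h1]
  refine (norm_star_dotProduct_le _ _).trans ?_
  refine (mul_le_mul (key η) (key ξ) (by positivity) (by positivity)).trans (le_of_eq ?_)
  nth_rewrite 3 [← Real.mul_self_sqrt (hsq_nonneg A)]
  ring

lemma cstarNorm_mul_conjTranspose_self_le_hsq (A : Matrix ι m ℂ) :
    cstarNorm (A * Aᴴ) ≤ hsq A := by
  have := cstarNorm_conjTranspose_mul_self_le_hsq Aᴴ
  rwa [conjTranspose_conjTranspose, hsq_conjTranspose] at this

end HS

end Matrix

namespace Matrix

@[simp] lemma hsq_single {m n : ℕ} (i : Fin m) (j : Fin n) :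
    hsq (Matrix.single i j (1 : ℂ)) = 1 := by
  unfold hsq
  rw [Finset.sum_eq_single i (by intro k _ hk; simp [hk.symm]) (by simp),
    Finset.sum_eq_single j (by intro k _ hk; simp [hk.symm]) (by simp)]
  simp

/-- Optimizing the weights in the inequality of arithmetic and geometric means. -/
lemma le_mul_sqrt_of_forall_weight {z c A B : ℝ} (hc : 0 ≤ c) (hA : 0 ≤ A) (hB : 0 ≤ B)
    (h : ∀ r : ℝ, 0 < r → 2 * z ≤ c * (r ^ 2 * A + (r⁻¹) ^ 2 * B)) : z ≤ c * √A * √B := by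
  have h1 : ∀ ε : ℝ, 0 < ε → z ≤ c * √(A + ε) * √(B + ε) := fun ε hε => by
    have h3 := h (√(√(B + ε) / √(A + ε))) (by positivity)
    rw [inv_pow, Real.sq_sqrt (by positivity), inv_div] at h3
    have a1 : 0 < √(A + ε) := by positivity
    have a2 : 0 < √(B + ε) := by positivity
    have b1 : √(B + ε) / √(A + ε) * A ≤ √(B + ε) * √(A + ε) := by
      rw [div_mul_eq_mul_div, div_le_iff₀ a1, mul_assoc, Real.mul_self_sqrt (by positivity)]
      gcongr; linarith
    have b2 : √(A + ε) / √(B + ε) * B ≤ √(A + ε) * √(B + ε) := by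
      rw [div_mul_eq_mul_div, div_le_iff₀ a2, mul_assoc, Real.mul_self_sqrt (by positivity)]
      gcongr; linarith
    have := mul_le_mul_of_nonneg_left (add_le_add b1 b2) hc
    linarith
  have h2 : Tendsto (fun ε : ℝ => c * √(A + ε) * √(B + ε)) (𝓝[>] 0) (𝓝 (c * √A * √B)) := by
    have : Continuous fun ε : ℝ => c * √(A + ε) * √(B + ε) := by fun_prop
    simpa using (this.tendsto 0).mono_left nhdsWithin_le_nhds
  exact ge_of_tendsto h2 (eventually_mem_nhdsWithin.mono h1)

lemma sqrt_mul_sqrt_add_le {a b c d : ℝ} (ha : 0 ≤ a) (hb : 0 ≤ b) (hc : 0 ≤ c) (hd : 0 ≤ d) :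
    √a * √c + √b * √d ≤ √(a + b) * √(c + d) := by
  rw [← Real.sqrt_mul (add_nonneg ha hb)]
  refine Real.le_sqrt_of_sq_le ?_
  nlinarith [Real.sq_sqrt ha, Real.sq_sqrt hb, Real.sq_sqrt hc, Real.sq_sqrt hd,
    sq_nonneg (√a * √d - √b * √c)]

end Matrix

/-! ### Consequences of the axioms -/

namespace MatrixOrderedData

open Matrix

section Basics

variable {X : Type u} [NormedAddCommGroup X] [NormedSpace ℂ X] {S : MatrixOrderedData X}
  {m n k : ℕ}

namespace IsSMOS

variable (hS : S.IsSMOS)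
include hS

lemma matNorm_zero : S.matNorm n 0 = 0 := (hS.matNorm_eq_zero_iff n 0).2 rfl

lemma matNorm_neg (x : Matrix (Fin n) (Fin n) X) : S.matNorm n (-x) = S.matNorm n x := by
  have := hS.matNorm_smul n (-1) x
  simpa using this

lemma matNorm_nonneg (x : Matrix (Fin n) (Fin n) X) : 0 ≤ S.matNorm n x := by
  have h := hS.matNorm_add_le n x (-x)
  rw [add_neg_cancel, hS.matNorm_zero, hS.matNorm_neg] at h
  linarith

lemma matNorm_real_smul (c : ℝ) (x : Matrix (Fin n) (Fin n) X) :
    S.matNorm n ((c : ℂ) • x) = |c| * S.matNorm n x := by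
  rw [hS.matNorm_smul, Complex.norm_real, Real.norm_eq_abs]

lemma matNorm_sub_le (x y : Matrix (Fin n) (Fin n) X) :
    S.matNorm n (x - y) ≤ S.matNorm n x + S.matNorm n y := by
  rw [sub_eq_add_neg, ← hS.matNorm_neg y]
  exact hS.matNorm_add_le n _ _

lemma matNorm_sandwich_le (α : Matrix (Fin n) (Fin m) ℂ) (x : Matrix (Fin m) (Fin m) X)
    (β : Matrix (Fin m) (Fin n) ℂ) :
    S.matNorm n (sandwich α x β) ≤ √(cstarNorm (α * αᴴ)) * √(cstarNorm (βᴴ * β)) *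
      S.matNorm m x := by
  have h := hS.ruan n m 0 x 0 α β 0 0
  simpa [hS.matNorm_zero, hS.matNorm_nonneg] using h

lemma matNorm_sandwich_le_hsq (α : Matrix (Fin n) (Fin m) ℂ) (x : Matrix (Fin m) (Fin m) X)
    (β : Matrix (Fin m) (Fin n) ℂ) :
    S.matNorm n (sandwich α x β) ≤ √(hsq α) * √(hsq β) * S.matNorm m x := by
  refine (hS.matNorm_sandwich_le α x β).trans ?_
  have := hS.matNorm_nonneg x
  gcongr
  · exact cstarNorm_mul_conjTranspose_self_le_hsq α
  · exact cstarNorm_conjTranspose_mul_self_le_hsq β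

lemma norm_apply_le_matNorm (x : Matrix (Fin n) (Fin n) X) (i j : Fin n) :
    ‖x i j‖ ≤ S.matNorm n x := by
  have h1 : single₁ (x i j) = sandwich (Matrix.single 0 i 1) x (Matrix.single j 0 1) := by
    ext a b
    obtain rfl := Subsingleton.elim a 0
    obtain rfl := Subsingleton.elim b 0
    simp [sandwich_apply, single₁, Matrix.single_apply]
  rw [← hS.matNorm_one, h1]
  refine (hS.matNorm_sandwich_le_hsq _ _ _).trans (le_of_eq ?_)
  simp

lemma matNorm_sum_le {ι : Type*} (s : Finset ι) (x : ι → Matrix (Fin n) (Fin n) X) :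
    S.matNorm n (∑ i ∈ s, x i) ≤ ∑ i ∈ s, S.matNorm n (x i) := by
  classical
  induction s using Finset.induction_on with
  | empty => simp [hS.matNorm_zero]
  | insert a s ha ih =>
    rw [Finset.sum_insert ha, Finset.sum_insert ha]
    exact (hS.matNorm_add_le n _ _).trans (by gcongr)

lemma matNorm_single_le (i j : Fin n) (x : X) : S.matNorm n (Matrix.single i j x) ≤ ‖x‖ := by
  have h1 : Matrix.single i j x =
      sandwich (Matrix.single i (0 : Fin 1) 1) (single₁ x) (Matrix.single (0 : Fin 1) j 1) := by
    ext a b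
    by_cases h : i = a <;> by_cases h' : j = b <;>
      simp [sandwich_apply, single₁, Matrix.single_apply, h, h']
  rw [h1, ← hS.matNorm_one]
  refine (hS.matNorm_sandwich_le_hsq _ _ _).trans (le_of_eq ?_)
  simp

lemma matNorm_le_sum (x : Matrix (Fin n) (Fin n) X) : S.matNorm n x ≤ ∑ i, ∑ j, ‖x i j‖ := by
  conv_lhs => rw [Matrix.matrix_eq_sum_single x]
  refine (hS.matNorm_sum_le _ _).trans (Finset.sum_le_sum fun i _ => ?_)
  refine (hS.matNorm_sum_le _ _).trans (Finset.sum_le_sum fun j _ => ?_)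
  exact hS.matNorm_single_le i j _

lemma adj_adj (x : Matrix (Fin m) (Fin n) X) : S.adj (S.adj x) = x := by
  ext; simp [hS.invol_invol]

lemma cone_sandwich {x : Matrix (Fin m) (Fin m) X} (hx : x ∈ S.cone m)
    (α : Matrix (Fin m) (Fin n) ℂ) : sandwich αᴴ x α ∈ S.cone n := by
  simpa using hS.cone_conj n m m x hx x hx α 0

lemma cone_add {x y : Matrix (Fin n) (Fin n) X} (hx : x ∈ S.cone n) (hy : y ∈ S.cone n) :
    x + y ∈ S.cone n := by
  simpa using hS.cone_conj n n n x hx y hy 1 1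

lemma cone_smul {x : Matrix (Fin n) (Fin n) X} (hx : x ∈ S.cone n) {c : ℝ} (hc : 0 ≤ c) :
    (c : ℂ) • x ∈ S.cone n := by
  have h := hS.cone_sandwich hx ((√c : ℂ) • (1 : Matrix (Fin n) (Fin n) ℂ))
  rw [conjTranspose_smul, smul_sandwich, sandwich_smul_right, conjTranspose_one,
    one_sandwich_one, smul_smul] at h
  convert h using 2
  simp [← Complex.ofReal_mul, Real.mul_self_sqrt hc]

lemma cone_sum {ι : Type*} (s : Finset ι) (x : ι → Matrix (Fin n) (Fin n) X)
    (h : ∀ i ∈ s, x i ∈ S.cone n) : ∑ i ∈ s, x i ∈ S.cone n := by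
  classical
  induction s using Finset.induction_on with
  | empty => simpa using hS.zero_mem_cone n
  | insert a s ha ih =>
    rw [Finset.sum_insert ha]
    exact hS.cone_add (h _ (Finset.mem_insert_self _ _))
      (ih fun i hi => h i (Finset.mem_insert_of_mem hi))

lemma norm_pair_le (f : Matrix (Fin n) (Fin n) (StrongDual ℂ X)) (x : Matrix (Fin n) (Fin n) X) :
    ‖pair f x‖ ≤ (∑ i, ∑ j, ‖f i j‖) * S.matNorm n x := by
  rw [Finset.sum_mul]
  refine (norm_sum_le _ _).trans (Finset.sum_le_sum fun i _ => ?_)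
  rw [Finset.sum_mul]
  refine (norm_sum_le _ _).trans (Finset.sum_le_sum fun j _ => ?_)
  exact (f i j).le_opNorm_of_le (hS.norm_apply_le_matNorm x i j)

end IsSMOS

/-! ### The matrix norm and the matrix cone of the dual -/

lemma sum_norm_sq_eq_hsq (η : Fin m × Fin n → ℂ) : ∑ i, ‖η i‖ ^ 2 = hsq (toMat η) :=
  Fintype.sum_prod_type _

lemma exists_toMat (A : Matrix (Fin m) (Fin n) ℂ) : ∃ η, toMat η = A :=
  ⟨fun p => A p.1 p.2, rfl⟩

lemma dual_matNorm_nonneg (S : MatrixOrderedData X)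
    (f : Matrix (Fin n) (Fin n) (StrongDual ℂ X)) :
    0 ≤ S.dual.matNorm n f := by
  refine Real.sSup_nonneg ?_
  rintro _ ⟨m, x, hx, rfl⟩
  exact cstarNorm_nonneg _

namespace IsSMOS

/-- The norm of `f^{(m)}(x)`, as the norm of a sesquilinear form on the space of `m × n`-matrices with
the Hilbert--Schmidt norm. -/
lemma cstarNorm_amplify_le_iff (f : Matrix (Fin n) (Fin n) (StrongDual ℂ X))
    (x : Matrix (Fin m) (Fin m) X) {c : ℝ} (hc : 0 ≤ c) :
    cstarNorm (amplify f x) ≤ c ↔ ∀ η ξ : Matrix (Fin m) (Fin n) ℂ,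
      ‖pair f (sandwich ηᴴ x ξ)‖ ≤ c * √(hsq η) * √(hsq ξ) := by
  constructor
  · intro h η ξ
    obtain ⟨η, rfl⟩ := exists_toMat η
    obtain ⟨ξ, rfl⟩ := exists_toMat ξ
    have := norm_dotProduct_le_cstarNorm (amplify f x) η ξ
    rw [dotProduct_amplify, sum_norm_sq_eq_hsq, sum_norm_sq_eq_hsq] at this
    exact this.trans (by gcongr)
  · intro h
    refine cstarNorm_le_of_forall _ hc fun η ξ => ?_
    rw [dotProduct_amplify, sum_norm_sq_eq_hsq, sum_norm_sq_eq_hsq]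
    exact h _ _

variable (hS : S.IsSMOS)
include hS

lemma bddAbove_dual_matNorm (f : Matrix (Fin n) (Fin n) (StrongDual ℂ X)) :
    BddAbove {r : ℝ | ∃ (m : ℕ) (x : Matrix (Fin m) (Fin m) X),
      S.matNorm m x ≤ 1 ∧ r = cstarNorm (amplify f x)} := by
  refine ⟨∑ i, ∑ j, ‖f i j‖, ?_⟩
  rintro _ ⟨m, x, hx, rfl⟩
  refine (cstarNorm_amplify_le_iff f x (by positivity)).2 fun η ξ => ?_
  refine (hS.norm_pair_le _ _).trans ?_
  have h1 := hS.matNorm_sandwich_le_hsq ηᴴ x ξ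
  rw [hsq_conjTranspose] at h1
  rw [mul_assoc]
  gcongr
  refine h1.trans (mul_le_of_le_one_right (by positivity) hx)

lemma norm_pair_sandwich_le (f : Matrix (Fin n) (Fin n) (StrongDual ℂ X))
    (α : Matrix (Fin n) (Fin m) ℂ) (x : Matrix (Fin m) (Fin m) X) (β : Matrix (Fin m) (Fin n) ℂ) :
    ‖pair f (sandwich α x β)‖ ≤ S.dual.matNorm n f * S.matNorm m x * √(hsq α) * √(hsq β) := by
  have key : ∀ y : Matrix (Fin m) (Fin m) X, S.matNorm m y ≤ 1 →
      ‖pair f (sandwich α y β)‖ ≤ S.dual.matNorm n f * √(hsq α) * √(hsq β) := fun y hy => by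
    have h1 : cstarNorm (amplify f y) ≤ S.dual.matNorm n f :=
      le_csSup (hS.bddAbove_dual_matNorm f) ⟨m, y, hy, rfl⟩
    have h2 := (cstarNorm_amplify_le_iff f y (S.dual_matNorm_nonneg f)).1 h1 αᴴ β
    rwa [conjTranspose_conjTranspose, hsq_conjTranspose] at h2
  rcases eq_or_lt_of_le (hS.matNorm_nonneg x) with h0 | h0
  · rw [(hS.matNorm_eq_zero_iff m x).1 h0.symm, hS.matNorm_zero]
    simp
  · have h1 := key (((S.matNorm m x)⁻¹ : ℝ) • x) (by
      rw [← Complex.coe_smul, hS.matNorm_real_smul, abs_of_pos (by positivity),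
        inv_mul_cancel₀ h0.ne'])
    rw [← Complex.coe_smul, sandwich_smul, pair_smul, norm_mul, Complex.norm_real,
      Real.norm_eq_abs, abs_of_pos (by positivity), inv_mul_le_iff₀ h0] at h1
    refine h1.trans (le_of_eq (by ring))

lemma dual_matNorm_le_iff (f : Matrix (Fin n) (Fin n) (StrongDual ℂ X)) {c : ℝ} (hc : 0 ≤ c) :
    S.dual.matNorm n f ≤ c ↔ ∀ (m : ℕ) (x : Matrix (Fin m) (Fin m) X)
      (η ξ : Matrix (Fin m) (Fin n) ℂ), S.matNorm m x ≤ 1 →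
      ‖pair f (sandwich ηᴴ x ξ)‖ ≤ c * √(hsq η) * √(hsq ξ) := by
  constructor
  · intro h m x η ξ hx
    refine (hS.norm_pair_sandwich_le f _ x _).trans ?_
    rw [hsq_conjTranspose]
    have := hS.matNorm_nonneg x
    gcongr
    calc S.dual.matNorm n f * S.matNorm m x ≤ c * 1 := by gcongr
      _ = c := mul_one c
  · intro h
    refine Real.sSup_le ?_ hc
    rintro _ ⟨m, x, hx, rfl⟩
    exact (cstarNorm_amplify_le_iff f x hc).2 fun η ξ => h m x η ξ hx

/-- It suffices to bound the real parts by arithmetic means. -/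
lemma dual_matNorm_le_of_re (f : Matrix (Fin n) (Fin n) (StrongDual ℂ X)) {c : ℝ} (hc : 0 ≤ c)
    (h : ∀ (m : ℕ) (x : Matrix (Fin m) (Fin m) X)
      (η ξ : Matrix (Fin m) (Fin n) ℂ), S.matNorm m x ≤ 1 →
      2 * (pair f (sandwich ηᴴ x ξ)).re ≤ c * (hsq η + hsq ξ)) : S.dual.matNorm n f ≤ c := by
  refine (hS.dual_matNorm_le_iff f hc).2 fun m x η ξ hx => ?_
  set z := pair f (sandwich ηᴴ x ξ) with hz
  -- rotate and rescale: `η ↦ a η`, `ξ ↦ b ξ` with `a b z = ‖z‖`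
  have key : ∀ r : ℝ, 0 < r → 2 * ‖z‖ ≤ c * (r ^ 2 * hsq η + (r⁻¹) ^ 2 * hsq ξ) := by
    intro r hr
    obtain ⟨w, hw, hwz⟩ : ∃ w : ℂ, ‖w‖ = 1 ∧ w * z = ‖z‖ := by
      rcases eq_or_ne z 0 with h0 | h0
      · exact ⟨1, by simp, by simp [h0]⟩
      · refine ⟨‖z‖ / z, by simp [h0], by field_simp⟩
    have h1 := h m x ((r : ℂ) • η) ((w * (r⁻¹ : ℝ)) • ξ) hx
    rw [conjTranspose_smul, smul_sandwich, sandwich_smul_right, pair_smul, pair_smul, ← hz,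
      hsq_smul, hsq_smul, norm_mul, hw, Complex.norm_real, Complex.norm_real] at h1
    have h2 : star (r : ℂ) * (w * ((r⁻¹ : ℝ) : ℂ) * z) = ‖z‖ := by
      rw [mul_right_comm w, hwz]
      have : (r : ℂ) ≠ 0 := by exact_mod_cast hr.ne'
      rw [Complex.ofReal_inv, Complex.star_def, Complex.conj_ofReal]
      field_simp
    rw [h2, Complex.ofReal_re] at h1
    simpa using h1
  exact le_mul_sqrt_of_forall_weight hc (hsq_nonneg η) (hsq_nonneg ξ) key

end IsSMOS

lemma amplify_isHermitian {f : Matrix (Fin n) (Fin n) (StrongDual ℂ X)}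
    (hf : S.dual.adj f = f) {x : Matrix (Fin m) (Fin m) X} (hx : S.adj x = x) :
    (amplify f x).IsHermitian := by
  ext p q
  have h1 : S.dual.adj f p.2 q.2 (x p.1 q.1) = star (f q.2 p.2 (S.invol (x p.1 q.1))) := rfl
  have h2 : S.invol (x p.1 q.1) = x q.1 p.1 := by
    conv_rhs => rw [← hx]
    rfl
  rw [hf, h2] at h1
  simpa [amplify] using h1.symm

/-- The positive elements of `M_n(X*)` are the positive functionals on `M_n(X)`. -/
lemma mem_dual_cone_iff (hS : S.IsSMOS) (f : Matrix (Fin n) (Fin n) (StrongDual ℂ X)) :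
    f ∈ S.dual.cone n ↔ S.dual.adj f = f ∧ ∀ x ∈ S.cone n, 0 ≤ (pair f x).re := by
  constructor
  · rintro ⟨h1, h2⟩
    refine ⟨h1, fun x hx => ?_⟩
    obtain ⟨η, hη⟩ := exists_toMat (1 : Matrix (Fin n) (Fin n) ℂ)
    have h3 := (h2 n x hx).re_dotProduct_nonneg η
    rw [dotProduct_amplify, hη] at h3
    simpa using h3
  · rintro ⟨h1, h2⟩
    refine ⟨h1, fun m x hx => ?_⟩
    have hh := amplify_isHermitian h1 (hS.cone_sa m x hx)
    refine PosSemidef.of_dotProduct_mulVec_nonneg hh fun ξ => ?_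
    rw [Complex.nonneg_iff]
    constructor
    · rw [dotProduct_amplify]
      exact h2 _ (hS.cone_sandwich hx _)
    · exact (hh.im_star_dotProduct_mulVec_self ξ).symm

lemma re_pair_nonneg (hS : S.IsSMOS) {f : Matrix (Fin n) (Fin n) (StrongDual ℂ X)}
    (hf : f ∈ S.dual.cone n) {x : Matrix (Fin n) (Fin n) X} (hx : x ∈ S.cone n) :
    0 ≤ (pair f x).re :=
  ((mem_dual_cone_iff hS f).1 hf).2 x hx

namespace IsSMOS

variable (hS : S.IsSMOS)
include hS

lemma dual_adj_adj (f : Matrix (Fin n) (Fin n) (StrongDual ℂ X)) : S.dual.adj (S.dual.adj f) = f := by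
  ext i j x
  have : S.dual.adj (S.dual.adj f) i j x = star (star (f i j (S.invol (S.invol x)))) := rfl
  rw [this, star_star, hS.invol_invol]

lemma dual_matNorm_one (f : StrongDual ℂ X) : S.dual.matNorm 1 (single₁ f) = ‖f‖ := by
  refine le_antisymm ?_ ?_
  · refine (hS.dual_matNorm_le_iff _ (norm_nonneg f)).2 fun m x η ξ hx => ?_
    refine (hS.norm_pair_le _ _).trans ?_
    have h1 := hS.matNorm_sandwich_le_hsq ηᴴ x ξ
    rw [hsq_conjTranspose] at h1
    simp only [single₁, Finset.univ_unique, Finset.sum_singleton, Matrix.of_apply]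
    rw [mul_assoc]
    gcongr
    refine h1.trans (mul_le_of_le_one_right (by positivity) hx)
  · refine ContinuousLinearMap.opNorm_le_bound _ (S.dual_matNorm_nonneg _) fun x => ?_
    have h1 := hS.norm_pair_sandwich_le (single₁ f) 1 (single₁ x) 1
    rw [one_sandwich_one, hS.matNorm_one] at h1
    simpa [pair, single₁, hsq] using h1

lemma dual_matNorm_eq_zero_iff (f : Matrix (Fin n) (Fin n) (StrongDual ℂ X)) : S.dual.matNorm n f = 0 ↔ f = 0 := by
  constructor
  · intro h
    ext i j x
    have h1 := hS.norm_pair_sandwich_le f 1 (Matrix.single i j x) 1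
    rw [h, one_sandwich_one] at h1
    have h2 : pair f (Matrix.single i j x) = f i j x := by
      simp only [pair, Matrix.single_apply]
      rw [Finset.sum_eq_single i (by intro k _ hk; simp [hk.symm]) (by simp),
        Finset.sum_eq_single j (by intro k _ hk; simp [hk.symm]) (by simp)]
      simp
    simpa [h2] using h1
  · rintro rfl
    refine le_antisymm ((hS.dual_matNorm_le_iff _ le_rfl).2 fun m x η ξ hx => ?_)
      (S.dual_matNorm_nonneg _)
    simp

lemma dual_matNorm_smul (c : ℂ) (f : Matrix (Fin n) (Fin n) (StrongDual ℂ X)) :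
    S.dual.matNorm n (c • f) = ‖c‖ * S.dual.matNorm n f := by
  have key : ∀ (c : ℂ) (f : Matrix (Fin n) (Fin n) (StrongDual ℂ X)),
      S.dual.matNorm n (c • f) ≤ ‖c‖ * S.dual.matNorm n f := fun c f => by
    have := S.dual_matNorm_nonneg f
    refine (hS.dual_matNorm_le_iff _ (by positivity)).2 fun m x η ξ hx => ?_
    rw [smul_pair, norm_mul, mul_assoc, mul_assoc]
    gcongr
    rw [← mul_assoc]
    exact (hS.dual_matNorm_le_iff _ this).1 le_rfl m x η ξ hx
  refine le_antisymm (key c f) ?_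
  rcases eq_or_ne c 0 with rfl | hc
  · simpa using S.dual_matNorm_nonneg _
  · have := key c⁻¹ (c • f)
    rw [smul_smul, inv_mul_cancel₀ hc, one_smul, norm_inv, ← div_eq_inv_mul,
      le_div_iff₀ (norm_pos_iff.2 hc)] at this
    linarith

lemma dual_matNorm_add_le (f g : Matrix (Fin n) (Fin n) (StrongDual ℂ X)) :
    S.dual.matNorm n (f + g) ≤ S.dual.matNorm n f + S.dual.matNorm n g := by
  have h1 := S.dual_matNorm_nonneg f
  have h2 := S.dual_matNorm_nonneg g
  refine (hS.dual_matNorm_le_iff _ (by positivity)).2 fun m x η ξ hx => ?_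
  rw [add_pair, add_mul, add_mul]
  refine (norm_add_le _ _).trans (add_le_add ?_ ?_)
  · exact (hS.dual_matNorm_le_iff _ h1).1 le_rfl m x η ξ hx
  · exact (hS.dual_matNorm_le_iff _ h2).1 le_rfl m x η ξ hx

/-- The operator space axiom for the dual: move the coefficients over to the Hilbert--Schmidt
matrices `η`, `ξ` and apply the Cauchy--Schwarz inequality. -/
lemma dual_ruan (f : Matrix (Fin m) (Fin m) (StrongDual ℂ X))
    (g : Matrix (Fin k) (Fin k) (StrongDual ℂ X))
    (α : Matrix (Fin n) (Fin m) ℂ) (β : Matrix (Fin m) (Fin n) ℂ)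
    (γ : Matrix (Fin n) (Fin k) ℂ) (δ : Matrix (Fin k) (Fin n) ℂ) :
    S.dual.matNorm n (sandwich α f β + sandwich γ g δ) ≤
      √(cstarNorm (α * αᴴ + γ * γᴴ)) * √(cstarNorm (βᴴ * β + δᴴ * δ)) *
        max (S.dual.matNorm m f) (S.dual.matNorm k g) := by
  set M := max (S.dual.matNorm m f) (S.dual.matNorm k g)
  have hM : 0 ≤ M := le_max_of_le_left (S.dual_matNorm_nonneg f)
  refine (hS.dual_matNorm_le_iff _ (by positivity)).2 fun r x η ξ hx => ?_
  rw [add_pair, sandwich_pair, sandwich_pair, sandwich_sandwich, sandwich_sandwich]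
  have h1 := hS.norm_pair_sandwich_le f (αᵀ * ηᴴ) x (ξ * βᵀ)
  have h2 := hS.norm_pair_sandwich_le g (γᵀ * ηᴴ) x (ξ * δᵀ)
  have h1' : ‖pair f (sandwich (αᵀ * ηᴴ) x (ξ * βᵀ))‖ ≤
      M * (√(hsq (αᵀ * ηᴴ)) * √(hsq (ξ * βᵀ))) := by
    refine h1.trans ?_
    rw [mul_assoc]
    gcongr
    calc S.dual.matNorm m f * S.matNorm r x ≤ M * 1 := by
          gcongr; exacts [hS.matNorm_nonneg _, le_max_left _ _]
      _ = M := mul_one _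
  have h2' : ‖pair g (sandwich (γᵀ * ηᴴ) x (ξ * δᵀ))‖ ≤
      M * (√(hsq (γᵀ * ηᴴ)) * √(hsq (ξ * δᵀ))) := by
    refine h2.trans ?_
    rw [mul_assoc]
    gcongr
    calc S.dual.matNorm k g * S.matNorm r x ≤ M * 1 := by
          gcongr; exacts [hS.matNorm_nonneg _, le_max_right _ _]
      _ = M := mul_one _
  have e1 : hsq (αᵀ * ηᴴ) + hsq (γᵀ * ηᴴ) ≤
      cstarNorm (α * αᴴ + γ * γᴴ) * hsq η := by
    have := hsq_add_hsq_mul_le α γ (ηᴴᵀ)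
    rwa [← hsq_transpose (_ * α), ← hsq_transpose (_ * γ), transpose_mul, transpose_mul,
      transpose_transpose, hsq_transpose, hsq_conjTranspose] at this
  have e2 : hsq (ξ * βᵀ) + hsq (ξ * δᵀ) ≤ cstarNorm (βᴴ * β + δᴴ * δ) * hsq ξ := by
    have := hsq_mul_add_hsq_mul_le β δ ξᵀ
    rwa [← hsq_transpose (β * _), ← hsq_transpose (δ * _), transpose_mul, transpose_mul,
      transpose_transpose, hsq_transpose] at this
  refine (norm_add_le _ _).trans ((add_le_add h1' h2').trans ?_)
  rw [← mul_add]
  have e3 := sqrt_mul_sqrt_add_le (hsq_nonneg (αᵀ * ηᴴ)) (hsq_nonneg (γᵀ * ηᴴ))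
    (hsq_nonneg (ξ * βᵀ)) (hsq_nonneg (ξ * δᵀ))
  calc M * _ ≤ M * (√(cstarNorm (α * αᴴ + γ * γᴴ) * hsq η) *
        √(cstarNorm (βᴴ * β + δᴴ * δ) * hsq ξ)) := by
        refine mul_le_mul_of_nonneg_left (e3.trans ?_) hM
        gcongr
    _ = _ := by
        rw [Real.sqrt_mul (cstarNorm_nonneg _), Real.sqrt_mul (cstarNorm_nonneg _)]
        ring

lemma dual_matNorm_adj (f : Matrix (Fin n) (Fin n) (StrongDual ℂ X)) : S.dual.matNorm n (S.dual.adj f) = S.dual.matNorm n f := by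
  have key : ∀ f : Matrix (Fin n) (Fin n) (StrongDual ℂ X),
      S.dual.matNorm n (S.dual.adj f) ≤ S.dual.matNorm n f := fun f => by
    refine (hS.dual_matNorm_le_iff _ (S.dual_matNorm_nonneg f)).2 fun m x η ξ hx => ?_
    rw [pair_dual_adj, norm_star, adj_sandwich]
    refine (hS.norm_pair_sandwich_le f _ _ _).trans ?_
    rw [hS.matNorm_adj, hsq_conjTranspose, hsq_conjTranspose, hsq_conjTranspose]
    have h0 := S.dual_matNorm_nonneg f
    rw [mul_right_comm]
    gcongr
    exact mul_le_of_le_one_right h0 hx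
  refine le_antisymm (key f) ?_
  have h2 := key (S.dual.adj f)
  rwa [hS.dual_adj_adj] at h2

lemma dual_cone_closed (f : Matrix (Fin n) (Fin n) (StrongDual ℂ X))
    (hf : ∀ ε > 0, ∃ g ∈ S.dual.cone n, S.dual.matNorm n (f - g) < ε) : f ∈ S.dual.cone n := by
  refine (mem_dual_cone_iff hS f).2 ⟨?_, fun x hx => ?_⟩
  · rw [← sub_eq_zero, ← hS.dual_matNorm_eq_zero_iff]
    refine le_antisymm (le_of_forall_pos_le_add fun ε hε => ?_) (S.dual_matNorm_nonneg _)
    obtain ⟨g, hg, hfg⟩ := hf (ε / 2) (by positivity)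
    have h1 : S.dual.adj f - f = S.dual.adj (f - g) + (-1 : ℂ) • (f - g) := by
      have : S.dual.adj g = g := hg.1
      have h2 : (-1 : ℂ) • (f - g) = -(f - g) := by ext; simp
      rw [adj_sub, this, h2]; abel
    rw [h1]
    refine (hS.dual_matNorm_add_le _ _).trans ?_
    rw [hS.dual_matNorm_adj, hS.dual_matNorm_smul]
    simp only [norm_neg, norm_one]
    linarith
  · have h0 := hS.matNorm_nonneg x
    set C := S.matNorm n x * √(hsq (1 : Matrix (Fin n) (Fin n) ℂ)) *
      √(hsq (1 : Matrix (Fin n) (Fin n) ℂ)) with hC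
    have hC0 : 0 ≤ C := by positivity
    refine le_of_forall_pos_le_add fun ε hε => ?_
    obtain ⟨g, hg, hfg⟩ := hf (ε / (C + 1)) (by positivity)
    have h1 := re_pair_nonneg hS hg hx
    have h2 := hS.norm_pair_sandwich_le (f - g) 1 x 1
    rw [one_sandwich_one, sub_pair, mul_assoc, mul_assoc, ← mul_assoc (S.matNorm n x), ← hC] at h2
    have h3 := (Complex.abs_re_le_norm _).trans h2
    rw [Complex.sub_re] at h3
    have h4 : S.dual.matNorm n (f - g) * C ≤ ε := by
      rw [lt_div_iff₀ (by positivity)] at hfg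
      nlinarith [S.dual_matNorm_nonneg (f - g)]
    linarith [(abs_le.1 (h3.trans h4)).1]

end IsSMOS

/-- The dual of a semi-matrix ordered operator space is again one. -/
theorem IsSMOS.dual (hS : S.IsSMOS) : S.dual.IsSMOS where
  invol_invol f := by
    ext x
    have : S.dual.invol (S.dual.invol f) x = star (star (f (S.invol (S.invol x)))) := rfl
    rw [this, star_star, hS.invol_invol]
  matNorm_one := hS.dual_matNorm_one
  matNorm_eq_zero_iff _ := hS.dual_matNorm_eq_zero_iff
  matNorm_smul _ := hS.dual_matNorm_smul
  matNorm_add_le _ := hS.dual_matNorm_add_le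
  ruan _ _ _ := hS.dual_ruan
  matNorm_adj _ := hS.dual_matNorm_adj
  cone_sa n f hf := hf.1
  zero_mem_cone n := (mem_dual_cone_iff hS _).2 ⟨by simp, by simp⟩
  cone_conj n m k f hf g hg α β := by
    rw [mem_dual_cone_iff hS] at hf hg ⊢
    constructor
    · rw [adj_add, adj_sandwich, adj_sandwich, hf.1, hg.1]; simp
    · intro x hx
      rw [add_pair, sandwich_pair, sandwich_pair, Complex.add_re]
      refine add_nonneg (hf.2 _ ?_) (hg.2 _ ?_)
      · exact hS.cone_sandwich (n := m) hx (αᵀ)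
      · exact hS.cone_sandwich (n := k) hx (βᵀ)
  cone_closed _ := hS.dual_cone_closed

lemma IsSMOS.bidual (hS : S.IsSMOS) : S.bidual.IsSMOS := hS.dual.dual

end Basics
end MatrixOrderedData

/-! ### Separation and norming functionals -/

/-- A form of the Hahn--Banach theorem.  The set `K` collects upper bounds: `(v, c) ∈ K` is to mean
`ℓ v ≤ c`.  If it is a cone that gives some bound for each `v` and no negative bound for `0`, then
there is a linear functional that satisfies all these bounds. -/
theorem exists_linearMap_le_of_cone {V : Type*} [AddCommGroup V] [Module ℝ V] (K : Set (V × ℝ))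
    (h0 : (0, 0) ∈ K) (hadd : ∀ p ∈ K, ∀ q ∈ K, p + q ∈ K)
    (hsmul : ∀ c : ℝ, 0 < c → ∀ p ∈ K, c • p ∈ K) (htot : ∀ v, ∃ c, (v, c) ∈ K)
    (hz : ∀ c, ((0 : V), c) ∈ K → 0 ≤ c) :
    ∃ ℓ : V →ₗ[ℝ] ℝ, ∀ v c, (v, c) ∈ K → ℓ v ≤ c := by
  let s : PointedCone ℝ (V × ℝ) :=
    { carrier := K
      add_mem' := fun {p q} hp hq => hadd p hp q hq
      zero_mem' := h0
      smul_mem' := fun c p hp => by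
        rcases eq_or_lt_of_le c.2 with hc | hc
        · have : c = 0 := Subtype.ext hc.symm
          rw [this, zero_smul]
          exact h0
        · exact hsmul c hc p hp }
  -- extend the functional `(0, c) ↦ c` to one that is nonnegative on `K`
  let f : (V × ℝ) →ₗ.[ℝ] ℝ :=
    ⟨LinearMap.ker (LinearMap.fst ℝ V ℝ), (LinearMap.snd ℝ V ℝ).comp (Submodule.subtype _)⟩
  obtain ⟨g, hg1, hg2⟩ := riesz_extension s f
    (fun ⟨⟨v, c⟩, hv⟩ hx => by
      obtain rfl : v = 0 := hv
      exact hz c hx)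
    (fun ⟨v, d⟩ => by
      obtain ⟨c, hc⟩ := htot v
      refine ⟨⟨(0, c - d), by simp [f]⟩, ?_⟩
      simpa [s] using hc)
  refine ⟨-(g.comp (LinearMap.inl ℝ V ℝ)), fun v c hvc => ?_⟩
  have h1 := hg2 (v, c) hvc
  have h2 : g (0, c) = c := hg1 ⟨(0, c), by simp [f]⟩
  have h3 : g (v, c) = g (v, 0) + g (0, c) := by rw [← map_add]; simp
  simp only [LinearMap.neg_apply, LinearMap.comp_apply, LinearMap.inl_apply]
  linarith

namespace MatrixOrderedData

open Matrix

variable {X : Type u} [NormedAddCommGroup X] [NormedSpace ℂ X] {S : MatrixOrderedData X}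
  {m n k : ℕ}

lemma pair_eq_sum_single (f : Matrix (Fin n) (Fin n) (StrongDual ℂ X))
    (ℓ : Matrix (Fin n) (Fin n) X →ₗ[ℝ] ℝ)
    (h : ∀ i j x, (f i j x).re = ℓ (Matrix.single i j x)) (y : Matrix (Fin n) (Fin n) X) :
    (pair f y).re = ℓ y := by
  conv_rhs => rw [Matrix.matrix_eq_sum_single y]
  simp only [pair, Complex.re_sum, map_sum, h]

/-- Bounded real functionals on `M_n(X)` are the real parts of elements of `M_n(X*)`. -/
lemma IsSMOS.exists_re_pair_eq (hS : S.IsSMOS) (ℓ : Matrix (Fin n) (Fin n) X →ₗ[ℝ] ℝ) (C : ℝ)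
    (h : ∀ y, ℓ y ≤ C * S.matNorm n y) :
    ∃ f : Matrix (Fin n) (Fin n) (StrongDual ℂ X), ∀ y, (pair f y).re = ℓ y := by
  have hC : ∀ y, |ℓ y| ≤ |C| * S.matNorm n y := fun y => by
    have h1 := h (-y)
    rw [hS.matNorm_neg, map_neg] at h1
    have h2 := mul_le_mul_of_nonneg_right (le_abs_self C) (hS.matNorm_nonneg y)
    exact abs_le.2 ⟨by linarith, (h y).trans h2⟩
  let g : Fin n → Fin n → StrongDual ℝ X := fun i j =>
    (ℓ.comp (Matrix.singleLinearMap ℝ i j)).mkContinuous |C| fun x => by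
      refine (hC _).trans ?_
      gcongr
      exact hS.matNorm_single_le i j x
  refine ⟨fun i j => StrongDual.extendRCLikeₗ (𝕜 := ℂ) (g i j), pair_eq_sum_single _ _ ?_⟩
  intro i j x
  rw [StrongDual.extendRCLikeₗ_apply]
  exact (StrongDual.re_extendRCLike_apply (𝕜 := ℂ) (g i j) x)

lemma re_smul_half_adj (f : Matrix (Fin n) (Fin n) (StrongDual ℂ X))
    (y : Matrix (Fin n) (Fin n) X) :
    (pair ((1 / 2 : ℂ) • (f + S.dual.adj f)) y).re =
      ((pair f y).re + (pair f (S.adj y)).re) / 2 := by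
  rw [smul_pair, add_pair, pair_dual_adj]
  simp; ring

/-- Bounded real functionals that are nonnegative on the cone yield positive elements of
`M_n(X*)`. -/
lemma IsSMOS.exists_mem_dual_cone (hS : S.IsSMOS) (ℓ : Matrix (Fin n) (Fin n) X →ₗ[ℝ] ℝ) (C : ℝ)
    (h : ∀ y, ℓ y ≤ C * S.matNorm n y) (hpos : ∀ y ∈ S.cone n, 0 ≤ ℓ y) :
    ∃ f ∈ S.dual.cone n, ∀ y, (pair f y).re = (ℓ y + ℓ (S.adj y)) / 2 := by
  obtain ⟨f, hf⟩ := hS.exists_re_pair_eq ℓ C h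
  have key : ∀ y, (pair ((1 / 2 : ℂ) • (f + S.dual.adj f)) y).re = (ℓ y + ℓ (S.adj y)) / 2 :=
    fun y => by rw [re_smul_half_adj, hf, hf]
  refine ⟨_, (mem_dual_cone_iff hS _).2 ⟨?_, fun x hx => ?_⟩, key⟩
  · rw [adj_smul, adj_add, hS.dual_adj_adj, add_comm]
    simp
  · rw [key, hS.cone_sa n x hx]
    linarith [hpos x hx]

/-- The matrix cone is determined by the positive elements of `M_n(X*)`. -/
theorem IsSMOS.mem_cone_of_forall_dual (hS : S.IsSMOS) {x₀ : Matrix (Fin n) (Fin n) X}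
    (hx₀ : S.adj x₀ = x₀) (h : ∀ f ∈ S.dual.cone n, 0 ≤ (pair f x₀).re) : x₀ ∈ S.cone n := by
  refine hS.cone_closed n x₀ ?_
  by_contra! hd
  obtain ⟨d, hd0, hd⟩ := hd
  -- `x₀` has distance at least `d` from the cone.  The cone `K` prescribes a functional of norm at
  -- most one that is nonnegative on the cone of `X` and at most `-d` at `x₀`.
  let K : Set (Matrix (Fin n) (Fin n) X × ℝ) := {q | ∃ p ∈ S.cone n, ∃ s : ℝ, 0 ≤ s ∧
    S.matNorm n (q.1 + p - (s : ℂ) • x₀) - s * d ≤ q.2}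
  obtain ⟨ℓ, hℓ⟩ := exists_linearMap_le_of_cone K
    ⟨0, hS.zero_mem_cone n, 0, le_rfl, by simp [hS.matNorm_zero]⟩
    (by
      rintro ⟨v, c⟩ ⟨p, hp, s, hs, hc⟩ ⟨v', c'⟩ ⟨p', hp', s', hs', hc'⟩
      refine ⟨p + p', hS.cone_add hp hp', s + s', by positivity, ?_⟩
      have h1 := hS.matNorm_add_le n (v + p - (s : ℂ) • x₀) (v' + p' - (s' : ℂ) • x₀)
      have h2 : v + p - (s : ℂ) • x₀ + (v' + p' - (s' : ℂ) • x₀) =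
        v + v' + (p + p') - ((s + s' : ℝ) : ℂ) • x₀ := by push_cast; module
      rw [h2] at h1
      simp only [Prod.mk_add_mk] at hc hc' ⊢
      linarith)
    (by
      rintro r hr ⟨v, c⟩ ⟨p, hp, s, hs, hc⟩
      refine ⟨(r : ℂ) • p, hS.cone_smul hp hr.le, r * s, by positivity, ?_⟩
      have h2 : r • v + (r : ℂ) • p - ((r * s : ℝ) : ℂ) • x₀ = (r : ℂ) • (v + p - (s : ℂ) • x₀) := by
        rw [← Complex.coe_smul]; push_cast; module
      simp only [Prod.smul_mk, smul_eq_mul] at hc ⊢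
      rw [h2, hS.matNorm_real_smul, abs_of_pos hr]
      nlinarith)
    (fun v => ⟨S.matNorm n v, 0, hS.zero_mem_cone n, 0, le_rfl, by simp⟩)
    (by
      rintro c ⟨p, hp, s, hs, hc⟩
      refine le_trans ?_ hc
      rcases eq_or_lt_of_le hs with rfl | hs
      · simp [hS.matNorm_nonneg]
      · have h1 := hd (((s⁻¹ : ℝ) : ℂ) • p) (hS.cone_smul hp (by positivity))
        have h2 : (0 : Matrix (Fin n) (Fin n) X) + p - (s : ℂ) • x₀ =
            ((-s : ℝ) : ℂ) • (x₀ - ((s⁻¹ : ℝ) : ℂ) • p) := by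
          rw [smul_sub, smul_smul, ← Complex.ofReal_mul]
          rw [neg_mul, mul_inv_cancel₀ hs.ne']
          push_cast; module
        simp only
        rw [h2, hS.matNorm_real_smul, abs_neg, abs_of_pos hs]
        nlinarith)
  obtain ⟨f, hf, hfℓ⟩ := hS.exists_mem_dual_cone ℓ 1
    (fun y => hℓ _ _ ⟨0, hS.zero_mem_cone n, 0, le_rfl, by simp⟩)
    (fun y hy => by
      have := hℓ (-y) 0 ⟨y, hy, 0, le_rfl, by simp [hS.matNorm_zero]⟩
      rw [map_neg] at this
      linarith)
  have h1 := h f hf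
  have h2 := hℓ x₀ (-d) ⟨0, hS.zero_mem_cone n, 1, zero_le_one, by simp [hS.matNorm_zero]⟩
  rw [hfℓ, hx₀] at h1
  linarith

/-- A norming functional for an element of `M_n(X)`. -/
lemma IsSMOS.exists_norming (hS : S.IsSMOS) (x₀ : Matrix (Fin n) (Fin n) X) :
    ∃ ℓ : Matrix (Fin n) (Fin n) X →ₗ[ℝ] ℝ, (∀ y, ℓ y ≤ S.matNorm n y) ∧
      S.matNorm n x₀ ≤ ℓ x₀ := by
  -- the bounds `ℓ v ≤ ‖v‖` and `ℓ (s x₀) ≤ s ‖x₀‖` for all real `s`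
  let K : Set (Matrix (Fin n) (Fin n) X × ℝ) := {q | ∃ s : ℝ,
    S.matNorm n (q.1 - (s : ℂ) • x₀) + s * S.matNorm n x₀ ≤ q.2}
  obtain ⟨ℓ, hℓ⟩ := exists_linearMap_le_of_cone K
    ⟨0, by simp [hS.matNorm_zero]⟩
    (by
      rintro ⟨v, c⟩ ⟨s, hc⟩ ⟨v', c'⟩ ⟨s', hc'⟩
      refine ⟨s + s', ?_⟩
      have h1 := hS.matNorm_add_le n (v - (s : ℂ) • x₀) (v' - (s' : ℂ) • x₀)
      have h2 : v - (s : ℂ) • x₀ + (v' - (s' : ℂ) • x₀) =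
        v + v' - ((s + s' : ℝ) : ℂ) • x₀ := by push_cast; module
      rw [h2] at h1
      simp only [Prod.mk_add_mk] at hc hc' ⊢
      linarith)
    (by
      rintro r hr ⟨v, c⟩ ⟨s, hc⟩
      refine ⟨r * s, ?_⟩
      have h2 : r • v - ((r * s : ℝ) : ℂ) • x₀ = (r : ℂ) • (v - (s : ℂ) • x₀) := by
        rw [← Complex.coe_smul]; push_cast; module
      simp only [Prod.smul_mk, smul_eq_mul] at hc ⊢
      rw [h2, hS.matNorm_real_smul, abs_of_pos hr]
      nlinarith)
    (fun v => ⟨S.matNorm n v, 0, by simp⟩)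
    (by
      rintro c ⟨s, hc⟩
      refine le_trans ?_ hc
      simp only
      rw [zero_sub, hS.matNorm_neg, hS.matNorm_real_smul, ← add_mul]
      have := neg_le_abs s
      exact mul_nonneg (by linarith) (hS.matNorm_nonneg _))
  refine ⟨ℓ, fun y => hℓ _ _ ⟨0, by simp⟩, ?_⟩
  have h2 := hℓ (-x₀) (-S.matNorm n x₀) ⟨-1, by simp [hS.matNorm_zero]⟩
  rw [map_neg] at h2
  linarith

end MatrixOrderedData

/-! ### The canonical embedding into the bidual -/

namespace Matrix

/-- The coordinate matrix `[1 0]` of size `n × (n + k)`. -/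
def inlMat (n k : ℕ) : Matrix (Fin n) (Fin (n + k)) ℂ :=
  Matrix.of fun i j => if j = Fin.castAdd k i then 1 else 0

/-- The coordinate matrix `[0 1]` of size `k × (n + k)`. -/
def inrMat (n k : ℕ) : Matrix (Fin k) (Fin (n + k)) ℂ :=
  Matrix.of fun i j => if j = Fin.natAdd n i then 1 else 0

section Coordinates

variable {n k : ℕ}

lemma castAdd_ne_natAdd (i : Fin n) (j : Fin k) : Fin.castAdd k i ≠ Fin.natAdd n j := by
  intro h
  have := congrArg Fin.val h
  simp at this
  omega

@[simp] lemma inlMat_conjTranspose : (inlMat n k)ᴴ = (inlMat n k)ᵀ := by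
  ext i j; simp [inlMat, apply_ite]

@[simp] lemma inrMat_conjTranspose : (inrMat n k)ᴴ = (inrMat n k)ᵀ := by
  ext i j; simp [inrMat, apply_ite]

@[simp] lemma inlMat_mul_transpose : inlMat n k * (inlMat n k)ᵀ = 1 := by
  ext i j
  simp [inlMat, mul_apply, one_apply, eq_comm]

@[simp] lemma inrMat_mul_transpose : inrMat n k * (inrMat n k)ᵀ = 1 := by
  ext i j
  simp [inrMat, mul_apply, one_apply, eq_comm]

@[simp] lemma inlMat_mul_inrMat_transpose : inlMat n k * (inrMat n k)ᵀ = 0 := by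
  ext i j
  simp [inlMat, inrMat, mul_apply, (castAdd_ne_natAdd _ _).symm]

@[simp] lemma inrMat_mul_inlMat_transpose : inrMat n k * (inlMat n k)ᵀ = 0 := by
  ext i j
  simp [inlMat, inrMat, mul_apply, castAdd_ne_natAdd]

lemma inlMat_add_inrMat :
    (inlMat n k)ᵀ * inlMat n k + (inrMat n k)ᵀ * inrMat n k = 1 := by
  ext i j
  refine Fin.addCases (fun i => ?_) (fun i => ?_) i <;>
  refine Fin.addCases (fun j => ?_) (fun j => ?_) j <;>
  simp [inlMat, inrMat, mul_apply, one_apply, castAdd_ne_natAdd, (castAdd_ne_natAdd _ _).symm]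

end Coordinates

open scoped Matrix.Norms.L2Operator in
lemma cstarNorm_add_le {ι : Type} [Fintype ι] [DecidableEq ι] (A B : Matrix ι ι ℂ) :
    cstarNorm (A + B) ≤ cstarNorm A + cstarNorm B := norm_add_le A B

open scoped Matrix.Norms.L2Operator in
lemma cstarNorm_smul {ι : Type} [Fintype ι] [DecidableEq ι] (c : ℂ) (A : Matrix ι ι ℂ) :
    cstarNorm (c • A) = ‖c‖ * cstarNorm A := norm_smul c A

open scoped Matrix.Norms.L2Operator in
lemma cstarNorm_one_le {ι : Type} [Fintype ι] [DecidableEq ι] :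
    cstarNorm (1 : Matrix ι ι ℂ) ≤ 1 := by
  refine ContinuousLinearMap.opNorm_le_bound _ zero_le_one fun x => ?_
  simp

@[simp] lemma cstarNorm_zero {ι : Type} [Fintype ι] [DecidableEq ι] :
    cstarNorm (0 : Matrix ι ι ℂ) = 0 := by simp [cstarNorm]

open scoped MatrixOrder Matrix.Norms.L2Operator in
lemma PosDef.exists_eq_conjTranspose_mul_self {n : ℕ} {P : Matrix (Fin n) (Fin n) ℂ}
    (hP : P.PosDef) : ∃ B : Matrix (Fin n) (Fin n) ℂ, IsUnit B.det ∧ P = Bᴴ * B := by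
  obtain ⟨B, hB⟩ := CStarAlgebra.nonneg_iff_eq_star_mul_self.mp hP.posSemidef.nonneg
  refine ⟨B, ?_, hB⟩
  have h1 := hP.isUnit
  rw [hB, Matrix.isUnit_iff_isUnit_det, det_mul] at h1
  exact isUnit_of_mul_isUnit_right h1

/-- A positive real functional on the matrix algebra is represented by a density matrix; after
adding a multiple of the trace, the density matrix is `B Bᴴ` with an invertible `B`. -/
lemma exists_density {n : ℕ} (p : Matrix (Fin n) (Fin n) ℂ →ₗ[ℝ] ℝ)
    (hp : ∀ v : Matrix (Fin n) (Fin 1) ℂ, 0 ≤ p (v * vᴴ)) {ε : ℝ} (hε : 0 < ε) :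
    ∃ B : Matrix (Fin n) (Fin n) ℂ, IsUnit B.det ∧ ∀ (m : ℕ) (α : Matrix (Fin n) (Fin m) ℂ),
      hsq (Bᴴ * α) = p (α * αᴴ) + ε * hsq α := by
  -- the density matrix of `p`: it is determined by `p A = Re tr (N A)`
  let N : Matrix (Fin n) (Fin n) ℂ := Matrix.of fun j i =>
    (p (Matrix.single i j 1) : ℂ) - Complex.I * (p (Matrix.single i j Complex.I) : ℂ)
  have hN : ∀ A, p A = ((N * A).trace).re := fun A => by
    conv_lhs => rw [Matrix.matrix_eq_sum_single A]
    simp only [trace, diag_apply, mul_apply, Complex.re_sum, map_sum]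
    rw [Finset.sum_comm]
    refine Finset.sum_congr rfl fun j _ => Finset.sum_congr rfl fun i _ => ?_
    have : Matrix.single i j (A i j) = (A i j).re • Matrix.single i j (1 : ℂ) +
        (A i j).im • Matrix.single i j Complex.I := by
      rw [Matrix.smul_single, Matrix.smul_single, ← Matrix.single_add]
      congr 1
      simp [Complex.re_add_im]
    rw [this, map_add, map_smul, map_smul]
    simp [N, Complex.mul_re]
    ring
  -- `p` is only evaluated at the self-adjoint matrices `α αᴴ`, where the hermitian part suffices
  let P : Matrix (Fin n) (Fin n) ℂ := (1 / 2 : ℂ) • (N + Nᴴ) + (ε : ℂ) • 1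
  have hP : ∀ (m : ℕ) (α : Matrix (Fin n) (Fin m) ℂ),
      ((αᴴ * P * α).trace).re = p (α * αᴴ) + ε * hsq α := fun m α => by
    have h1 : (αᴴ * Nᴴ * α).trace = star ((αᴴ * N * α).trace) := by
      rw [← trace_conjTranspose]
      simp [conjTranspose_mul, Matrix.mul_assoc]
    have h2 : p (α * αᴴ) = ((αᴴ * N * α).trace).re := by
      rw [hN, ← Matrix.mul_assoc, trace_mul_comm, Matrix.mul_assoc]
    rw [h2, hsq_eq_re_trace]
    simp only [P, Matrix.mul_add, Matrix.add_mul, Matrix.mul_smul, Matrix.smul_mul, trace_add,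
      trace_smul, Matrix.mul_one, h1]
    simp
    ring
  have hPh : P.IsHermitian := by
    simp only [P, Matrix.IsHermitian, conjTranspose_add, conjTranspose_smul,
      conjTranspose_conjTranspose, conjTranspose_one]
    rw [add_comm Nᴴ]
    simp
  have hPpos : P.PosDef := by
    refine PosDef.of_dotProduct_mulVec_pos hPh fun v hv => ?_
    rw [Complex.pos_iff]
    refine ⟨?_, (hPh.im_star_dotProduct_mulVec_self v).symm⟩
    let α : Matrix (Fin n) (Fin 1) ℂ := Matrix.of fun i _ => v i
    have h1 : star v ⬝ᵥ (P *ᵥ v) = (αᴴ * P * α).trace := by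
      simp only [trace, Matrix.mul_assoc]
      simp [α, dotProduct, mulVec, mul_apply]
    rw [h1, hP]
    refine add_pos_of_nonneg_of_pos (hp α) (mul_pos hε ?_)
    obtain ⟨i, hi⟩ := Function.ne_iff.1 hv
    have : 0 < ‖v i‖ ^ 2 := by have := norm_pos_iff.2 hi; positivity
    refine this.trans_le ?_
    simp only [hsq, α, Finset.univ_unique, Finset.sum_singleton, Matrix.of_apply]
    exact Finset.single_le_sum (f := fun i => ‖v i‖ ^ 2) (fun i _ => by positivity)
      (Finset.mem_univ i)
  obtain ⟨B, hBu, hB⟩ := hPpos.exists_eq_conjTranspose_mul_self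
  refine ⟨Bᴴ, ?_, fun m α => ?_⟩
  · rw [det_conjTranspose]
    exact hBu.star
  · rw [← hP, hB, conjTranspose_conjTranspose, hsq_eq_re_trace, conjTranspose_mul]
    simp only [Matrix.mul_assoc]

end Matrix

namespace MatrixOrderedData

open Matrix

variable {X : Type u} [NormedAddCommGroup X] [NormedSpace ℂ X] {S : MatrixOrderedData X}
  {m n k : ℕ}

/-- The direct sum `x ⊕ y` of matrices over `X`. -/
def dsum (x : Matrix (Fin m) (Fin m) X) (y : Matrix (Fin k) (Fin k) X) :
    Matrix (Fin (m + k)) (Fin (m + k)) X :=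
  sandwich (inlMat m k)ᵀ x (inlMat m k) + sandwich (inrMat m k)ᵀ y (inrMat m k)

lemma IsSMOS.matNorm_dsum_le (hS : S.IsSMOS) (x : Matrix (Fin m) (Fin m) X)
    (y : Matrix (Fin k) (Fin k) X) :
    S.matNorm (m + k) (dsum x y) ≤ max (S.matNorm m x) (S.matNorm k y) := by
  have h := hS.ruan (m + k) m k x y (inlMat m k)ᵀ (inlMat m k) (inrMat m k)ᵀ (inrMat m k)
  rw [← inlMat_conjTranspose, ← inrMat_conjTranspose, conjTranspose_conjTranspose,
    conjTranspose_conjTranspose, inlMat_conjTranspose, inrMat_conjTranspose,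
    inlMat_add_inrMat] at h
  refine h.trans ?_
  have h0 : 0 ≤ max (S.matNorm m x) (S.matNorm k y) := le_max_of_le_left (hS.matNorm_nonneg x)
  have h1 : √(cstarNorm (1 : Matrix (Fin (m + k)) (Fin (m + k)) ℂ)) ≤ 1 :=
    Real.sqrt_le_one.2 cstarNorm_one_le
  refine mul_le_of_le_one_left h0 ?_
  exact mul_le_one₀ h1 (Real.sqrt_nonneg _) h1

lemma sandwich_dsum (x : Matrix (Fin m) (Fin m) X) (y : Matrix (Fin k) (Fin k) X)
    (α : Matrix (Fin n) (Fin m) ℂ) (β : Matrix (Fin m) (Fin n) ℂ)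
    (γ : Matrix (Fin n) (Fin k) ℂ) (δ : Matrix (Fin k) (Fin n) ℂ) :
    sandwich (α * inlMat m k + γ * inrMat m k) (dsum x y)
      ((inlMat m k)ᵀ * β + (inrMat m k)ᵀ * δ) = sandwich α x β + sandwich γ y δ := by
  simp [dsum, sandwich_add, sandwich_sandwich, Matrix.add_mul, Matrix.mul_add, Matrix.mul_assoc,
    ← Matrix.mul_assoc (inlMat m k), ← Matrix.mul_assoc (inrMat m k)]

/-- A functional of norm at most one on `M_n(X)` is dominated by two functionals on the scalar
matrices, as in the proof of Ruan's representation theorem. -/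
lemma IsSMOS.exists_dominating (hS : S.IsSMOS) (ℓ : Matrix (Fin n) (Fin n) X →ₗ[ℝ] ℝ)
    (hℓ : ∀ y, ℓ y ≤ S.matNorm n y) :
    ∃ p q : Matrix (Fin n) (Fin n) ℂ →ₗ[ℝ] ℝ, (∀ A, p A ≤ cstarNorm A) ∧
      (∀ A, q A ≤ cstarNorm A) ∧
      ∀ (r : ℕ) (α : Matrix (Fin n) (Fin r) ℂ) (x : Matrix (Fin r) (Fin r) X)
        (β : Matrix (Fin r) (Fin n) ℂ), S.matNorm r x ≤ 1 →
        2 * ℓ (sandwich α x β) ≤ p (α * αᴴ) + q (βᴴ * β) := by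
  -- the bounds `p A ≤ ‖A‖`, `q B ≤ ‖B‖` and `-p (α αᴴ) - q (βᴴ β) ≤ -2 ℓ (α x β)`; the last ones form
  -- a convex set because the direct sum `x ⊕ x'` has norm at most one
  let K : Set ((Matrix (Fin n) (Fin n) ℂ × Matrix (Fin n) (Fin n) ℂ) × ℝ) :=
    {z | ∃ (r : ℕ) (α : Matrix (Fin n) (Fin r) ℂ) (x : Matrix (Fin r) (Fin r) X)
      (β : Matrix (Fin r) (Fin n) ℂ), S.matNorm r x ≤ 1 ∧
      cstarNorm (z.1.1 + α * αᴴ) + cstarNorm (z.1.2 + βᴴ * β) - 2 * ℓ (sandwich α x β) ≤ z.2}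
  obtain ⟨L, hL⟩ := exists_linearMap_le_of_cone K
    ⟨0, 0, 0, 0, by simp [hS.matNorm_zero], by simp⟩
    (by
      rintro ⟨⟨A, B⟩, c⟩ ⟨r, α, x, β, hx, hc⟩ ⟨⟨A', B'⟩, c'⟩ ⟨r', α', x', β', hx', hc'⟩
      refine ⟨r + r', α * inlMat r r' + α' * inrMat r r', dsum x x',
        (inlMat r r')ᵀ * β + (inrMat r r')ᵀ * β', (hS.matNorm_dsum_le x x').trans
        (max_le hx hx'), ?_⟩
      rw [sandwich_dsum, map_add]
      have e1 : (α * inlMat r r' + α' * inrMat r r') * (α * inlMat r r' + α' * inrMat r r')ᴴ =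
          α * αᴴ + α' * α'ᴴ := by
        simp [Matrix.add_mul, Matrix.mul_add, Matrix.mul_assoc, conjTranspose_mul,
          ← Matrix.mul_assoc (inlMat r r'), ← Matrix.mul_assoc (inrMat r r')]
      have e2 : ((inlMat r r')ᵀ * β + (inrMat r r')ᵀ * β')ᴴ *
          ((inlMat r r')ᵀ * β + (inrMat r r')ᵀ * β') = βᴴ * β + β'ᴴ * β' := by
        have t1 : ((inlMat r r')ᵀ)ᴴ = inlMat r r' := by
          rw [← inlMat_conjTranspose, conjTranspose_conjTranspose]
        have t2 : ((inrMat r r')ᵀ)ᴴ = inrMat r r' := by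
          rw [← inrMat_conjTranspose, conjTranspose_conjTranspose]
        simp [Matrix.add_mul, Matrix.mul_add, Matrix.mul_assoc, conjTranspose_mul, t1, t2,
          ← Matrix.mul_assoc (inlMat r r'), ← Matrix.mul_assoc (inrMat r r')]
      rw [e1, e2]
      have h1 := cstarNorm_add_le (A + α * αᴴ) (A' + α' * α'ᴴ)
      have h2 := cstarNorm_add_le (B + βᴴ * β) (B' + β'ᴴ * β')
      rw [add_add_add_comm] at h1 h2
      simp only [Prod.mk_add_mk] at hc hc' ⊢
      linarith)
    (by
      rintro s hs ⟨⟨A, B⟩, c⟩ ⟨r, α, x, β, hx, hc⟩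
      refine ⟨r, (√s : ℂ) • α, x, (√s : ℂ) • β, hx, ?_⟩
      have h0 : (√s : ℂ) * (√s : ℂ) = s := by
        rw [← Complex.ofReal_mul, Real.mul_self_sqrt hs.le]
      have e1 : s • A + ((√s : ℂ) • α) * ((√s : ℂ) • α)ᴴ = (s : ℂ) • (A + α * αᴴ) := by
        rw [conjTranspose_smul, Matrix.smul_mul, Matrix.mul_smul, smul_smul, Complex.star_def,
          Complex.conj_ofReal, h0, smul_add, Complex.coe_smul, Complex.coe_smul]
      have e2 : s • B + ((√s : ℂ) • β)ᴴ * ((√s : ℂ) • β) = (s : ℂ) • (B + βᴴ * β) := by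
        rw [conjTranspose_smul, Matrix.smul_mul, Matrix.mul_smul, smul_smul, Complex.star_def,
          Complex.conj_ofReal, h0, smul_add, Complex.coe_smul, Complex.coe_smul]
      simp only [Prod.smul_mk, smul_eq_mul] at hc ⊢
      rw [e1, e2, cstarNorm_smul, cstarNorm_smul, smul_sandwich, sandwich_smul_right, smul_smul, h0,
        Complex.coe_smul, map_smul, Complex.norm_real, Real.norm_eq_abs, abs_of_pos hs, smul_eq_mul]
      nlinarith)
    (fun v => ⟨cstarNorm v.1 + cstarNorm v.2, 0, 0, 0, 0, by simp [hS.matNorm_zero], by simp⟩)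
    (by
      rintro c ⟨r, α, x, β, hx, hc⟩
      refine le_trans ?_ hc
      simp only [Prod.fst_zero, Prod.snd_zero, zero_add]
      have h1 := (hℓ _).trans (hS.matNorm_sandwich_le α x β)
      have h2 := cstarNorm_nonneg (α * αᴴ)
      have h3 := cstarNorm_nonneg (βᴴ * β)
      have h4 : √(cstarNorm (α * αᴴ)) * √(cstarNorm (βᴴ * β)) * S.matNorm r x ≤
          √(cstarNorm (α * αᴴ)) * √(cstarNorm (βᴴ * β)) := mul_le_of_le_one_right (by positivity) hx
      nlinarith [Real.sq_sqrt h2, Real.sq_sqrt h3,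
        sq_nonneg (√(cstarNorm (α * αᴴ)) - √(cstarNorm (βᴴ * β)))])
  refine ⟨L.comp (LinearMap.inl ℝ _ _), L.comp (LinearMap.inr ℝ _ _), fun A => ?_, fun A => ?_,
    fun r α x β hx => ?_⟩
  · exact hL _ _ ⟨0, 0, 0, 0, by simp [hS.matNorm_zero], by simp⟩
  · exact hL _ _ ⟨0, 0, 0, 0, by simp [hS.matNorm_zero], by simp⟩
  · have h1 := hL (-(α * αᴴ), -(βᴴ * β)) (-(2 * ℓ (sandwich α x β))) ⟨r, α, x, β, hx, by simp⟩
    have h2 : L (-(α * αᴴ), -(βᴴ * β)) = -(L (α * αᴴ, 0) + L (0, βᴴ * β)) := by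
      rw [← map_add, ← map_neg]; simp
    simp only [LinearMap.comp_apply, LinearMap.inl_apply, LinearMap.inr_apply]
    linarith

/-- The canonical map into the bidual. -/
def toBidual (X : Type u) [NormedAddCommGroup X] [NormedSpace ℂ X] :
    X →ₗ[ℂ] StrongDual ℂ (StrongDual ℂ X) :=
  (NormedSpace.inclusionInDoubleDual ℂ X).toLinearMap

lemma pair_toBidual (x : Matrix (Fin n) (Fin n) X) (f : Matrix (Fin n) (Fin n) (StrongDual ℂ X)) :
    pair (x.map (toBidual X)) f = pair f x := rfl

lemma adj_toBidual (S : MatrixOrderedData X) (x : Matrix (Fin n) (Fin n) X) :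
    S.bidual.adj (x.map (toBidual X)) = (S.adj x).map (toBidual X) := by
  ext i j f
  have : S.bidual.adj (x.map (toBidual X)) i j f = star (star (f (S.invol (x j i)))) := rfl
  rw [this, star_star]
  rfl

/-- The canonical map into the bidual is a complete isometry. -/
theorem IsSMOS.bidual_matNorm_toBidual (hS : S.IsSMOS) (x₀ : Matrix (Fin n) (Fin n) X) :
    S.bidual.matNorm n (x₀.map (toBidual X)) = S.matNorm n x₀ := by
  have hD := hS.dual
  refine le_antisymm ?_ ?_
  · refine (hD.dual_matNorm_le_iff _ (hS.matNorm_nonneg _)).2 fun m f η ξ hf => ?_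
    rw [pair_toBidual, sandwich_pair]
    refine (hS.norm_pair_sandwich_le f _ _ _).trans ?_
    rw [hsq_transpose, hsq_transpose, hsq_conjTranspose]
    have := hS.matNorm_nonneg x₀
    gcongr
    exact mul_le_of_le_one_left this hf
  · obtain ⟨ℓ, hℓ, hx₀⟩ := hS.exists_norming x₀
    obtain ⟨f₀, hf₀⟩ := hS.exists_re_pair_eq ℓ 1 (by simpa using hℓ)
    obtain ⟨p, q, hp, hq, hpq⟩ := hS.exists_dominating ℓ hℓ
    have hp0 : ∀ v : Matrix (Fin n) (Fin 1) ℂ, 0 ≤ p (v * vᴴ) := fun v => by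
      have := hpq 1 v 0 0 (by simp [hS.matNorm_zero])
      simpa using this
    have hq0 : ∀ v : Matrix (Fin n) (Fin 1) ℂ, 0 ≤ q (v * vᴴ) := fun v => by
      have := hpq 1 0 0 vᴴ (by simp [hS.matNorm_zero])
      simpa using this
    set M := S.bidual.matNorm n (x₀.map (toBidual X)) with hM
    have hM0 : 0 ≤ M := hS.bidual.matNorm_nonneg _
    -- With density matrices `B Bᴴ` and `C Cᴴ` of `p` and `q`, perturbed by `ε`, the functional
    -- `f y = f₀ (B⁻ᴴ y C⁻¹)` is a complete contraction, and `x₀` is evaluated as `f (Bᴴ x₀ C)`.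
    have key : ∀ ε : ℝ, 0 < ε →
        S.matNorm n x₀ ≤ M * (1 + ε * hsq (1 : Matrix (Fin n) (Fin n) ℂ)) := fun ε hε => by
      obtain ⟨B, hBu, hB⟩ := exists_density p hp0 hε
      obtain ⟨C, hCu, hC⟩ := exists_density q hq0 hε
      have hBH : IsUnit (Bᴴ).det := by rw [det_conjTranspose]; exact hBu.star
      set f := sandwich ((Bᴴ)⁻¹)ᵀ f₀ (C⁻¹)ᵀ with hf
      have hpf : ∀ y, pair f y = pair f₀ (sandwich (Bᴴ)⁻¹ y C⁻¹) := fun y => by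
        rw [hf, pair_sandwich]
      have hf1 : S.dual.matNorm n f ≤ 1 := by
        refine hS.dual_matNorm_le_of_re f zero_le_one fun m x η ξ hx => ?_
        rw [hpf, sandwich_sandwich, hf₀]
        refine (hpq _ _ _ _ hx).trans ?_
        have h1 := hB m ((Bᴴ)⁻¹ * ηᴴ)
        have h2 := hC m (ξ * C⁻¹)ᴴ
        rw [← Matrix.mul_assoc, Matrix.mul_nonsing_inv _ hBH, Matrix.one_mul,
          hsq_conjTranspose] at h1
        rw [← conjTranspose_mul, hsq_conjTranspose, Matrix.mul_assoc,
          Matrix.nonsing_inv_mul _ hCu, Matrix.mul_one, conjTranspose_conjTranspose] at h2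
        nlinarith [hsq_nonneg ((Bᴴ)⁻¹ * ηᴴ), hsq_nonneg (ξ * C⁻¹)ᴴ]
      have h3 : ℓ x₀ = (pair (x₀.map (toBidual X)) (sandwich (Bᴴ)ᵀ f Cᵀ)).re := by
        rw [pair_toBidual, sandwich_pair, transpose_transpose, transpose_transpose, hpf,
          sandwich_sandwich, Matrix.nonsing_inv_mul _ hBH, Matrix.mul_nonsing_inv _ hCu,
          one_sandwich_one, hf₀]
      have h4 := hD.norm_pair_sandwich_le (x₀.map (toBidual X)) (Bᴴ)ᵀ f Cᵀ
      rw [hsq_transpose, hsq_transpose, hsq_conjTranspose] at h4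
      have h1 : hsq B ≤ 1 + ε * hsq (1 : Matrix (Fin n) (Fin n) ℂ) := by
        have := hB n 1
        rw [Matrix.mul_one, hsq_conjTranspose, conjTranspose_one, Matrix.mul_one] at this
        rw [this]
        gcongr
        exact (hp 1).trans cstarNorm_one_le
      have h2 : hsq C ≤ 1 + ε * hsq (1 : Matrix (Fin n) (Fin n) ℂ) := by
        have := hC n 1
        rw [Matrix.mul_one, hsq_conjTranspose, conjTranspose_one, Matrix.mul_one] at this
        rw [this]
        gcongr
        exact (hq 1).trans cstarNorm_one_le
      set c := 1 + ε * hsq (1 : Matrix (Fin n) (Fin n) ℂ)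
      have hc : 0 ≤ c := (hsq_nonneg B).trans h1
      calc S.matNorm n x₀ ≤ ℓ x₀ := hx₀
        _ ≤ M * S.dual.matNorm n f * √(hsq B) * √(hsq C) := by
            rw [h3]; exact (Complex.re_le_norm _).trans h4
        _ ≤ M * 1 * √c * √c := by gcongr
        _ = M * c := by rw [mul_one, mul_assoc, Real.mul_self_sqrt hc]
    have h2 : Tendsto (fun ε : ℝ => M * (1 + ε * hsq (1 : Matrix (Fin n) (Fin n) ℂ))) (𝓝[>] 0)
        (𝓝 M) := by
      have : Continuous fun ε : ℝ => M * (1 + ε * hsq (1 : Matrix (Fin n) (Fin n) ℂ)) := by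
        fun_prop
      simpa using (this.tendsto 0).mono_left nhdsWithin_le_nhds
    exact ge_of_tendsto h2 (eventually_mem_nhdsWithin.mono key)

/-- The canonical map into the bidual is an order embedding: the forward direction is formal, and the
other one is the separation theorem. -/
lemma IsSMOS.mem_cone_iff_toBidual (hS : S.IsSMOS) {x : Matrix (Fin n) (Fin n) X}
    (hx : S.adj x = x) : x ∈ S.cone n ↔ x.map (toBidual X) ∈ S.bidual.cone n := by
  constructor
  · intro h
    refine (mem_dual_cone_iff hS.dual _).2 ⟨?_, fun f hf => ?_⟩
    · exact (adj_toBidual S x).trans (by rw [hx])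
    · exact re_pair_nonneg hS hf h
  · intro h
    refine hS.mem_cone_of_forall_dual hx fun f hf => ?_
    exact re_pair_nonneg hS.dual h hf

end MatrixOrderedData

namespace MatrixOrderedData

open Matrix

section UnitBlock

variable {X : Type u} [NormedAddCommGroup X] [NormedSpace ℂ X] (S : MatrixOrderedData X)
  {m n k : ℕ}

section Entries

variable (t : ℝ) (a : X) (x : Matrix (Fin n) (Fin n) X) (i j : Fin n)

lemma unitBlock_castAdd_castAdd : S.unitBlock t a x (Fin.castAdd n i) (Fin.castAdd n j) =
    if i = j then (t : ℂ) • a else 0 := by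
  simp [unitBlock, Matrix.diagonal_apply, -Fin.natAdd_eq_addNat]

lemma unitBlock_castAdd_natAdd :
    S.unitBlock t a x (Fin.castAdd n i) (Fin.natAdd n j) = x i j := by
  simp [unitBlock, -Fin.natAdd_eq_addNat]

lemma unitBlock_natAdd_castAdd :
    S.unitBlock t a x (Fin.natAdd n i) (Fin.castAdd n j) = S.invol (x j i) := by
  simp [unitBlock, -Fin.natAdd_eq_addNat]

lemma unitBlock_natAdd_natAdd : S.unitBlock t a x (Fin.natAdd n i) (Fin.natAdd n j) =
    if i = j then (t : ℂ) • a else 0 := by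
  simp [unitBlock, Matrix.diagonal_apply, -Fin.natAdd_eq_addNat]

end Entries

/-- The matrix `[0, x; x*, 0]`. -/
def offDiag (x : Matrix (Fin n) (Fin n) X) : Matrix (Fin (n + n)) (Fin (n + n)) X :=
  sandwich (inlMat n n)ᵀ x (inrMat n n) + sandwich (inrMat n n)ᵀ (S.adj x) (inlMat n n)

lemma unitBlock_eq (t : ℝ) (a : X) (x : Matrix (Fin n) (Fin n) X) :
    S.unitBlock t a x = (t : ℂ) • Matrix.diagonal (fun _ => a) + S.offDiag x := by
  ext i j
  refine Fin.addCases (fun i => ?_) (fun i => ?_) i <;>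
  refine Fin.addCases (fun j => ?_) (fun j => ?_) j <;>
  simp [unitBlock_castAdd_castAdd, unitBlock_castAdd_natAdd, unitBlock_natAdd_castAdd,
    unitBlock_natAdd_natAdd, offDiag, sandwich_apply, inlMat, inrMat, castAdd_ne_natAdd,
    (castAdd_ne_natAdd _ _).symm, Matrix.diagonal_apply, Matrix.smul_apply,
    Finset.sum_ite_eq, -Fin.natAdd_eq_addNat]

variable {S}

lemma adj_diagonal {a : X} (ha : S.invol a = a) :
    S.adj (Matrix.diagonal fun _ : Fin n => a) = Matrix.diagonal fun _ => a := by
  ext i j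
  simp only [adj_apply, Matrix.diagonal_apply, apply_ite S.invol, ha, map_zero, eq_comm]

lemma transpose_inl_conj : ((inlMat n k)ᵀ)ᴴ = inlMat n k := by
  rw [← inlMat_conjTranspose, conjTranspose_conjTranspose]

lemma transpose_inr_conj : ((inrMat n k)ᵀ)ᴴ = inrMat n k := by
  rw [← inrMat_conjTranspose, conjTranspose_conjTranspose]

lemma adj_offDiag (hS : S.IsSMOS) (x : Matrix (Fin n) (Fin n) X) :
    S.adj (S.offDiag x) = S.offDiag x := by
  simp [offDiag, adj_add, adj_sandwich, hS.adj_adj, transpose_inl_conj, transpose_inr_conj,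
    add_comm]

lemma adj_unitBlock (hS : S.IsSMOS) (t : ℝ) {a : X} (ha : S.invol a = a)
    (x : Matrix (Fin n) (Fin n) X) : S.adj (S.unitBlock t a x) = S.unitBlock t a x := by
  rw [unitBlock_eq, adj_add, adj_real_smul, adj_diagonal ha, adj_offDiag hS]

lemma pair_eq_star {f : Matrix (Fin n) (Fin n) (StrongDual ℂ X)} (hf : S.dual.adj f = f)
    (x : Matrix (Fin n) (Fin n) X) : pair f (S.adj x) = star (pair f x) := by
  have := pair_dual_adj S f x
  rw [hf] at this
  rw [this, star_star]

lemma pair_diagonal (f : Matrix (Fin n) (Fin n) (StrongDual ℂ X)) (a : X) :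
    pair f (Matrix.diagonal fun _ => a) = ∑ i, f i i a := by
  simp [pair, Matrix.diagonal_apply, apply_ite]

lemma diagonal_pair (f : StrongDual ℂ X) (x : Matrix (Fin n) (Fin n) X) :
    pair (Matrix.diagonal fun _ => f) x = ∑ i, f (x i i) := by
  unfold pair
  refine Finset.sum_congr rfl fun i _ => ?_
  rw [Finset.sum_eq_single i (by intro j _ hj; simp [hj.symm]) (by simp)]
  simp

/-- The value of a self-adjoint functional at `[t a, x; x*, t a]`. -/
lemma re_pair_unitBlock {f : Matrix (Fin (n + n)) (Fin (n + n)) (StrongDual ℂ X)}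
    (hf : S.dual.adj f = f) (t : ℝ) (a : X) (x : Matrix (Fin n) (Fin n) X) :
    (pair f (S.unitBlock t a x)).re =
      t * ∑ i, (f i i a).re + 2 * (pair (sandwich (inlMat n n) f (inrMat n n)ᵀ) x).re := by
  have h1 : S.offDiag x = sandwich (inlMat n n)ᵀ x (inrMat n n) +
      S.adj (sandwich (inlMat n n)ᵀ x (inrMat n n)) := by
    rw [offDiag, adj_sandwich, transpose_inl_conj, inrMat_conjTranspose]
  rw [unitBlock_eq, pair_add, pair_smul, pair_diagonal, h1, pair_add, pair_eq_star hf,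
    pair_sandwich, transpose_transpose, Complex.add_re, Complex.add_re, Complex.re_ofReal_mul,
    Complex.re_sum, Complex.star_def, Complex.conj_re]
  ring

/-- The value of `[t e, φ; φ*, t e]` over the dual space at a self-adjoint matrix. -/
lemma re_unitBlock_pair {x : Matrix (Fin (n + n)) (Fin (n + n)) X}
    (hx : S.adj x = x) (t : ℝ) (e : StrongDual ℂ X) (φ : Matrix (Fin n) (Fin n) (StrongDual ℂ X)) :
    (pair (S.dual.unitBlock t e φ) x).re =
      t * ∑ i, (e (x i i)).re + 2 * (pair φ (sandwich (inlMat n n) x (inrMat n n)ᵀ)).re := by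
  have h1 : S.dual.offDiag φ = sandwich (inlMat n n)ᵀ φ (inrMat n n) +
      S.dual.adj (sandwich (inlMat n n)ᵀ φ (inrMat n n)) := by
    rw [offDiag, adj_sandwich, transpose_inl_conj, inrMat_conjTranspose]
  rw [unitBlock_eq, add_pair, smul_pair, diagonal_pair, h1, add_pair, pair_dual_adj, hx,
    sandwich_pair, transpose_transpose, Complex.add_re, Complex.add_re, Complex.re_ofReal_mul,
    Complex.re_sum, Complex.star_def, Complex.conj_re]
  ring

lemma sandwich_single₁ (a : X) (v : Matrix (Fin n) (Fin 1) ℂ) (w : Matrix (Fin 1) (Fin n) ℂ) :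
    sandwich v (single₁ a) w = Matrix.of fun i j => (v i 0 * w 0 j) • a := by
  ext i j; simp [sandwich_apply, single₁]

/-- Compression of a positive functional to a vector. -/
def compress (f : Matrix (Fin n) (Fin n) X) (v : Matrix (Fin n) (Fin 1) ℂ) : X :=
  sandwich vᴴ f v 0 0

lemma single₁_compress (f : Matrix (Fin n) (Fin n) X) (v : Matrix (Fin n) (Fin 1) ℂ) :
    single₁ (compress f v) = sandwich vᴴ f v := by
  ext i j
  obtain rfl := Subsingleton.elim i 0
  obtain rfl := Subsingleton.elim j 0
  rfl

lemma compress_mem (hS : S.IsSMOS) {f : Matrix (Fin n) (Fin n) X} (hf : f ∈ S.cone n)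
    (v : Matrix (Fin n) (Fin 1) ℂ) : compress f v ∈ S.posCone := by
  change single₁ _ ∈ S.cone 1
  rw [single₁_compress]
  exact hS.cone_sandwich hf v

lemma apply_mem_posCone (hS : S.IsSMOS) {f : Matrix (Fin n) (Fin n) X} (hf : f ∈ S.cone n)
    (i : Fin n) : f i i ∈ S.posCone := by
  have h := compress_mem hS hf (Matrix.single i 0 1)
  convert h using 1
  unfold compress
  rw [sandwich_apply]
  rw [Finset.sum_eq_single i (by intro j _ hj; simp [hj.symm]) (by simp),
    Finset.sum_eq_single i (by intro j _ hj; simp [hj.symm]) (by simp)]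
  simp

lemma invol_of_mem_posCone (hS : S.IsSMOS) {a : X} (ha : a ∈ S.posCone) : S.invol a = a :=
  congrFun (congrFun (hS.cone_sa 1 _ ha) 0) 0

lemma pair_single₁ (f : StrongDual ℂ X) (x : X) : pair (single₁ f) (single₁ x) = f x := by
  simp [pair, single₁]

lemma re_apply_nonneg (hS : S.IsSMOS) {f : StrongDual ℂ X} (hf : f ∈ S.dual.posCone) {x : X}
    (hx : x ∈ S.posCone) : 0 ≤ (f x).re := by
  rw [← pair_single₁]
  exact re_pair_nonneg hS hf hx

lemma add_mem_posCone (hS : S.IsSMOS) {x y : X} (hx : x ∈ S.posCone) (hy : y ∈ S.posCone) :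
    x + y ∈ S.posCone := by
  have := hS.cone_add hx hy
  exact this

lemma smul_mem_posCone (hS : S.IsSMOS) {x : X} (hx : x ∈ S.posCone) {c : ℝ} (hc : 0 ≤ c) :
    (c : ℂ) • x ∈ S.posCone := by
  have := hS.cone_smul hx hc
  exact this

lemma zero_mem_posCone (hS : S.IsSMOS) : (0 : X) ∈ S.posCone := by
  have := hS.zero_mem_cone 1
  exact this

/-- `I_n ⊗ a` is positive if `a` is. -/
lemma diagonal_mem_cone (hS : S.IsSMOS) {a : X} (ha : a ∈ S.posCone) :
    Matrix.diagonal (fun _ : Fin n => a) ∈ S.cone n := by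
  have h : Matrix.diagonal (fun _ : Fin n => a) =
      ∑ i : Fin n, sandwich (Matrix.single 0 i 1)ᴴ (single₁ a) (Matrix.single 0 i 1) := by
    ext j l
    rw [Matrix.sum_apply]
    simp only [sandwich_single₁, Matrix.of_apply, conjTranspose_apply, Matrix.single_apply]
    by_cases h : j = l
    · subst h; simp
    · simp only [Matrix.diagonal_apply, h, if_false]
      refine (Finset.sum_eq_zero fun i _ => ?_).symm
      by_cases hi : i = j
      · subst hi; simp [h]
      · simp [hi]
  rw [h]
  exact hS.cone_sum _ _ fun i _ => hS.cone_sandwich ha _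

/-- The unit element of the bidual, as seen from `X`: an element `e` of the unit ball of `X**` such
that the norm of `x ∈ M_n(X)` is the smallest `t ≥ 0` with `[t e, x; x*, t e] ≥ 0`. -/
structure IsBidualUnit (S : MatrixOrderedData X) (e : StrongDual ℂ (StrongDual ℂ X)) : Prop where
  norm_le_one : ‖e‖ ≤ 1
  matNorm_le_iff : ∀ (n : ℕ) (x : Matrix (Fin n) (Fin n) X) (t : ℝ), 0 ≤ t →
    (S.matNorm n x ≤ t ↔
      S.bidual.unitBlock t e (x.map (toBidual X)) ∈ S.bidual.cone (n + n))

end UnitBlock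

/-! ### Operators on a Hilbert space -/

section BlockOp

variable {H : Type u} [NormedAddCommGroup H] [InnerProductSpace ℂ H] {n : ℕ}

lemma blockOp_apply (T : Matrix (Fin n) (Fin n) (H →L[ℂ] H)) (ξ : PiLp 2 fun _ : Fin n => H)
    (i : Fin n) : blockOp T ξ i = ∑ j, T i j (ξ j) := by
  simp [blockOp]

lemma inner_blockOp (T : Matrix (Fin n) (Fin n) (H →L[ℂ] H)) (η ξ : PiLp 2 fun _ : Fin n => H) :
    inner ℂ η (blockOp T ξ) = ∑ i, ∑ j, inner ℂ (η i) (T i j (ξ j)) := by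
  simp only [PiLp.inner_apply, blockOp_apply, inner_sum]

lemma blockOp_isPositive_iff {T : Matrix (Fin n) (Fin n) (H →L[ℂ] H)} :
    (blockOp T).IsPositive ↔ ∀ ξ, 0 ≤ inner ℂ ξ (blockOp T ξ) := by
  constructor
  · exact fun h ξ => h.inner_nonneg_right ξ
  · intro h
    rw [← ContinuousLinearMap.isPositive_toLinearMap_iff, LinearMap.isPositive_iff_complex]
    intro ξ
    have h2 := Complex.nonneg_iff.1 (h ξ)
    have h3 : inner ℂ (blockOp T ξ) ξ = inner ℂ ξ (blockOp T ξ) := by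
      rw [← inner_conj_symm, Complex.conj_eq_iff_im]
      exact h2.2.symm
    change (((inner ℂ (blockOp T ξ) ξ).re : ℝ) : ℂ) = inner ℂ (blockOp T ξ) ξ ∧
      0 ≤ (inner ℂ (blockOp T ξ) ξ).re
    rw [h3]
    exact ⟨Complex.ext rfl h2.2, h2.1⟩

/-- The operator norm through arithmetic means; compare `dual_matNorm_le_of_re`. -/
lemma opNorm_le_iff_re_inner {E : Type*} [NormedAddCommGroup E] [InnerProductSpace ℂ E]
    (T : E →L[ℂ] E) {t : ℝ} (ht : 0 ≤ t) :
    ‖T‖ ≤ t ↔ ∀ η ξ, 2 * (inner ℂ η (T ξ)).re ≤ t * (‖η‖ ^ 2 + ‖ξ‖ ^ 2) := by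
  constructor
  · intro h η ξ
    have h1 : (inner ℂ η (T ξ)).re ≤ ‖η‖ * (t * ‖ξ‖) :=
      (Complex.re_le_norm _).trans ((norm_inner_le_norm _ _).trans (by
        gcongr; exact T.le_of_opNorm_le h ξ))
    nlinarith [mul_nonneg ht (sq_nonneg (‖η‖ - ‖ξ‖))]
  · intro h
    refine ContinuousLinearMap.opNorm_le_of_re_inner_le ht fun ξ η hξ hη => ?_
    have h1 := h η ξ
    rw [hξ, hη] at h1
    rw [← inner_conj_symm, RCLike.conj_re]
    simp only [RCLike.re_to_complex]
    linarith

end BlockOp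

end MatrixOrderedData

namespace MatrixOrderedData

open Matrix

/-- The value of `[t, T; T*, t]` at a vector of `Hⁿ ⊕ Hⁿ`. -/
lemma inner_blockOp_unitBlock {H : Type u} [NormedAddCommGroup H] [InnerProductSpace ℂ H]
    [CompleteSpace H] {n : ℕ} (t : ℝ) (T : Matrix (Fin n) (Fin n) (H →L[ℂ] H))
    (ξ η : PiLp 2 fun _ : Fin n => H) :
    inner ℂ (WithLp.toLp 2 (Fin.append ξ η : Fin (n + n) → H))
      (blockOp ((boundedOperators H).unitBlock t (ContinuousLinearMap.id ℂ H) T)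
        (WithLp.toLp 2 (Fin.append ξ η : Fin (n + n) → H))) =
      ((t * (‖ξ‖ ^ 2 + ‖η‖ ^ 2) + 2 * (inner ℂ ξ (blockOp T η)).re : ℝ) : ℂ) := by
  have hinv : ∀ A : H →L[ℂ] H, (boundedOperators H).invol A = ContinuousLinearMap.adjoint A :=
    fun A => rfl
  have h1 : ∀ ζ : PiLp 2 fun _ : Fin n => H,
      ∑ i, ∑ j, inner ℂ (ζ i) ((if i = j then (t : ℂ) • ContinuousLinearMap.id ℂ H else 0) (ζ j)) =
      ((t * ‖ζ‖ ^ 2 : ℝ) : ℂ) := fun ζ => by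
    rw [PiLp.norm_sq_eq_of_L2, Finset.mul_sum, Complex.ofReal_sum]
    refine Finset.sum_congr rfl fun i _ => ?_
    rw [Finset.sum_eq_single i (by intro j _ hj; simp [hj.symm]) (by simp)]
    simp [inner_self_eq_norm_sq_to_K]
  have h2 : ∑ i, ∑ j, inner ℂ (η i) (ContinuousLinearMap.adjoint (T j i) (ξ j)) =
      star (inner ℂ ξ (blockOp T η)) := by
    rw [inner_blockOp, star_sum, Finset.sum_comm]
    refine Finset.sum_congr rfl fun i _ => ?_
    rw [star_sum]
    refine Finset.sum_congr rfl fun j _ => ?_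
    rw [ContinuousLinearMap.adjoint_inner_right]
    exact (inner_conj_symm _ _).symm
  rw [inner_blockOp]
  simp only [Fin.sum_univ_add, Fin.append_left, Fin.append_right, unitBlock_castAdd_castAdd,
    unitBlock_castAdd_natAdd, unitBlock_natAdd_castAdd, unitBlock_natAdd_natAdd,
    Finset.sum_add_distrib, hinv]
  rw [h1, h1, h2, ← inner_blockOp]
  set z := inner ℂ ξ (blockOp T η)
  have hz : z + star z = ((2 * z.re : ℝ) : ℂ) := Complex.add_conj z
  push_cast at hz ⊢
  linear_combination hz

/-- The norm of an operator matrix `T` is the smallest `t ≥ 0` with `[t, T; T*, t] ≥ 0`. -/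
lemma norm_blockOp_le_iff {H : Type u} [NormedAddCommGroup H] [InnerProductSpace ℂ H]
    [CompleteSpace H] {n : ℕ} {t : ℝ} (ht : 0 ≤ t) (T : Matrix (Fin n) (Fin n) (H →L[ℂ] H)) :
    ‖blockOp T‖ ≤ t ↔
      (blockOp ((boundedOperators H).unitBlock t (ContinuousLinearMap.id ℂ H) T)).IsPositive := by
  rw [opNorm_le_iff_re_inner _ ht, blockOp_isPositive_iff]
  constructor
  · intro h ζ
    obtain ⟨ξ, η, rfl⟩ : ∃ ξ η : PiLp 2 fun _ : Fin n => H,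
        ζ = WithLp.toLp 2 (Fin.append ξ η : Fin (n + n) → H) := by
      refine ⟨WithLp.toLp 2 fun i => ζ (Fin.castAdd n i), WithLp.toLp 2 fun i => ζ (Fin.natAdd n i),
        ?_⟩
      ext i
      refine Fin.addCases (fun i => ?_) (fun i => ?_) i <;> simp [-Fin.natAdd_eq_addNat]
    rw [inner_blockOp_unitBlock, Complex.zero_le_real]
    -- a sign turns the upper bound for the inner products into positivity
    have := h (-ξ) η
    rw [inner_neg_left, norm_neg, Complex.neg_re] at this
    linarith
  · intro h ξ η
    have := h (WithLp.toLp 2 (Fin.append (-ξ) η : Fin (n + n) → H))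
    have h1 := inner_blockOp_unitBlock t T (-ξ) η
    rw [WithLp.ofLp_neg] at h1
    rw [h1, Complex.zero_le_real, inner_neg_left, norm_neg, Complex.neg_re] at this
    linarith

lemma map_unitBlock {X : Type u} [NormedAddCommGroup X] [NormedSpace ℂ X]
    {Y : Type v} [NormedAddCommGroup Y] [NormedSpace ℂ Y]
    (S : MatrixOrderedData X) (T : MatrixOrderedData Y) (φ : X →ₗ[ℂ] Y)
    (hφ : ∀ x, φ (S.invol x) = T.invol (φ x)) {n : ℕ} (t : ℝ) (a : X)
    (x : Matrix (Fin n) (Fin n) X) :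
    (S.unitBlock t a x).map φ = T.unitBlock t (φ a) (x.map φ) := by
  ext i j : 2
  refine Fin.addCases (fun i => ?_) (fun i => ?_) i <;>
  refine Fin.addCases (fun j => ?_) (fun j => ?_) j <;>
  simp [unitBlock_castAdd_castAdd, unitBlock_castAdd_natAdd, unitBlock_natAdd_castAdd,
    unitBlock_natAdd_natAdd, apply_ite φ, hφ, -Fin.natAdd_eq_addNat]

/-- The unit of a unital operator system defines its matrix norm. -/
lemma IsUnitalOperatorSystem.exists_unit {Y : Type u} [NormedAddCommGroup Y] [NormedSpace ℂ Y]
    {T : MatrixOrderedData Y} (h : T.IsUnitalOperatorSystem) :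
    ∃ e : Y, ‖e‖ ≤ 1 ∧ ∀ (n : ℕ) (y : Matrix (Fin n) (Fin n) Y) (t : ℝ), 0 ≤ t →
      (T.matNorm n y ≤ t ↔ T.unitBlock t e y ∈ T.cone (n + n)) := by
  obtain ⟨hT, H, _, _, _, Ψ, hΨ, hΨn, e, he⟩ := h
  have hT := hT.toIsSMOS
  refine ⟨e, ?_, fun n y t ht => ?_⟩
  · rw [← hT.matNorm_one, ← hΨn]
    change ‖blockOp ((single₁ e).map Ψ)‖ ≤ 1
    refine (opNorm_le_iff_re_inner _ zero_le_one).2 fun η ξ => ?_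
    have h1 : inner ℂ η (blockOp ((single₁ e).map Ψ) ξ) = inner ℂ η ξ := by
      rw [inner_blockOp]
      simp [PiLp.inner_apply, single₁, he]
    rw [h1]
    have h2 : (inner ℂ η ξ).re ≤ ‖η‖ * ‖ξ‖ := (Complex.re_le_norm _).trans (norm_inner_le_norm _ _)
    nlinarith [sq_nonneg (‖η‖ - ‖ξ‖)]
  · have he' : T.invol e = e := by
      apply hΨ.injective
      rw [hΨ.map_invol, he]
      exact ContinuousLinearMap.adjoint_id
    rw [← hΨn, hΨ.mem_cone_iff _ _ (adj_unitBlock hT t he' y),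
      map_unitBlock T (boundedOperators H) Ψ hΨ.map_invol, he]
    exact norm_blockOp_le_iff ht _

/-! ### Direct sums of matrix valued maps -/

section Representation

variable {Y : Type u} [NormedAddCommGroup Y] [NormedSpace ℂ Y] {J : Type u} {k : J → ℕ}
  (g : ∀ j, Matrix (Fin (k j)) (Fin (k j)) Y)

/-- The Hilbert space direct sum of the spaces `ℂ^{k_j}`. -/
abbrev RepSpace (k : J → ℕ) : Type u := lp (fun j => EuclideanSpace ℂ (Fin (k j))) 2

variable (hg : ∀ j (φ : StrongDual ℂ Y), cstarNorm ((g j).map φ) ≤ ‖φ‖)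

lemma norm_real_smul_apply {k : J → ℕ} (c : ℝ) (ξ : RepSpace k) (j : J) :
    ‖((c : ℂ) • ξ : RepSpace k) j‖ = |c| * ‖ξ j‖ := by
  rw [lp.coeFn_smul, Pi.smul_apply, norm_smul, Complex.norm_real, Real.norm_eq_abs]

/-- The action of `φ ∈ Y*` on the direct sum of the spaces `ℂ^{k_j}`, by the matrices
`(φ(g_j(p, q)))_{p, q}`. -/
def repOp (φ : StrongDual ℂ Y) : RepSpace k →L[ℂ] RepSpace k :=
  LinearMap.mkContinuous
    { toFun := fun ξ => ⟨fun j => Matrix.toEuclideanCLM (𝕜 := ℂ) ((g j).map φ) (ξ j),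
        Memℓp.mono' (lp.memℓp ((‖φ‖ : ℂ) • ξ)) fun j => by
          refine (ContinuousLinearMap.le_of_opNorm_le _ (hg j φ) _).trans (le_of_eq ?_)
          rw [norm_real_smul_apply, abs_norm]⟩
      map_add' := fun ξ η => by ext1; funext j; exact map_add _ _ _
      map_smul' := fun c ξ => by ext1; funext j; exact map_smul (Matrix.toEuclideanCLM (𝕜 := ℂ) ((g j).map φ)) c (ξ j) }
    ‖φ‖ fun ξ => by
      have h : ‖((‖φ‖ : ℂ) • ξ : RepSpace k)‖ = ‖φ‖ * ‖ξ‖ := by rw [norm_smul]; simp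
      rw [← h]
      refine lp.norm_mono two_ne_zero fun j => ?_
      refine (ContinuousLinearMap.le_of_opNorm_le _ (hg j φ) _).trans (le_of_eq ?_)
      rw [norm_real_smul_apply, abs_norm]

lemma repOp_apply (φ : StrongDual ℂ Y) (ξ : RepSpace k) (j : J) :
    repOp g hg φ ξ j = Matrix.toEuclideanCLM (𝕜 := ℂ) ((g j).map φ) (ξ j) := rfl

/-- The linear map `φ ↦ ⨁ φ(g_j)`. -/
def rep : StrongDual ℂ Y →ₗ[ℂ] (RepSpace k →L[ℂ] RepSpace k) where
  toFun := repOp g hg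
  map_add' φ ψ := by
    ext ξ j : 3
    have : (g j).map (φ + ψ) = (g j).map φ + (g j).map ψ := rfl
    simp only [repOp_apply, this, map_add, _root_.add_apply, lp.coeFn_add, Pi.add_apply]
  map_smul' c φ := by
    ext ξ j : 3
    have : (g j).map (c • φ) = c • (g j).map φ := rfl
    simp only [repOp_apply, this, map_smul, _root_.smul_apply, lp.coeFn_smul, Pi.smul_apply,
      RingHom.id_apply]

lemma rep_apply (φ : StrongDual ℂ Y) (ξ : RepSpace k) (j : J) :
    rep g hg φ ξ j = Matrix.toEuclideanCLM (𝕜 := ℂ) ((g j).map φ) (ξ j) := rfl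

/-- The `j`-th component of a vector in `Hⁿ`. -/
def component {n : ℕ} (ξ : PiLp 2 fun _ : Fin n => RepSpace k) (j : J) :
    Fin (k j) × Fin n → ℂ := fun p => ξ p.2 j p.1

lemma hasSum_component {n : ℕ} (ξ : PiLp 2 fun _ : Fin n => RepSpace k) :
    HasSum (fun j => ∑ p, ‖component ξ j p‖ ^ 2) (‖ξ‖ ^ 2) := by
  rw [PiLp.norm_sq_eq_of_L2]
  have h1 : ∀ i, HasSum (fun j => ‖ξ i j‖ ^ 2) (‖ξ i‖ ^ 2) := fun i => by
    have := lp.hasSum_norm (p := 2) (by norm_num) (ξ i)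
    simpa using this
  have h2 := hasSum_sum (s := Finset.univ) fun i _ => h1 i
  convert h2 using 2 with j
  rw [Fintype.sum_prod_type, Finset.sum_comm]
  refine Finset.sum_congr rfl fun i _ => ?_
  rw [EuclideanSpace.norm_sq_eq]
  rfl

/-- The matrix `Φ` over `Y*` acts on `Hⁿ` componentwise, by the matrices `Φ^{(k_j)}(g_j)`. -/
lemma hasSum_inner_blockOp {n : ℕ} (Φ : Matrix (Fin n) (Fin n) (StrongDual ℂ Y))
    (η ξ : PiLp 2 fun _ : Fin n => RepSpace k) :
    HasSum (fun j => star (component η j) ⬝ᵥ (amplify Φ (g j) *ᵥ component ξ j))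
      (inner ℂ η (blockOp (Φ.map (rep g hg)) ξ)) := by
  rw [inner_blockOp]
  have h1 : ∀ i l, HasSum (fun j => inner ℂ (η i j) (rep g hg (Φ i l) (ξ l) j))
      (inner ℂ (η i) (rep g hg (Φ i l) (ξ l))) := fun i l => lp.hasSum_inner _ _
  have h2 := hasSum_sum (s := Finset.univ) fun i _ => hasSum_sum (s := Finset.univ)
    fun l _ => h1 i l
  suffices h4 : (fun j => star (component η j) ⬝ᵥ (amplify Φ (g j) *ᵥ component ξ j)) =
      fun j => ∑ i, ∑ l, inner ℂ (η i j) (rep g hg (Φ i l) (ξ l) j) by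
    rw [h4]
    exact h2
  funext j
  simp only [dotProduct, mulVec, Fintype.sum_prod_type, rep_apply]
  rw [Finset.sum_comm]
  refine Finset.sum_congr rfl fun i _ => ?_
  have h3 : ∀ l, inner ℂ (η i j) (Matrix.toEuclideanCLM (𝕜 := ℂ) ((g j).map (Φ i l)) (ξ l j)) =
      ∑ a, ∑ b, star (η i j a) * (Φ i l (g j a b) * ξ l j b) := fun l => by
    rw [EuclideanSpace.inner_eq_star_dotProduct, dotProduct_comm]
    simp only [dotProduct, Pi.star_apply, Matrix.ofLp_toEuclideanCLM, mulVec, Finset.mul_sum,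
      Matrix.map_apply]
  simp only [h3]
  rw [Finset.sum_comm]
  refine Finset.sum_congr rfl fun a _ => ?_
  rw [Finset.mul_sum, Finset.sum_comm]
  simp only [Finset.mul_sum]
  rw [Finset.sum_comm, Finset.sum_comm]
  rfl

/-- The vector of `Hⁿ` whose only nonzero component is the `j`-th. -/
def embed [DecidableEq J] {n : ℕ} (j : J) (ζ : Fin (k j) × Fin n → ℂ) :
    PiLp 2 fun _ : Fin n => RepSpace k :=
  WithLp.toLp 2 fun i => lp.single 2 j (WithLp.toLp 2 fun a => ζ (a, i))

lemma component_embed_self [DecidableEq J] {n : ℕ} (j : J) (ζ : Fin (k j) × Fin n → ℂ) :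
    component (embed j ζ) j = ζ := by
  funext p
  simp [component, embed]

lemma component_embed_of_ne [DecidableEq J] {n : ℕ} {j j' : J} (h : j' ≠ j)
    (ζ : Fin (k j) × Fin n → ℂ) : component (embed j ζ) j' = 0 := by
  funext p
  simp [component, embed, h]

lemma norm_sq_embed [DecidableEq J] {n : ℕ} (j : J) (ζ : Fin (k j) × Fin n → ℂ) :
    ‖embed j ζ‖ ^ 2 = ∑ p, ‖ζ p‖ ^ 2 := by
  refine (hasSum_component (embed j ζ)).unique ?_
  have := hasSum_single (f := fun j' => ∑ p, ‖component (embed j ζ) j' p‖ ^ 2) j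
    (fun j' hj' => by simp [component_embed_of_ne hj'])
  rwa [component_embed_self] at this

lemma inner_blockOp_embed [DecidableEq J] {n : ℕ} (Φ : Matrix (Fin n) (Fin n) (StrongDual ℂ Y))
    (j : J) (η ξ : Fin (k j) × Fin n → ℂ) :
    inner ℂ (embed j η) (blockOp (Φ.map (rep g hg)) (embed j ξ)) =
      star η ⬝ᵥ (amplify Φ (g j) *ᵥ ξ) := by
  refine (hasSum_inner_blockOp g hg Φ (embed j η) (embed j ξ)).unique ?_
  have := hasSum_single (f := fun j' => star (component (embed j η) j') ⬝ᵥ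
    (amplify Φ (g j') *ᵥ component (embed j ξ) j')) j
    (fun j' hj' => by simp [component_embed_of_ne hj'])
  rwa [component_embed_self, component_embed_self] at this

lemma norm_blockOp_rep_le_iff {n : ℕ} (Φ : Matrix (Fin n) (Fin n) (StrongDual ℂ Y)) {t : ℝ}
    (ht : 0 ≤ t) :
    ‖blockOp (Φ.map (rep g hg))‖ ≤ t ↔ ∀ j, cstarNorm (amplify Φ (g j)) ≤ t := by
  classical
  constructor
  · intro h j
    refine cstarNorm_le_of_forall _ ht fun η ξ => ?_
    rw [← inner_blockOp_embed g hg, ← norm_sq_embed, ← norm_sq_embed,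
      Real.sqrt_sq (norm_nonneg _), Real.sqrt_sq (norm_nonneg _), mul_right_comm, mul_comm]
    refine (norm_inner_le_norm _ _).trans ?_
    gcongr
    exact ContinuousLinearMap.le_of_opNorm_le _ h _
  · intro h
    refine (opNorm_le_iff_re_inner _ ht).2 fun η ξ => ?_
    have h1 := Complex.hasSum_re (hasSum_inner_blockOp g hg Φ η ξ)
    have h2 := (hasSum_component η).add (hasSum_component ξ)
    refine hasSum_le (fun j => ?_) (h1.mul_left 2) (h2.mul_left t)
    have h3 := (Complex.re_le_norm _).trans
      (norm_dotProduct_le_cstarNorm (amplify Φ (g j)) (component η j) (component ξ j))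
    set a := ∑ p, ‖component η j p‖ ^ 2 with ha
    set b := ∑ p, ‖component ξ j p‖ ^ 2 with hb
    have ha0 : 0 ≤ a := by positivity
    have hb0 : 0 ≤ b := by positivity
    have h4 : cstarNorm (amplify Φ (g j)) * √a * √b ≤ t * (√a * √b) := by
      rw [mul_assoc]
      exact mul_le_mul_of_nonneg_right (h j) (by positivity)
    nlinarith [Real.sq_sqrt ha0, Real.sq_sqrt hb0, mul_nonneg ht (sq_nonneg (√a - √b))]

lemma blockOp_rep_isPositive_iff {n : ℕ} (Φ : Matrix (Fin n) (Fin n) (StrongDual ℂ Y)) :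
    (blockOp (Φ.map (rep g hg))).IsPositive ↔
      ∀ j (ζ : Fin (k j) × Fin n → ℂ), 0 ≤ star ζ ⬝ᵥ (amplify Φ (g j) *ᵥ ζ) := by
  classical
  rw [blockOp_isPositive_iff]
  constructor
  · intro h j ζ
    rw [← inner_blockOp_embed g hg]
    exact h _
  · intro h ξ
    exact (hasSum_inner_blockOp g hg Φ ξ ξ).nonneg fun j => h j _

lemma rep_eq_adjoint {φ ψ : StrongDual ℂ Y} (h : ∀ j, (g j).map ψ = ((g j).map φ)ᴴ) :
    rep g hg ψ = ContinuousLinearMap.adjoint (rep g hg φ) := by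
  rw [ContinuousLinearMap.eq_adjoint_iff]
  intro ξ η
  refine (lp.hasSum_inner _ _).unique ?_
  convert lp.hasSum_inner ξ (rep g hg φ η) using 2 with j
  rw [rep_apply, rep_apply, h, ← star_eq_conjTranspose, map_star,
    ContinuousLinearMap.star_eq_adjoint, ContinuousLinearMap.adjoint_inner_left]

lemma rep_eq_id {φ : StrongDual ℂ Y} (h : ∀ j, (g j).map φ = 1) :
    rep g hg φ = ContinuousLinearMap.id ℂ (RepSpace k) := by
  ext ξ j : 3
  rw [rep_apply, h, map_one]
  rfl

end Representation

end MatrixOrderedData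

/-! ### The unit of the bidual -/

namespace Matrix

lemma sandwich_map_functional {X : Type u} [NormedAddCommGroup X] [NormedSpace ℂ X] {m n : ℕ}
    (φ : StrongDual ℂ X) (α : Matrix (Fin n) (Fin m) ℂ) (x : Matrix (Fin m) (Fin m) X)
    (β : Matrix (Fin m) (Fin n) ℂ) : (sandwich α x β).map φ = α * x.map φ * β := by
  ext i j
  simp only [map_apply, sandwich_apply, map_sum, map_smul, smul_eq_mul, mul_apply,
    Finset.sum_mul]
  rw [Finset.sum_comm]
  refine Finset.sum_congr rfl fun k _ => Finset.sum_congr rfl fun l _ => by ring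

end Matrix

namespace MatrixOrderedData

open Matrix

variable {X : Type u} [NormedAddCommGroup X] [NormedSpace ℂ X] {S : MatrixOrderedData X}
  {e : StrongDual ℂ (StrongDual ℂ X)} {n k : ℕ}

/-- If the bidual is a unital operator system, then its unit defines the matrix norm of `X`, since
`X` embeds completely isometrically. -/
lemma exists_isBidualUnit (hS : S.IsSMOS) (h : S.bidual.IsUnitalOperatorSystem) :
    ∃ e, S.IsBidualUnit e := by
  obtain ⟨e, he, h⟩ := h.exists_unit
  refine ⟨e, he, fun n x t ht => ?_⟩
  rw [← h n _ t ht, hS.bidual_matNorm_toBidual]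

lemma map_posSemidef_of_mem_posCone (he : e ∈ S.bidual.posCone)
    {f : Matrix (Fin k) (Fin k) (StrongDual ℂ X)} (hf : f ∈ S.dual.cone k) :
    (f.map e).PosSemidef :=
  (he.2 k f hf).submatrix fun i => (i, 0)

/-- Positivity of `[t e, x; x*, t e]` in the bidual, tested on the positive elements of the dual. -/
lemma unitBlock_mem_bidual_cone_iff (hS : S.IsSMOS) (he : e ∈ S.bidual.posCone)
    (x : Matrix (Fin n) (Fin n) X) (t : ℝ) :
    S.bidual.unitBlock t e (x.map (toBidual X)) ∈ S.bidual.cone (n + n) ↔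
      ∀ f ∈ S.dual.cone (n + n), 0 ≤ t * ∑ i, (e (f i i)).re +
        2 * (pair (sandwich (inlMat n n) f (inrMat n n)ᵀ) x).re := by
  refine (mem_dual_cone_iff hS.dual _).trans ?_
  refine (and_iff_right (adj_unitBlock hS.bidual t (invol_of_mem_posCone hS.bidual he) _)).trans ?_
  refine forall₂_congr fun f hf => ?_
  have h := re_unitBlock_pair (S := S.dual) (((mem_dual_cone_iff hS f).1 hf).1) t e
    (x.map (toBidual X))
  rw [pair_toBidual] at h
  exact iff_of_eq (congrArg _ h)

namespace IsBidualUnit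

variable (hE : S.IsBidualUnit e) (hS : S.IsSMOS)
include hE hS

/-- The unit is positive: it is a diagonal entry of the positive matrix `[e, 0; 0, e]`. -/
lemma mem_posCone : e ∈ S.bidual.posCone := by
  have h := (hE.matNorm_le_iff 1 0 1 zero_le_one).1 (by rw [hS.matNorm_zero]; exact zero_le_one)
  have h1 := apply_mem_posCone hS.bidual h (Fin.castAdd 1 0)
  rwa [unitBlock_castAdd_castAdd, if_pos rfl, Complex.ofReal_one, one_smul] at h1

lemma map_posSemidef {f : Matrix (Fin k) (Fin k) (StrongDual ℂ X)} (hf : f ∈ S.dual.cone k) :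
    (f.map e).PosSemidef := map_posSemidef_of_mem_posCone (hE.mem_posCone hS) hf

lemma matNorm_le_iff' (x : Matrix (Fin n) (Fin n) X) {t : ℝ} (ht : 0 ≤ t) :
    S.matNorm n x ≤ t ↔ ∀ f ∈ S.dual.cone (n + n), 0 ≤ t * ∑ i, (e (f i i)).re +
        2 * (pair (sandwich (inlMat n n) f (inrMat n n)ᵀ) x).re := by
  rw [hE.matNorm_le_iff n x t ht, unitBlock_mem_bidual_cone_iff hS (hE.mem_posCone hS)]

/-- A positive functional `f` is dominated by its values at the unit. -/
lemma re_pair_sandwich_le {f : Matrix (Fin k) (Fin k) (StrongDual ℂ X)} (hf : f ∈ S.dual.cone k)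
    (A B : Matrix (Fin k) (Fin n) ℂ) {x : Matrix (Fin n) (Fin n) X} {t : ℝ}
    (hx : S.matNorm n x ≤ t) :
    2 * (pair (sandwich Aᴴ f B) x).re ≤
      t * ((Aᴴ * f.map e * A).trace.re + (Bᴴ * f.map e * B).trace.re) := by
  -- compress `f` by `W = [-A, B]`, so that the upper right corner becomes `-Aᴴ f B`
  have h := (hE.matNorm_le_iff' hS x ((hS.matNorm_nonneg x).trans hx)).1 hx _
    (hS.dual.cone_sandwich hf (B * inrMat n n - A * inlMat n n))
  set W := B * inrMat n n - A * inlMat n n with hW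
  have h1 : inlMat n n * Wᴴ = -Aᴴ := by
    simp [hW, Matrix.mul_sub, ← Matrix.mul_assoc]
  have h2 : W * (inrMat n n)ᵀ = B := by
    simp [hW, Matrix.sub_mul, Matrix.mul_assoc]
  have h1' : inrMat n n * Wᴴ = Bᴴ := by
    simp [hW, Matrix.mul_sub, ← Matrix.mul_assoc]
  have h2' : W * (inlMat n n)ᵀ = -A := by
    simp [hW, Matrix.sub_mul, Matrix.mul_assoc]
  rw [sandwich_sandwich, h1, h2, ← neg_one_smul ℂ, smul_sandwich, smul_pair] at h
  have h3 : ∑ i, (e (sandwich Wᴴ f W i i)).re = (Wᴴ * f.map e * W).trace.re := by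
    rw [← sandwich_map_functional, trace, Complex.re_sum]
    rfl
  have h4 : (Wᴴ * f.map e * W).trace = (Aᴴ * f.map e * A).trace + (Bᴴ * f.map e * B).trace := by
    set M := Wᴴ * f.map e * W with hM
    have e1 : Aᴴ * f.map e * A = inlMat n n * M * (inlMat n n)ᵀ := by
      rw [hM]
      simp only [Matrix.mul_assoc, h2']
      simp only [← Matrix.mul_assoc, h1]
      simp
    have e2 : Bᴴ * f.map e * B = inrMat n n * M * (inrMat n n)ᵀ := by
      rw [hM]
      simp only [Matrix.mul_assoc, h2]
      simp only [← Matrix.mul_assoc, h1']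
    rw [e1, e2, trace_mul_comm (inlMat n n * M), ← Matrix.mul_assoc _ _ M,
      trace_mul_comm (inrMat n n * M), ← Matrix.mul_assoc _ _ M, ← trace_add, ← Matrix.add_mul, inlMat_add_inrMat, Matrix.one_mul]
  rw [h3, h4] at h
  simp only [neg_mul, one_mul, Complex.neg_re, Complex.add_re] at h
  linarith

/-- The norm of a positive functional is its value at the unit. -/
lemma norm_eq_of_mem_posCone {f : StrongDual ℂ X} (hf : f ∈ S.dual.posCone) :
    ‖f‖ = (e f).re := by
  have h0 : 0 ≤ (e f).re := by
    have := (hE.map_posSemidef hS hf).diag_nonneg (i := 0)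
    exact (Complex.nonneg_iff.1 this).1
  refine le_antisymm (f.opNorm_le_bound h0 fun x => ?_) ((Complex.re_le_norm _).trans ?_)
  · obtain ⟨c, hc, hcx⟩ := Complex.exists_norm_eq_mul_self (f x)
    have := hE.re_pair_sandwich_le hS hf (1 : Matrix (Fin 1) (Fin 1) ℂ) (c • 1)
      (hS.matNorm_one x).le
    have hcc : star c * c = 1 := by
      rw [Complex.star_def, Complex.conj_mul', hc]; simp
    have ht : ((single₁ f).map e).trace = e f := by simp [trace, single₁]
    rw [conjTranspose_one, sandwich_smul_right, one_sandwich_one, smul_pair, pair_single₁, ← hcx,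
      conjTranspose_smul, conjTranspose_one, Matrix.smul_mul, Matrix.mul_smul, Matrix.one_mul,
      Matrix.smul_mul, smul_smul, mul_comm c, hcc, one_smul, Matrix.mul_one, ht,
      Complex.ofReal_re] at this
    linarith
  · exact (e.le_opNorm f).trans (by nlinarith [hE.norm_le_one, norm_nonneg f])

/-- A unital completely positive map is completely contractive. -/
lemma dual_matNorm_le_one {g : Matrix (Fin k) (Fin k) (StrongDual ℂ X)} (hg : g ∈ S.dual.cone k)
    (h1 : g.map e = 1) : S.dual.matNorm k g ≤ 1 := by
  refine hS.dual_matNorm_le_of_re g zero_le_one fun m x η ξ hx => ?_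
  have h := hE.re_pair_sandwich_le hS hg (ηᴴᵀ)ᴴ ξᵀ hx
  have h2 : (ηᴴᵀ * (ηᴴᵀ)ᴴ).trace.re = hsq η := by
    rw [trace_mul_comm, ← hsq_eq_re_trace, hsq_transpose, hsq_conjTranspose]
  rw [pair_sandwich]
  rw [conjTranspose_conjTranspose, h1, Matrix.mul_one, Matrix.mul_one, h2, ← hsq_eq_re_trace, hsq_transpose] at h
  exact h

end IsBidualUnit

end MatrixOrderedData

/-! ### The bidual as a unital operator system -/

namespace MatrixOrderedData

open Matrix

variable {X : Type u} [NormedAddCommGroup X] [NormedSpace ℂ X] {S : MatrixOrderedData X}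
  {e : StrongDual ℂ (StrongDual ℂ X)} {n k m : ℕ}

lemma posDef_add_smul_one {A : Matrix (Fin n) (Fin n) ℂ} (hA : A.PosSemidef) {ε : ℝ} (hε : 0 < ε) :
    (A + (ε : ℂ) • (1 : Matrix (Fin n) (Fin n) ℂ)).PosDef :=
  PosDef.posSemidef_add hA (PosDef.one.smul (Complex.zero_lt_real.2 hε))

lemma nonneg_of_forall_add_mul {a b : ℝ} (h : ∀ ε : ℝ, 0 < ε → 0 ≤ a + ε * b) : 0 ≤ a := by
  by_contra! ha
  have h1 := h (-a / (2 * (|b| + 1))) (div_pos (by linarith) (by positivity))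
  have h2 : -a / (2 * (|b| + 1)) * b ≤ -a / 2 := by
    have h3 : -a / (2 * (|b| + 1)) * b ≤ -a / (2 * (|b| + 1)) * (|b| + 1) :=
      mul_le_mul_of_nonneg_left (by linarith [le_abs_self b]) (div_nonneg (by linarith) (by positivity))
    refine h3.trans (le_of_eq ?_)
    field_simp
  linarith

lemma eq_of_forall_re_pair {f g : Matrix (Fin n) (Fin n) (StrongDual ℂ X)}
    (h : ∀ x, (pair f x).re = (pair g x).re) : f = g := by
  have h1 : ∀ x, pair f x = pair g x := fun x => by
    refine Complex.ext (h x) ?_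
    have := h (Complex.I • x)
    rw [pair_smul, pair_smul] at this
    simpa using this
  ext i j x
  have := h1 (Matrix.single i j x)
  have e1 : ∀ f : Matrix (Fin n) (Fin n) (StrongDual ℂ X), pair f (Matrix.single i j x) = f i j x :=
    fun f => by
      unfold pair
      rw [Finset.sum_eq_single i (by intro k _ hk; simp [hk.symm]) (by simp),
        Finset.sum_eq_single j (by intro k _ hk; simp [hk.symm]) (by simp)]
      simp
  rwa [e1, e1] at this

namespace IsBidualUnit

variable (hE : S.IsBidualUnit e) (hS : S.IsSMOS)
include hE hS

/-- Without states there are no positive functionals at all. -/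
lemma eq_zero_of_no_state (h : ∀ s ∈ S.dual.posCone, e s ≠ 1)
    {f : Matrix (Fin n) (Fin n) (StrongDual ℂ X)} (hf : f ∈ S.dual.cone n) : f = 0 := by
  have h0 : ∀ s ∈ S.dual.posCone, s = 0 := fun s hs => by
    by_contra hs0
    have hn : ‖s‖ ≠ 0 := norm_ne_zero_iff.2 hs0
    refine h _ (smul_mem_posCone hS.dual hs (c := ‖s‖⁻¹) (by positivity)) ?_
    have h1 := (hE.map_posSemidef hS hs).diag_nonneg (i := 0)
    have h2 : e s = (‖s‖ : ℂ) := by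
      rw [hE.norm_eq_of_mem_posCone hS hs]
      exact Complex.ext rfl (Complex.nonneg_iff.1 h1).2.symm
    rw [map_smul, h2, smul_eq_mul, ← Complex.ofReal_mul, inv_mul_cancel₀ hn, Complex.ofReal_one]
  have ht : (f.map e).trace = 0 := by
    refine Finset.sum_eq_zero fun i _ => ?_
    rw [diag_apply, map_apply, h0 _ (apply_mem_posCone hS.dual hf i), map_zero]
  have key : ∀ x, (pair f x).re ≤ 0 := fun x => by
    have := hE.re_pair_sandwich_le hS hf 1 1 (x := x) le_rfl
    rw [conjTranspose_one, one_sandwich_one, Matrix.one_mul, Matrix.mul_one, ht] at this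
    simp only [Complex.zero_re, add_zero, mul_zero] at this
    linarith
  refine eq_of_forall_re_pair fun x => le_antisymm (by simpa using key x) ?_
  have := key (-x)
  rw [pair_neg, Complex.neg_re] at this
  simpa using this

/-- Positivity in the bidual is tested on unital completely positive maps: up to a small multiple
of a state, each positive functional on matrices is of the form `Bᴴ g B` for such a map `g`. -/
lemma mem_bidual_cone_of_unital {φ : Matrix (Fin n) (Fin n) (StrongDual ℂ (StrongDual ℂ X))}
    (hφ : S.bidual.adj φ = φ)
    (h : ∀ g ∈ S.dual.cone n, g.map e = 1 → ∀ Z : Matrix (Fin n) (Fin n) ℂ,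
      0 ≤ (pair φ (sandwich Zᴴ g Z)).re) : φ ∈ S.bidual.cone n := by
  refine (mem_dual_cone_iff hS.dual φ).2 ⟨hφ, fun f hf => ?_⟩
  by_cases hs : ∃ s ∈ S.dual.posCone, e s = 1
  swap
  · push Not at hs
    rw [hE.eq_zero_of_no_state hS hs hf, pair_zero, Complex.zero_re]
  obtain ⟨s, hs, hs1⟩ := hs
  -- adding `ε` times a state makes `e(f)` invertible; with `e(f') = Bᴴ B` take `g = B⁻ᴴ f' B⁻¹`
  refine nonneg_of_forall_add_mul (b := (pair φ (diagonal fun _ => s)).re) fun ε hε => ?_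
  set f' := f + (ε : ℂ) • (diagonal fun _ => s) with hf'
  have hf'mem : f' ∈ S.dual.cone n :=
    hS.dual.cone_add hf (hS.dual.cone_smul (diagonal_mem_cone hS.dual hs) hε.le)
  have hmap : f'.map e = f.map e + (ε : ℂ) • (1 : Matrix (Fin n) (Fin n) ℂ) := by
    ext i j
    by_cases hij : i = j
    · subst hij; simp [hf', hs1]
    · simp [hf', hij]
  obtain ⟨B, hB, hBB⟩ := (posDef_add_smul_one (hE.map_posSemidef hS hf) hε).exists_eq_conjTranspose_mul_self
  rw [← hmap] at hBB
  have hB1 : B⁻¹ * B = 1 := nonsing_inv_mul _ hB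
  have hB2 : B * B⁻¹ = 1 := mul_nonsing_inv _ hB
  have hB3 : (B⁻¹)ᴴ * Bᴴ = 1 := by rw [← conjTranspose_mul, hB2, conjTranspose_one]
  have hB4 : Bᴴ * (B⁻¹)ᴴ = 1 := by rw [← conjTranspose_mul, hB1, conjTranspose_one]
  have h1 := h (sandwich (B⁻¹)ᴴ f' B⁻¹) (hS.dual.cone_sandwich hf'mem _) (by
    rw [sandwich_map_functional, hBB, ← Matrix.mul_assoc, hB3, Matrix.one_mul, hB2]) B
  rw [sandwich_sandwich, hB1, hB4, one_sandwich_one, hf', pair_add, pair_smul, Complex.add_re,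
    Complex.re_ofReal_mul] at h1
  exact h1

end IsBidualUnit

end MatrixOrderedData

namespace MatrixOrderedData

open Matrix

variable {X : Type u} [NormedAddCommGroup X] [NormedSpace ℂ X] {S : MatrixOrderedData X}
  {e : StrongDual ℂ (StrongDual ℂ X)} {n k m : ℕ}

/-- The element `diag(α, β) ⊗ e` of the bidual, evaluated at a positive functional. -/
def diagValue (e : StrongDual ℂ (StrongDual ℂ X)) (α β : Matrix (Fin m) (Fin m) ℂ)
    (h : Matrix (Fin (m + m)) (Fin (m + m)) (StrongDual ℂ X)) : ℝ :=
  (α * (inlMat m m * h.map e * (inlMat m m)ᵀ)).trace.re +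
    (β * (inrMat m m * h.map e * (inrMat m m)ᵀ)).trace.re

lemma diagValue_add (e : StrongDual ℂ (StrongDual ℂ X)) (α β α' β' : Matrix (Fin m) (Fin m) ℂ)
    (h : Matrix (Fin (m + m)) (Fin (m + m)) (StrongDual ℂ X)) :
    diagValue e (α + α') (β + β') h = diagValue e α β h + diagValue e α' β' h := by
  simp only [diagValue, Matrix.add_mul, trace_add, Complex.add_re]
  ring

lemma diagValue_smul (e : StrongDual ℂ (StrongDual ℂ X)) (c : ℝ) (α β : Matrix (Fin m) (Fin m) ℂ)
    (h : Matrix (Fin (m + m)) (Fin (m + m)) (StrongDual ℂ X)) :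
    diagValue e ((c : ℂ) • α) ((c : ℂ) • β) h = c * diagValue e α β h := by
  simp only [diagValue, Matrix.smul_mul, trace_smul, smul_eq_mul, Complex.re_ofReal_mul]
  ring

lemma diagValue_one (e : StrongDual ℂ (StrongDual ℂ X))
    (h : Matrix (Fin (m + m)) (Fin (m + m)) (StrongDual ℂ X)) :
    diagValue e 1 1 h = (h.map e).trace.re := by
  rw [diagValue, Matrix.one_mul, Matrix.one_mul, ← Complex.add_re,
    trace_mul_comm (inlMat m m * _), trace_mul_comm (inrMat m m * _), ← Matrix.mul_assoc,
    ← Matrix.mul_assoc, ← trace_add, ← Matrix.add_mul, inlMat_add_inrMat, Matrix.one_mul]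

lemma trace_mul_conjTranspose_mul_re (e : StrongDual ℂ (StrongDual ℂ X)) (v : Matrix (Fin m) (Fin 1) ℂ)
    (h : Matrix (Fin (m + m)) (Fin (m + m)) (StrongDual ℂ X)) (A : Matrix (Fin m) (Fin (m + m)) ℂ) :
    ((v * vᴴ) * (A * h.map e * Aᴴ)).trace = e (compress h (Aᴴ * v)) := by
  have h1 : (single₁ (compress h (Aᴴ * v))).map e = vᴴ * (A * h.map e * Aᴴ) * v := by
    rw [single₁_compress, sandwich_map_functional, conjTranspose_mul, conjTranspose_conjTranspose]
    simp only [Matrix.mul_assoc]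
  rw [Matrix.mul_assoc, trace_mul_comm, ← h1]
  simp [trace, single₁]

namespace IsBidualUnit

variable (hE : S.IsBidualUnit e) (hS : S.IsSMOS)
include hE hS

/-- A lower bound for `f ∈ M_m(X*)` of norm at most one: if `[α, x; x*, β]` is positive in the
bidual then `2 Re f(x) ≥ -(tr α + tr β)`. -/
lemma nonneg_of_diagValue {f : Matrix (Fin m) (Fin m) (StrongDual ℂ X)}
    (hf : S.dual.matNorm m f ≤ 1) {α β : Matrix (Fin m) (Fin m) ℂ} (hα : α.PosSemidef)
    (hβ : β.PosSemidef) (x : Matrix (Fin m) (Fin m) X)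
    (h : ∀ g ∈ S.dual.cone (m + m), 0 ≤ diagValue e α β g +
      2 * (pair (sandwich (inlMat m m) g (inrMat m m)ᵀ) x).re) :
    0 ≤ α.trace.re + β.trace.re + 2 * (pair f x).re := by
  -- make the diagonal invertible, `α' = Bᴴ B` and `β' = Cᴴ C`; the corner normalized accordingly is a
  -- contraction `x'`, and `f` is evaluated at `x` through `x'`
  refine nonneg_of_forall_add_mul (b := 2 * m) fun ε hε => ?_
  set α' := α + (ε : ℂ) • (1 : Matrix (Fin m) (Fin m) ℂ) with hα'
  set β' := β + (ε : ℂ) • (1 : Matrix (Fin m) (Fin m) ℂ) with hβ'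
  have h' : ∀ g ∈ S.dual.cone (m + m), 0 ≤ diagValue e α' β' g +
      2 * (pair (sandwich (inlMat m m) g (inrMat m m)ᵀ) x).re := fun g hg => by
    rw [hα', hβ', diagValue_add, diagValue_smul, diagValue_one]
    have h1 := h g hg
    have h2 := (Complex.nonneg_iff.1 (hE.map_posSemidef hS hg).trace_nonneg).1
    nlinarith [mul_nonneg hε.le h2]
  obtain ⟨B, hB, hBB⟩ := (posDef_add_smul_one hα hε).exists_eq_conjTranspose_mul_self
  obtain ⟨C, hC, hCC⟩ := (posDef_add_smul_one hβ hε).exists_eq_conjTranspose_mul_self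
  rw [← hα'] at hBB
  rw [← hβ'] at hCC
  have hB1 : B⁻¹ * B = 1 := nonsing_inv_mul _ hB
  have hB2 : B * B⁻¹ = 1 := mul_nonsing_inv _ hB
  have hC1 : C⁻¹ * C = 1 := nonsing_inv_mul _ hC
  have hC2 : C * C⁻¹ = 1 := mul_nonsing_inv _ hC
  have hC3 : (C⁻¹)ᴴ * Cᴴ = 1 := by rw [← conjTranspose_mul, hC2, conjTranspose_one]
  have hB3 : (B⁻¹)ᴴ * Bᴴ = 1 := by rw [← conjTranspose_mul, hB2, conjTranspose_one]
  have hC4 : Cᴴ * (C⁻¹)ᴴ = 1 := by rw [← conjTranspose_mul, hC1, conjTranspose_one]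
  set x' := sandwich (B⁻¹)ᵀ x ((C⁻¹)ᴴ)ᵀ with hx'
  have hnx : S.matNorm m x' ≤ 1 := by
    refine (hE.matNorm_le_iff' hS x' zero_le_one).2 fun g hg => ?_
    set W := (inlMat m m)ᵀ * (B⁻¹)ᴴ * inlMat m m + (inrMat m m)ᵀ * (C⁻¹)ᴴ * inrMat m m with hW
    have w1 : W * (inlMat m m)ᵀ = (inlMat m m)ᵀ * (B⁻¹)ᴴ := by
      simp [hW, Matrix.add_mul, Matrix.mul_assoc]
    have w2 : W * (inrMat m m)ᵀ = (inrMat m m)ᵀ * (C⁻¹)ᴴ := by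
      simp [hW, Matrix.add_mul, Matrix.mul_assoc]
    have w3 : inlMat m m * Wᴴ = B⁻¹ * inlMat m m := by
      have := congrArg conjTranspose w1
      simpa [conjTranspose_mul, transpose_inl_conj] using this
    have w4 : inrMat m m * Wᴴ = C⁻¹ * inrMat m m := by
      have := congrArg conjTranspose w2
      simpa [conjTranspose_mul, transpose_inr_conj] using this
    have h1 := h' _ (hS.dual.cone_sandwich hg W)
    have h2 : diagValue e α' β' (sandwich Wᴴ g W) = ∑ i, (e (g i i)).re := by
      have e1 : ∑ i, (e (g i i)).re = (g.map e).trace.re := by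
        rw [trace, Complex.re_sum]; rfl
      rw [e1, ← diagValue_one, diagValue, diagValue, sandwich_map_functional]
      have e2 : ∀ (L : Matrix (Fin m) (Fin (m + m)) ℂ) (D : Matrix (Fin m) (Fin m) ℂ),
          W * Lᵀ = Lᵀ * (D⁻¹)ᴴ → L * Wᴴ = D⁻¹ * L → D * D⁻¹ = 1 → (D⁻¹)ᴴ * Dᴴ = 1 →
          ((Dᴴ * D) * (L * (Wᴴ * g.map e * W) * Lᵀ)).trace = (1 * (L * g.map e * Lᵀ)).trace := by
        intro L D d1 d2 d3 d4
        have : L * (Wᴴ * g.map e * W) * Lᵀ = D⁻¹ * (L * g.map e * Lᵀ) * (D⁻¹)ᴴ := by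
          calc L * (Wᴴ * g.map e * W) * Lᵀ = (L * Wᴴ) * g.map e * (W * Lᵀ) := by
                simp only [Matrix.mul_assoc]
            _ = _ := by rw [d1, d2]; simp only [Matrix.mul_assoc]
        rw [this, Matrix.mul_assoc, trace_mul_comm, Matrix.one_mul]
        calc (D * (D⁻¹ * (L * g.map e * Lᵀ) * (D⁻¹)ᴴ) * Dᴴ).trace
            = ((D * D⁻¹) * (L * g.map e * Lᵀ) * ((D⁻¹)ᴴ * Dᴴ)).trace := by
              simp only [Matrix.mul_assoc]
          _ = _ := by rw [d3, d4, Matrix.one_mul, Matrix.mul_one]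
      rw [hBB, hCC, e2 _ B w1 w3 hB2 hB3, e2 _ C w2 w4 hC2 hC3]
    rw [h2, sandwich_sandwich, w3, w2] at h1
    rw [one_mul, hx', pair_sandwich, transpose_transpose, transpose_transpose, sandwich_sandwich]
    exact h1
  have hx : x = sandwich Bᵀ x' (Cᴴ)ᵀ := by
    rw [hx', sandwich_sandwich, ← transpose_mul, ← transpose_mul, hB1, hC4, transpose_one,
      one_sandwich_one]
  have h1 : ‖pair f x‖ ≤ √(hsq B) * √(hsq C) := by
    conv_lhs => rw [hx]
    refine (hS.norm_pair_sandwich_le f _ _ _).trans ?_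
    rw [hsq_transpose, hsq_transpose, hsq_conjTranspose]
    have h3 : S.dual.matNorm m f * S.matNorm m x' ≤ 1 :=
      mul_le_one₀ hf (hS.matNorm_nonneg _) hnx
    rw [mul_assoc]
    exact mul_le_of_le_one_left (by positivity) h3
  have h2 : α'.trace.re + β'.trace.re = hsq B + hsq C := by
    rw [hBB, hCC, hsq_eq_re_trace, hsq_eq_re_trace]
  have h3 : α'.trace.re + β'.trace.re = α.trace.re + β.trace.re + ε * (2 * m) := by
    simp [hα', hβ']; ring
  have h4 := (abs_le.1 ((Complex.abs_re_le_norm _).trans h1)).1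
  nlinarith [sq_nonneg (√(hsq B) - √(hsq C)), Real.sq_sqrt (hsq_nonneg B),
    Real.sq_sqrt (hsq_nonneg C)]

/-- The bounds that a completely positive extension of `[·, f; f*, ·]` has to satisfy: its value at
`y` is at most `tr α + tr β + 2 Re f(x)` whenever `y ≤ [α ⊗ e, x; x*, β ⊗ e]` in the bidual, with
positive scalar matrices `α` and `β`. -/
def paulsenCone (S : MatrixOrderedData X) (e : StrongDual ℂ (StrongDual ℂ X))
    (f : Matrix (Fin m) (Fin m) (StrongDual ℂ X)) :
    Set (Matrix (Fin (m + m)) (Fin (m + m)) X × ℝ) :=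
  {q | ∃ α β : Matrix (Fin m) (Fin m) ℂ, α.PosSemidef ∧ β.PosSemidef ∧
    ∃ x : Matrix (Fin m) (Fin m) X, α.trace.re + β.trace.re + 2 * (pair f x).re ≤ q.2 ∧
      ∀ g ∈ S.dual.cone (m + m), (pair g q.1).re ≤ diagValue e α β g +
        2 * (pair (sandwich (inlMat m m) g (inrMat m m)ᵀ) x).re}

/-- A form of Paulsen's trick: a map `f : X → M_m` of norm at most one is the corner of a
completely positive map into `M_{2m}` whose diagonal entries are contractive. -/
theorem exists_positive_extension {f : Matrix (Fin m) (Fin m) (StrongDual ℂ X)}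
    (hf : S.dual.matNorm m f ≤ 1) :
    ∃ G ∈ S.dual.cone (m + m), sandwich (inlMat m m) G (inrMat m m)ᵀ = f ∧
      ∀ v : Matrix (Fin m) (Fin 1) ℂ, (e (compress G ((inlMat m m)ᵀ * v))).re ≤ hsq v ∧
        (e (compress G ((inrMat m m)ᵀ * v))).re ≤ hsq v := by
  -- each `y` satisfies `y ≤ ‖y‖ (I ⊗ e)`
  have hbd : ∀ y : Matrix (Fin (m + m)) (Fin (m + m)) X,
      (y, 2 * m * S.matNorm _ y) ∈ paulsenCone S e f := fun y => by
    have hy := hS.matNorm_nonneg y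
    have hp : ((S.matNorm _ y : ℂ) • (1 : Matrix (Fin m) (Fin m) ℂ)).PosSemidef :=
      PosSemidef.one.smul (Complex.zero_le_real.2 hy)
    refine ⟨_, _, hp, hp, 0, ?_, fun g hg => ?_⟩
    · simp; apply le_of_eq; ring
    · have h := hE.re_pair_sandwich_le hS hg 1 1 (x := y) le_rfl
      rw [conjTranspose_one, one_sandwich_one, Matrix.one_mul, Matrix.mul_one] at h
      rw [diagValue_smul, diagValue_one, pair_zero, Complex.zero_re]
      linarith
  obtain ⟨ℓ, hℓ⟩ : ∃ ℓ : Matrix (Fin (m + m)) (Fin (m + m)) X →ₗ[ℝ] ℝ,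
      ∀ y c, (y, c) ∈ paulsenCone S e f → ℓ y ≤ c := by
    refine exists_linearMap_le_of_cone (paulsenCone S e f) ?_ ?_ ?_ (fun y => ⟨_, hbd y⟩) ?_
    · exact ⟨0, 0, PosSemidef.zero, PosSemidef.zero, 0, by simp, fun g _ => by simp [diagValue]⟩
    · rintro p ⟨α, β, hα, hβ, x, h1, h2⟩ q ⟨α', β', hα', hβ', x', h1', h2'⟩
      refine ⟨_, _, hα.add hα', hβ.add hβ', x + x', ?_, fun g hg => ?_⟩
      · simp only [trace_add, pair_add, Complex.add_re, Prod.snd_add]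
        linarith
      · have := h2 g hg
        have := h2' g hg
        simp only [diagValue_add, pair_add, Complex.add_re, Prod.fst_add]
        linarith
    · rintro c hc p ⟨α, β, hα, hβ, x, h1, h2⟩
      refine ⟨_, _, hα.smul (Complex.zero_le_real.2 hc.le), hβ.smul (Complex.zero_le_real.2 hc.le),
        (c : ℂ) • x, ?_, fun g hg => ?_⟩
      · simp only [trace_smul, smul_eq_mul, Complex.re_ofReal_mul, pair_smul, Prod.smul_snd]
        nlinarith
      · have h3 : (c • p).1 = (c : ℂ) • p.1 := (Complex.coe_smul c p.1).symm
        rw [h3, diagValue_smul]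
        simp only [Complex.re_ofReal_mul, pair_smul]
        nlinarith [h2 g hg]
    · rintro c ⟨α, β, hα, hβ, x, h1, h2⟩
      refine (hE.nonneg_of_diagValue hS hf hα hβ x fun g hg => ?_).trans h1
      simpa using h2 g hg
  obtain ⟨G, hG, hGℓ⟩ := hS.exists_mem_dual_cone ℓ (2 * m) (fun y => hℓ _ _ (hbd y)) fun p hp => by
    have := hℓ (-p) 0 ⟨0, 0, PosSemidef.zero, PosSemidef.zero, 0, by simp, fun g hg => by
      have := re_pair_nonneg hS hg hp
      simpa [diagValue, pair_neg] using this⟩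
    rw [map_neg] at this
    linarith
  -- on off-diagonal matrices the bound holds for `x` and for `-x`, hence with equality
  have hadj := ((mem_dual_cone_iff hS G).1 hG).1
  have hoff : ∀ x, ℓ (S.offDiag x) = 2 * (pair f x).re := by
    have h1 : ∀ x, ℓ (S.offDiag x) ≤ 2 * (pair f x).re := fun x =>
      hℓ _ _ ⟨0, 0, PosSemidef.zero, PosSemidef.zero, x, by simp, fun g hg => by
        have := re_pair_unitBlock (((mem_dual_cone_iff hS g).1 hg).1) 0 0 x
        rw [unitBlock_eq] at this
        simpa [diagValue] using this.le⟩
    refine fun x => le_antisymm (h1 x) ?_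
    have h2 := h1 (-x)
    have h3 : S.offDiag (-x) = -S.offDiag x := by
      rw [offDiag, adj_neg, ← neg_one_smul ℂ x, ← neg_one_smul ℂ (S.adj x), sandwich_smul,
        sandwich_smul, ← smul_add, neg_one_smul]
      rfl
    rw [h3, map_neg, pair_neg, Complex.neg_re] at h2
    linarith
  refine ⟨G, hG, ?_, ?_⟩
  · refine eq_of_forall_re_pair fun x => ?_
    have h1 := re_pair_unitBlock hadj 0 0 x
    have h2 : S.unitBlock 0 0 x = S.offDiag x := by rw [unitBlock_eq]; simp
    rw [h2, hGℓ, adj_offDiag hS, hoff] at h1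
    linarith
  · -- the norm of a compression of `G` is read off on the elements of the unit ball
    have key : ∀ (w : Matrix (Fin (m + m)) (Fin 1) ℂ) (r : ℝ) (α β : Matrix (Fin m) (Fin m) ℂ),
        α.PosSemidef → β.PosSemidef → α.trace.re + β.trace.re = r → 0 ≤ r →
        (∀ g ∈ S.dual.cone (m + m), diagValue e α β g = (e (compress g w)).re) →
        (e (compress G w)).re ≤ r := by
      intro w r α β hα hβ hr hr0 hw
      have hb : ∀ y : X, (compress G w y).re ≤ r * ‖y‖ := by
        have h1 : ∀ y : X, ‖y‖ ≤ 1 → ℓ (sandwich (wᴴ)ᵀ (single₁ y) wᵀ) ≤ r := fun y hy =>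
          hℓ _ _ ⟨α, β, hα, hβ, 0, by simp [hr], fun g hg => by
            rw [hw g hg, ← sandwich_pair, ← single₁_compress, pair_single₁,
              ← hE.norm_eq_of_mem_posCone hS (compress_mem hS.dual hg w), pair_zero,
              Complex.zero_re, mul_zero, add_zero]
            refine (Complex.re_le_norm _).trans (((compress g w).le_opNorm y).trans ?_)
            exact mul_le_of_le_one_right (norm_nonneg _) hy⟩
        have h2 : ∀ y : X, ‖y‖ ≤ 1 → (compress G w y).re ≤ r := fun y hy => by
          have e1 : (compress G w y).re = (pair G (sandwich (wᴴ)ᵀ (single₁ y) wᵀ)).re := by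
            rw [← sandwich_pair, ← single₁_compress, pair_single₁]
          have e2 : S.adj (sandwich (wᴴ)ᵀ (single₁ y) wᵀ) =
              sandwich (wᴴ)ᵀ (single₁ (S.invol y)) wᵀ := by
            rw [adj_sandwich, conjTranspose_transpose_eq_transpose_conjTranspose,
              conjTranspose_transpose_eq_transpose_conjTranspose wᴴ, conjTranspose_conjTranspose]
            rfl
          have e3 : ‖S.invol y‖ ≤ 1 := by
            have := hS.matNorm_adj 1 (single₁ y)
            rw [hS.matNorm_one] at this
            rw [← hS.matNorm_one]
            exact (this.le).trans hy
          rw [e1, hGℓ, e2]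
          have := h1 y hy
          have := h1 _ e3
          linarith
        intro y
        by_cases hy : y = 0
        · simp [hy]
        · have h3 := h2 ((‖y‖⁻¹ : ℝ) • y) (by rw [norm_smul]; simp [hy])
          rw [← Complex.coe_smul, map_smul, smul_eq_mul, Complex.re_ofReal_mul] at h3
          have : 0 < ‖y‖ := norm_pos_iff.2 hy
          field_simp at h3
          rwa [mul_comm] at h3
      rw [← hE.norm_eq_of_mem_posCone hS (compress_mem hS.dual hG w)]
      refine (compress G w).opNorm_le_bound hr0 fun y => ?_
      obtain ⟨c, hc, hcx⟩ := Complex.exists_norm_eq_mul_self (compress G w y)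
      have := hb (c • y)
      rw [map_smul, smul_eq_mul, ← hcx, Complex.ofReal_re, norm_smul, hc, one_mul] at this
      exact this
    intro v
    have hv : (v * vᴴ).PosSemidef := posSemidef_self_mul_conjTranspose v
    have hv2 : (v * vᴴ).trace.re = hsq v := by
      rw [trace_mul_comm, hsq_eq_re_trace]
    constructor
    · refine key _ _ (v * vᴴ) 0 hv PosSemidef.zero (by simp [hv2]) (hsq_nonneg v) fun g _ => ?_
      have := trace_mul_conjTranspose_mul_re e v g (inlMat m m)
      rw [inlMat_conjTranspose] at this
      simp [diagValue, this]
    · refine key _ _ 0 (v * vᴴ) PosSemidef.zero hv (by simp [hv2]) (hsq_nonneg v) fun g _ => ?_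
      have := trace_mul_conjTranspose_mul_re e v g (inrMat m m)
      rw [inrMat_conjTranspose] at this
      simp [diagValue, this]

end IsBidualUnit

end MatrixOrderedData

namespace MatrixOrderedData

open Matrix

variable {X : Type u} [NormedAddCommGroup X] [NormedSpace ℂ X] {S : MatrixOrderedData X}
  {e : StrongDual ℂ (StrongDual ℂ X)} {n k m : ℕ}

/-- A contractive diagonal entry `L G Lᵀ` of a positive functional is contractive on matrices. -/
lemma re_trace_le_of_compress (e : StrongDual ℂ (StrongDual ℂ X))
    {G : Matrix (Fin k) (Fin k) (StrongDual ℂ X)} {L : Matrix (Fin m) (Fin k) ℂ}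
    (h : ∀ v : Matrix (Fin m) (Fin 1) ℂ, (e (compress G (Lᴴ * v))).re ≤ hsq v)
    (η : Matrix (Fin m) (Fin n) ℂ) :
    ((Lᴴ * η)ᴴ * G.map e * (Lᴴ * η)).trace.re ≤ hsq η := by
  rw [← sandwich_map_functional, trace, Complex.re_sum, ← hsq_transpose, hsq]
  refine Finset.sum_le_sum fun j _ => ?_
  have h1 := h (Matrix.of fun i _ => η i j)
  have h2 : hsq (Matrix.of fun i (_ : Fin 1) => η i j) = ∑ i, ‖ηᵀ j i‖ ^ 2 := by simp [hsq]
  rw [h2] at h1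
  refine le_trans (le_of_eq ?_) h1
  simp [compress, sandwich_apply, mul_apply]

lemma injective_of_isCompleteIsometry {Y : Type v} [NormedAddCommGroup Y] [NormedSpace ℂ Y]
    (hS : S.IsSMOS) {T : MatrixOrderedData Y} (hT : T.matNorm 1 0 = 0) {φ : X →ₗ[ℂ] Y}
    (h : IsCompleteIsometry S T φ) : Function.Injective φ := by
  refine (injective_iff_map_eq_zero _).2 fun x hx => ?_
  have h1 := h 1 (single₁ x)
  have h2 : (single₁ x).map φ = 0 := by ext1 i j; exact hx
  rw [h2, hT, hS.matNorm_one] at h1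
  exact norm_eq_zero.1 h1.symm

lemma boundedOperators_matNorm_zero (H : Type u) [NormedAddCommGroup H] [InnerProductSpace ℂ H]
    [CompleteSpace H] : (boundedOperators H).matNorm n 0 = 0 := by
  have h : blockOp (0 : Matrix (Fin n) (Fin n) (H →L[ℂ] H)) = 0 := by
    ext ξ i
    simp [blockOp_apply]
  change ‖blockOp (0 : Matrix (Fin n) (Fin n) (H →L[ℂ] H))‖ = 0
  rw [h, norm_zero]

namespace IsBidualUnit

variable (hE : S.IsBidualUnit e) (hS : S.IsSMOS)
include hE hS

/-- The norm of the bidual is computed by the unital completely positive maps `g : X → M_k`, that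
is, by the elements `g ∈ M_k(X*)_+` with `e(g) = 1`. -/
lemma bidual_matNorm_le_iff (φ : Matrix (Fin n) (Fin n) (StrongDual ℂ (StrongDual ℂ X))) {t : ℝ}
    (ht : 0 ≤ t) : S.bidual.matNorm n φ ≤ t ↔
      ∀ (k : ℕ) (g : Matrix (Fin k) (Fin k) (StrongDual ℂ X)), g ∈ S.dual.cone k → g.map e = 1 →
        cstarNorm (amplify φ g) ≤ t := by
  constructor
  · intro h k g hg h1
    refine (IsSMOS.cstarNorm_amplify_le_iff φ g ht).2 fun η ξ => ?_
    refine (hS.dual.norm_pair_sandwich_le φ ηᴴ g ξ).trans ?_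
    rw [hsq_conjTranspose]
    have h2 : S.dual.dual.matNorm n φ * S.dual.matNorm k g ≤ t * 1 :=
      mul_le_mul h (hE.dual_matNorm_le_one hS hg h1) (hS.dual.matNorm_nonneg _) ht
    rw [mul_one] at h2
    gcongr
  · intro h
    -- the matrix `[t e, φ; φ*, t e]` is positive, since it is so on unital maps
    have hpos : S.bidual.unitBlock t e φ ∈ S.bidual.cone (n + n) := by
      refine hE.mem_bidual_cone_of_unital hS
        (adj_unitBlock hS.bidual t (invol_of_mem_posCone hS.bidual (hE.mem_posCone hS)) φ)
        fun g hg hg1 Z => ?_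
      have hZ := hS.dual.cone_sandwich hg Z
      have h1 := re_unitBlock_pair (S := S.dual) (((mem_dual_cone_iff hS _).1 hZ).1) t e φ
      have h2 : ∑ i, (e (sandwich Zᴴ g Z i i)).re =
          hsq (Z * (inlMat n n)ᵀ) + hsq (Z * (inrMat n n)ᵀ) := by
        have e1 : ∑ i, (e (sandwich Zᴴ g Z i i)).re = (Zᴴ * Z).trace.re := by
          have : Zᴴ * Z = (sandwich Zᴴ g Z).map e := by
            rw [sandwich_map_functional, hg1, Matrix.mul_one]
          rw [this, trace, Complex.re_sum]
          rfl
        have e2 : ∀ L : Matrix (Fin n) (Fin (n + n)) ℂ, Lᴴ = Lᵀ → hsq (Z * Lᵀ) =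
            ((Lᵀ * L) * (Zᴴ * Z)).trace.re := fun L hL => by
          rw [hsq_eq_re_trace, conjTranspose_mul, ← hL, conjTranspose_conjTranspose,
            Matrix.mul_assoc Lᴴ, trace_mul_comm Lᴴ]
          simp only [Matrix.mul_assoc]
        rw [e1, e2 _ inlMat_conjTranspose, e2 _ inrMat_conjTranspose, ← Complex.add_re,
          ← trace_add, ← Matrix.add_mul, inlMat_add_inrMat, Matrix.one_mul]
      have h3 := (IsSMOS.cstarNorm_amplify_le_iff φ g ht).1 (h _ g hg hg1) (Z * (inlMat n n)ᵀ)
        (Z * (inrMat n n)ᵀ)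
      have h4 : sandwich (inlMat n n) (sandwich Zᴴ g Z) (inrMat n n)ᵀ =
          sandwich (Z * (inlMat n n)ᵀ)ᴴ g (Z * (inrMat n n)ᵀ) := by
        rw [sandwich_sandwich, conjTranspose_mul, transpose_inl_conj]
      rw [h2, h4] at h1
      refine le_of_le_of_eq ?_ h1.symm
      have h5 := (abs_le.1 ((Complex.abs_re_le_norm _).trans h3)).1
      set a := hsq (Z * (inlMat n n)ᵀ)
      set b := hsq (Z * (inrMat n n)ᵀ)
      have ha : 0 ≤ a := hsq_nonneg _
      have hb : 0 ≤ b := hsq_nonneg _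
      nlinarith [Real.sq_sqrt ha, Real.sq_sqrt hb, mul_nonneg ht (sq_nonneg (√a - √b))]
    refine hS.dual.dual_matNorm_le_of_re φ ht fun m f η ξ hf => ?_
    -- evaluate this positive matrix at the extension `G` of a contraction `f`, compressed so that the
    -- corner becomes `-ηᴴ f ξ`
    obtain ⟨G, hG, hGf, hGv⟩ := hE.exists_positive_extension hS hf
    set W := (inrMat m m)ᴴ * ξ * inrMat n n - (inlMat m m)ᴴ * η * inlMat n n with hW
    have w1 : W * (inlMat n n)ᵀ = -((inlMat m m)ᴴ * η) := by
      simp [hW, Matrix.sub_mul, Matrix.mul_assoc]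
    have w2 : W * (inrMat n n)ᵀ = (inrMat m m)ᴴ * ξ := by
      simp [hW, Matrix.sub_mul, Matrix.mul_assoc]
    have hWG := hS.dual.cone_sandwich hG W
    have h1 := re_unitBlock_pair (S := S.dual) (((mem_dual_cone_iff hS _).1 hWG).1) t e φ
    have h2 := re_pair_nonneg hS.dual hpos hWG
    have h0 := h2.trans_eq h1
    have h3 : sandwich (inlMat n n) (sandwich Wᴴ G W) (inrMat n n)ᵀ = -sandwich ηᴴ f ξ := by
      have : inlMat n n * Wᴴ = -(ηᴴ * inlMat m m) := by
        have := congrArg conjTranspose w1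
        simpa [conjTranspose_mul, transpose_inl_conj] using this
      rw [sandwich_sandwich, w2, this, ← hGf, sandwich_sandwich, ← neg_one_smul ℂ,
        smul_sandwich, inrMat_conjTranspose]
      exact neg_one_smul ℂ (sandwich (ηᴴ * inlMat m m) G ((inrMat m m)ᵀ * ξ))
    have h4 : ∑ i, (e (sandwich Wᴴ G W i i)).re ≤ hsq η + hsq ξ := by
      have e1 : ∑ i, (e (sandwich Wᴴ G W i i)).re = (Wᴴ * G.map e * W).trace.re := by
        rw [← sandwich_map_functional, trace, Complex.re_sum]
        rfl
      have e2 : ∀ L : Matrix (Fin n) (Fin (n + n)) ℂ, Lᴴ = Lᵀ →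
          ((W * Lᵀ)ᴴ * G.map e * (W * Lᵀ)).trace =
            ((Lᵀ * L) * (Wᴴ * G.map e * W)).trace := fun L hL => by
        rw [conjTranspose_mul, ← hL, conjTranspose_conjTranspose, Matrix.mul_assoc Lᴴ,
          trace_mul_comm Lᴴ]
        simp only [Matrix.mul_assoc]
      have e3 : (Wᴴ * G.map e * W).trace.re = ((W * (inlMat n n)ᵀ)ᴴ * G.map e *
          (W * (inlMat n n)ᵀ)).trace.re + ((W * (inrMat n n)ᵀ)ᴴ * G.map e *
          (W * (inrMat n n)ᵀ)).trace.re := by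
        rw [e2 _ inlMat_conjTranspose, e2 _ inrMat_conjTranspose, ← Complex.add_re,
          ← trace_add, ← Matrix.add_mul, inlMat_add_inrMat, Matrix.one_mul]
      rw [e1, e3, w1, w2]
      have e4 := re_trace_le_of_compress e (L := inlMat m m)
        (fun v => by rw [inlMat_conjTranspose]; exact (hGv v).1) η
      have e5 := re_trace_le_of_compress e (L := inrMat m m)
        (fun v => by rw [inrMat_conjTranspose]; exact (hGv v).2) ξ
      have e6 : (-((inlMat m m)ᴴ * η))ᴴ * G.map e * -((inlMat m m)ᴴ * η) =
          ((inlMat m m)ᴴ * η)ᴴ * G.map e * ((inlMat m m)ᴴ * η) := by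
        simp only [conjTranspose_neg, Matrix.neg_mul, Matrix.mul_neg, neg_neg]
      rw [e6]
      linarith
    rw [h3, pair_neg, Complex.neg_re] at h0
    nlinarith [mul_le_mul_of_nonneg_left h4 ht]

/-- The matrix cone of the bidual is proper. -/
lemma bidual_isMOS : S.bidual.IsMOS where
  toIsSMOS := hS.bidual
  cone_proper n φ h1 h2 := by
    rw [← hS.bidual.matNorm_eq_zero_iff]
    refine le_antisymm ?_ (hS.bidual.matNorm_nonneg φ)
    refine (hE.bidual_matNorm_le_iff hS φ le_rfl).2 fun k g hg _ => ?_
    have h3 : (amplify φ g).PosSemidef := h1.2 k g hg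
    have h4 : (-amplify φ g).PosSemidef := h2.2 k g hg
    have h5 : amplify φ g = 0 := by
      open scoped MatrixOrder in
      exact le_antisymm (neg_nonneg.1 h4.nonneg) h3.nonneg
    rw [h5, cstarNorm_zero]

/-- The representations are contractive on the bidual, so that their direct sum is defined. -/
lemma cstarNorm_map_le {g : Matrix (Fin k) (Fin k) (StrongDual ℂ X)} (hg : g ∈ S.dual.cone k)
    (h1 : g.map e = 1) (φ : StrongDual ℂ (StrongDual ℂ X)) : cstarNorm (g.map φ) ≤ ‖φ‖ := by
  refine cstarNorm_le_of_forall _ (norm_nonneg φ) fun η ξ => ?_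
  have h2 := hS.dual.norm_pair_sandwich_le (single₁ φ) (Matrix.of fun i (_ : Fin 1) => η i)ᴴ g
    (Matrix.of fun i (_ : Fin 1) => ξ i)
  have h3 : star η ⬝ᵥ (g.map φ *ᵥ ξ) = pair (single₁ φ)
      (sandwich (Matrix.of fun i (_ : Fin 1) => η i)ᴴ g (Matrix.of fun i (_ : Fin 1) => ξ i)) := by
    simp only [pair, single₁, Finset.univ_unique, Finset.sum_singleton, of_apply, sandwich_apply,
      map_sum, map_smul, smul_eq_mul, dotProduct, mulVec, Finset.mul_sum, conjTranspose_apply,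
      Pi.star_apply, map_apply]
    exact Finset.sum_congr rfl fun i _ => Finset.sum_congr rfl fun j _ => by ring
  rw [h3]
  refine h2.trans ?_
  rw [hsq_conjTranspose, hS.dual.dual_matNorm_one]
  have h4 : ∀ v : Fin k → ℂ, hsq (Matrix.of fun i (_ : Fin 1) => v i) = ∑ i, ‖v i‖ ^ 2 :=
    fun v => by simp [hsq]
  rw [h4, h4]
  have h5 : ‖φ‖ * S.dual.matNorm k g ≤ ‖φ‖ :=
    mul_le_of_le_one_right (norm_nonneg φ) (hE.dual_matNorm_le_one hS hg h1)
  gcongr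

/-- The representation of the bidual on the direct sum of all unital completely positive maps from
`X` to matrix algebras. -/
theorem isUnitalOperatorSystem : S.bidual.IsUnitalOperatorSystem := by
  let J : Type u := Σ k : ℕ, {g : Matrix (Fin k) (Fin k) (StrongDual ℂ X) //
    g ∈ S.dual.cone k ∧ g.map e = 1}
  let g : ∀ j : J, Matrix (Fin j.1) (Fin j.1) (StrongDual ℂ X) := fun j => j.2.1
  have hg : ∀ j (φ : StrongDual ℂ (StrongDual ℂ X)), cstarNorm ((g j).map φ) ≤ ‖φ‖ := fun j φ =>
    hE.cstarNorm_map_le hS j.2.2.1 j.2.2.2 φ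
  have hiso : IsCompleteIsometry S.bidual (boundedOperators (RepSpace fun j : J => j.1))
      (rep g hg) := fun n φ => by
    have key : ∀ t : ℝ, 0 ≤ t → (‖blockOp (φ.map (rep g hg))‖ ≤ t ↔ S.bidual.matNorm n φ ≤ t) :=
      fun t ht => by
        rw [norm_blockOp_rep_le_iff g hg φ ht, hE.bidual_matNorm_le_iff hS φ ht]
        exact ⟨fun h k g hg h1 => h ⟨k, g, hg, h1⟩, fun h j => h j.1 (g j) j.2.2.1 j.2.2.2⟩
    exact le_antisymm ((key _ (hS.bidual.matNorm_nonneg φ)).2 le_rfl)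
      ((key _ (norm_nonneg _)).1 le_rfl)
  refine ⟨hE.bidual_isMOS hS, _, inferInstance, inferInstance, inferInstance, rep g hg,
    ⟨fun φ => ?_, ?_, fun n φ hφ => ?_⟩, hiso, e, rep_eq_id g hg fun j => j.2.2.2⟩
  · refine rep_eq_adjoint g hg fun j => ?_
    have hj := ((mem_dual_cone_iff hS _).1 j.2.2.1).1
    ext a b
    have h1 : S.dual.invol (g j a b) = g j b a := congrFun (congrFun hj b) a
    have h2 : S.bidual.invol φ (g j a b) = star (φ (S.dual.invol (g j a b))) := rfl
    rw [map_apply, h2, h1, conjTranspose_apply, map_apply]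
  · exact injective_of_isCompleteIsometry hS.bidual (boundedOperators_matNorm_zero _) hiso
  · refine Iff.trans ?_ (blockOp_rep_isPositive_iff g hg φ).symm
    constructor
    · exact fun h j ζ => (h.2 j.1 (g j) j.2.2.1).dotProduct_mulVec_nonneg ζ
    · refine fun h => hE.mem_bidual_cone_of_unital hS hφ fun g' hg' h1 Z => ?_
      obtain ⟨η, rfl⟩ := exists_toMat Z
      rw [← dotProduct_amplify]
      exact (Complex.nonneg_iff.1 (h ⟨_, g', hg', h1⟩ η)).1

end IsBidualUnit

/-- A space whose bidual is a unital operator system is an operator system, as it embeds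
completely isometrically and completely order isomorphically into its bidual. -/
theorem isOperatorSystem_of_bidual (hS : S.IsSMOS) (h : S.bidual.IsUnitalOperatorSystem) :
    S.IsOperatorSystem := by
  obtain ⟨hM, H, i1, i2, i3, Ψ, ⟨h1, h2, h3⟩, h4, -⟩ := h
  have hinj : Function.Injective (toBidual X) :=
    injective_of_isCompleteIsometry hS (hS.bidual.matNorm_zero) fun n x =>
      hS.bidual_matNorm_toBidual x
  have hmap : ∀ {n : ℕ} (x : Matrix (Fin n) (Fin n) X),
      x.map (Ψ.comp (toBidual X)) = (x.map (toBidual X)).map Ψ := fun x => rfl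
  have hadj : ∀ {n : ℕ} {x : Matrix (Fin n) (Fin n) X}, S.adj x = x →
      S.bidual.adj (x.map (toBidual X)) = x.map (toBidual X) := fun {n x} hx => by
    rw [adj_toBidual S, hx]
  refine ⟨⟨hS, fun n x hx hnx => ?_⟩, H, i1, i2, i3, Ψ.comp (toBidual X), ⟨fun x => ?_,
    h2.comp hinj, fun n x hx => ?_⟩, fun n x => ?_⟩
  · have hx' := (hS.mem_cone_iff_toBidual (hS.cone_sa n x hx)).1 hx
    have hnx' := (hS.mem_cone_iff_toBidual (hS.cone_sa n _ hnx)).1 hnx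
    have h5 : (-x).map (toBidual X) = -x.map (toBidual X) := by ext1 i j; simp
    rw [h5] at hnx'
    have h6 := hM.cone_proper n _ hx' hnx'
    rw [← hS.matNorm_eq_zero_iff, ← hS.bidual_matNorm_toBidual, h6, hS.bidual.matNorm_zero]
  · have := congrFun (congrFun (adj_toBidual S (single₁ x)) 0) 0
    have h5 : toBidual X (S.invol x) = S.bidual.invol (toBidual X x) := this.symm
    rw [LinearMap.comp_apply, LinearMap.comp_apply, h5, h1]
  · rw [hmap, ← h3 n _ (hadj hx), hS.mem_cone_iff_toBidual hx]
  · rw [hmap, h4, hS.bidual_matNorm_toBidual]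

end MatrixOrderedData

/-! ### Weakly matrix norm defining nets -/

namespace MatrixOrderedData

open Matrix

variable {X : Type u} [NormedAddCommGroup X] [NormedSpace ℂ X] {S : MatrixOrderedData X}
  {e : StrongDual ℂ (StrongDual ℂ X)} {n : ℕ}

/-- The linear functional on `M_n(X)` given by a matrix of functionals. -/
def pairLinearMap (f : Matrix (Fin n) (Fin n) (StrongDual ℂ X)) :
    Matrix (Fin n) (Fin n) X →ₗ[ℂ] ℂ where
  toFun := pair f
  map_add' := pair_add f
  map_smul' := pair_smul f

lemma isPosFunctional_pairLinearMap (hS : S.IsSMOS)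
    {f : Matrix (Fin n) (Fin n) (StrongDual ℂ X)} (hf : f ∈ S.dual.cone n) :
    S.IsPosFunctional (pairLinearMap f) where
  bounded := ⟨_, hS.norm_pair_le f⟩
  selfAdjoint := pair_eq_star ((mem_dual_cone_iff hS f).1 hf).1
  nonneg _ hx := re_pair_nonneg hS hf hx

/-- The bounded positive functionals on `M_n(X)` are given by `M_n(X*)_+`. -/
lemma IsPosFunctional.exists_pair (hS : S.IsSMOS) {F : Matrix (Fin n) (Fin n) X →ₗ[ℂ] ℂ}
    (hF : S.IsPosFunctional F) : ∃ f ∈ S.dual.cone n, ∀ y, F y = pair f y := by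
  obtain ⟨C, hC⟩ := hF.bounded
  let f : Matrix (Fin n) (Fin n) (StrongDual ℂ X) := fun i j =>
    (F ∘ₗ Matrix.singleLinearMap ℂ i j).mkContinuous |C| fun x => by
      refine (hC _).trans ?_
      exact mul_le_mul (le_abs_self C) (hS.matNorm_single_le i j x) (hS.matNorm_nonneg _)
        (abs_nonneg C)
  have hf : ∀ y, F y = pair f y := fun y => by
    conv_lhs => rw [Matrix.matrix_eq_sum_single y]
    simp only [map_sum]
    rfl
  refine ⟨f, (mem_dual_cone_iff hS f).2 ⟨eq_of_forall_re_pair fun x => ?_, fun x hx => ?_⟩, hf⟩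
  · rw [pair_dual_adj, ← hf, hF.selfAdjoint, star_star, hf]
  · rw [← hf]
    exact hF.nonneg x hx

lemma tendsto_coe_ereal_iff_nonneg {I : Type w} {l : Filter I} [l.NeBot] {u : I → ℝ} {r : ℝ}
    (h : Tendsto u l (𝓝 r)) :
    (∃ L : EReal, 0 ≤ L ∧ Tendsto (fun i => (u i : EReal)) l (𝓝 L)) ↔ 0 ≤ r := by
  have h' : Tendsto (fun i => (u i : EReal)) l (𝓝 (r : EReal)) :=
    (continuous_coe_real_ereal.tendsto r).comp h
  constructor
  · rintro ⟨L, hL, hu⟩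
    rw [tendsto_nhds_unique hu h'] at hL
    exact EReal.coe_nonneg.1 hL
  · exact fun hr => ⟨r, EReal.coe_nonneg.2 hr, h'⟩

section Net

variable {I : Type w} [Preorder I] {a : I → X}

/-- If `a_i` converges to `e` on positive functionals, then the condition in the definition of
`‖x‖_a^w` is positivity of `[t e, x; x*, t e]` in the bidual. -/
lemma forall_isPosFunctional_iff (hS : S.IsSMOS) (he : e ∈ S.bidual.posCone)
    [(atTop : Filter I).NeBot]
    (hlim : ∀ f ∈ S.dual.posCone, Tendsto (fun i => (f (a i)).re) atTop (𝓝 (e f).re))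
    (x : Matrix (Fin n) (Fin n) X) (t : ℝ) :
    (∀ F : Matrix (Fin (n + n)) (Fin (n + n)) X →ₗ[ℂ] ℂ, S.IsPosFunctional F →
      ∃ L : EReal, 0 ≤ L ∧
        Tendsto (fun i => (((F (S.unitBlock t (a i) x)).re : ℝ) : EReal)) atTop (𝓝 L)) ↔
    S.bidual.unitBlock t e (x.map (toBidual X)) ∈ S.bidual.cone (n + n) := by
  rw [unitBlock_mem_bidual_cone_iff hS he]
  have key : ∀ f ∈ S.dual.cone (n + n), Tendsto (fun i => (pair f (S.unitBlock t (a i) x)).re)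
      atTop (𝓝 (t * ∑ i, (e (f i i)).re +
        2 * (pair (sandwich (inlMat n n) f (inrMat n n)ᵀ) x).re)) := fun f hf => by
    simp only [re_pair_unitBlock ((mem_dual_cone_iff hS f).1 hf).1]
    exact ((tendsto_finsetSum _ fun i _ =>
      hlim _ (apply_mem_posCone hS.dual hf i)).const_mul t).add_const _
  constructor
  · intro h f hf
    exact (tendsto_coe_ereal_iff_nonneg (key f hf)).1 (h _ (isPosFunctional_pairLinearMap hS hf))
  · intro h F hF
    obtain ⟨f, hf, hfF⟩ := hF.exists_pair hS
    simp only [hfF]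
    exact (tendsto_coe_ereal_iff_nonneg (key f hf)).2 (h f hf)

/-- If `a_i` converges to `e` on positive functionals, then the net weakly defines the matrix norm
exactly if `e` is the unit of the bidual. -/
lemma weakNetNorm_eq_iff (hS : S.IsSMOS) (he : e ∈ S.bidual.posCone)
    [(atTop : Filter I).NeBot]
    (hlim : ∀ f ∈ S.dual.posCone, Tendsto (fun i => (f (a i)).re) atTop (𝓝 (e f).re))
    (x : Matrix (Fin n) (Fin n) X) :
    ENNReal.ofReal (S.matNorm n x) = S.weakNetNorm a x ↔ ∀ t : ℝ, 0 ≤ t →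
      (S.matNorm n x ≤ t ↔
        S.bidual.unitBlock t e (x.map (toBidual X)) ∈ S.bidual.cone (n + n)) := by
  unfold weakNetNorm
  simp only [forall_isPosFunctional_iff hS he hlim x]
  constructor
  · intro h t ht
    constructor
    -- the infimum need not be attained by its definition, but the cone of the bidual is closed
    · intro hxt
      rw [unitBlock_mem_bidual_cone_iff hS he]
      intro f hf
      have hA : 0 ≤ ∑ i, (e (f i i)).re := Finset.sum_nonneg fun i _ =>
        re_apply_nonneg hS.dual he (apply_mem_posCone hS.dual hf i)
      refine nonneg_of_forall_add_mul (b := ∑ i, (e (f i i)).re) fun ε hε => ?_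
      have h1 : ENNReal.ofReal (S.matNorm n x) < ENNReal.ofReal (t + ε) :=
        (ENNReal.ofReal_lt_ofReal_iff (by linarith)).2 (by linarith)
      rw [h, iInf_lt_iff] at h1
      obtain ⟨t', h1⟩ := h1
      rw [iInf_lt_iff] at h1
      obtain ⟨h2, h3⟩ := h1
      have h4 : (t' : ℝ) ≤ t + ε := by
        rw [← ENNReal.ofReal_coe_nnreal] at h3
        exact ((ENNReal.ofReal_lt_ofReal_iff (by linarith)).1 h3).le
      have h5 := (unitBlock_mem_bidual_cone_iff hS he x _).1 h2 f hf
      nlinarith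
    · intro hx
      have h1 : ENNReal.ofReal (S.matNorm n x) ≤ ENNReal.ofReal t := by
        rw [h]
        exact iInf₂_le (⟨t, ht⟩ : ℝ≥0) hx |>.trans (ENNReal.ofReal_eq_coe_nnreal ht).symm.le
      exact (ENNReal.ofReal_le_ofReal_iff ht).1 h1
  · intro h
    refine le_antisymm (le_iInf₂ fun t ht => ?_) ?_
    · exact ENNReal.ofReal_le_of_le_toReal (by simpa using (h t t.2).2 ht)
    · refine iInf₂_le_of_le ⟨S.matNorm n x, hS.matNorm_nonneg x⟩
        ((h _ (hS.matNorm_nonneg x)).1 le_rfl) ?_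
      exact (ENNReal.ofReal_eq_coe_nnreal (hS.matNorm_nonneg x)).symm.le

/-- The matrix `[c, b; b, c]` is positive for `0 ≤ b ≤ c`, being `diag(c - b, c - b) + [b, b; b, b]`.
-/
lemma unitBlock_self_mem_cone (hS : S.IsSMOS) {b c : X} (hb : b ∈ S.posCone) (hbc : S.le b c) :
    S.unitBlock 1 c (single₁ b) ∈ S.cone (1 + 1) := by
  have h1 : S.unitBlock 1 c (single₁ b) = diagonal (fun _ => c - b) +
      sandwich (inlMat 1 1 + inrMat 1 1)ᴴ (single₁ b) (inlMat 1 1 + inrMat 1 1) := by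
    have hb' := invol_of_mem_posCone hS hb
    have e1 : diagonal (fun _ : Fin (1 + 1) => b) =
        sandwich (inlMat 1 1)ᵀ (single₁ b) (inlMat 1 1) +
          sandwich (inrMat 1 1)ᵀ (single₁ b) (inrMat 1 1) := by
      ext i j
      refine Fin.addCases (fun i => ?_) (fun i => ?_) i <;>
      refine Fin.addCases (fun j => ?_) (fun j => ?_) j <;>
      obtain rfl := Subsingleton.elim i 0 <;> obtain rfl := Subsingleton.elim j 0 <;>
      simp [sandwich_apply, single₁, inlMat, inrMat, -Fin.natAdd_eq_addNat]
    have e2 : S.adj (single₁ b) = single₁ b := by ext i j; exact hb'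
    have e3 : diagonal (fun _ : Fin (1 + 1) => c - b) =
        diagonal (fun _ => c) - diagonal (fun _ => b) := (diagonal_sub _ _).symm
    rw [unitBlock_eq, e3, e1, conjTranspose_add, inlMat_conjTranspose, inrMat_conjTranspose,
      add_sandwich, sandwich_add_right, sandwich_add_right, offDiag, e2]
    simp only [Complex.ofReal_one, one_smul]
    abel
  rw [h1]
  exact hS.cone_add (diagonal_mem_cone hS hbc) (hS.cone_sandwich hb _)

/-- The elements of a weakly matrix norm defining net are contractions. -/
lemma IsWeaklyMatrixNormDefining.norm_le_one (hS : S.IsSMOS)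
    (ha : S.IsWeaklyMatrixNormDefining a) (j : I) : ‖a j‖ ≤ 1 := by
  have := ha.1.nonempty
  have := ha.1.directed
  have h1 : S.weakNetNorm a (single₁ (a j)) ≤ (1 : ℝ≥0) := by
    refine iInf₂_le (1 : ℝ≥0) fun F hF => ?_
    obtain ⟨f, hf, hfF⟩ := hF.exists_pair hS
    -- the values at `[a_i, a_j; a_j, a_i]` increase with `i`, and are nonnegative from `i = j` on
    have hmono : Monotone fun i => (((F (S.unitBlock (1 : ℝ≥0) (a i) (single₁ (a j)))).re : ℝ) :
        EReal) := fun i k hik => by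
      refine EReal.coe_le_coe_iff.2 ?_
      rw [hfF, hfF, re_pair_unitBlock ((mem_dual_cone_iff hS f).1 hf).1,
        re_pair_unitBlock ((mem_dual_cone_iff hS f).1 hf).1]
      simp only [NNReal.coe_one, one_mul]
      refine add_le_add (Finset.sum_le_sum fun l _ => ?_) le_rfl
      have h2 := re_apply_nonneg hS (apply_mem_posCone hS.dual hf l) (ha.1.mono i k hik)
      rw [map_sub, Complex.sub_re] at h2
      linarith
    refine ⟨_, ?_, tendsto_atTop_iSup hmono⟩
    refine le_trans ?_ (le_iSup _ j)
    refine EReal.coe_nonneg.2 (hF.nonneg _ ?_)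
    refine unitBlock_self_mem_cone hS (ha.1.mem_posCone j) ?_
    exact ha.1.mono j j le_rfl
  rw [← ha.2, hS.matNorm_one] at h1
  rw [← ENNReal.ofReal_coe_nnreal] at h1
  exact (ENNReal.ofReal_le_ofReal_iff zero_le_one).1 h1

/-- The weak* limit of a weakly matrix norm defining net is the unit of the bidual. -/
theorem IsWeaklyMatrixNormDefining.exists_isBidualUnit (hS : S.IsSMOS)
    (ha : S.IsWeaklyMatrixNormDefining a) : ∃ e, S.IsBidualUnit e := by
  have := ha.1.nonempty
  have := ha.1.directed
  -- a weak* cluster point; on positive functionals the net converges to it by monotonicity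
  let U : Ultrafilter I := Ultrafilter.of atTop
  have hU : (U : Filter I) ≤ atTop := Ultrafilter.of_le atTop
  let E : I → WeakDual ℂ (StrongDual ℂ X) := fun i => StrongDual.toWeakDual (toBidual X (a i))
  have hE : ∀ i, E i ∈ WeakDual.toStrongDual ⁻¹'
      Metric.closedBall (0 : StrongDual ℂ (StrongDual ℂ X)) 1 := fun i => by
    have h : ‖toBidual X (a i)‖ ≤ 1 :=
      (NormedSpace.double_dual_bound ℂ X (a i)).trans (ha.norm_le_one hS i)
    exact (mem_closedBall_zero_iff (E := StrongDual ℂ (StrongDual ℂ X))).2 h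
  obtain ⟨e', he1, he'⟩ := (WeakDual.isCompact_closedBall (𝕜 := ℂ)
    (0 : StrongDual ℂ (StrongDual ℂ X)) 1).ultrafilter_le_nhds (U.map E)
    (le_principal_iff.2 (Filter.mem_map.2 (Filter.univ_mem' hE)))
  let e : StrongDual ℂ (StrongDual ℂ X) := WeakDual.toStrongDual e'
  have hn : ‖e‖ ≤ 1 := (mem_closedBall_zero_iff (E := StrongDual ℂ (StrongDual ℂ X))).1 he1
  have hlimU : ∀ f : StrongDual ℂ X, Tendsto (fun i => f (a i)) U (𝓝 (e f)) := fun f =>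
    ((WeakDual.eval_continuous f).tendsto e').comp he'
  have he : e ∈ S.bidual.posCone := by
    refine (mem_dual_cone_iff hS.dual _).2 ⟨?_, fun f hf => ?_⟩
    · ext i j f
      have h1 := hlimU (S.dual.invol f)
      have h2 : ∀ i, S.dual.invol f (a i) = star (f (a i)) := fun i => by
        have : S.dual.invol f (a i) = star (f (S.invol (a i))) := rfl
        rw [this, invol_of_mem_posCone hS (ha.1.mem_posCone i)]
      simp only [h2] at h1
      have h3 := (hlimU f).star
      have h4 : e (S.dual.invol f) = star (e f) := tendsto_nhds_unique h1 h3
      have h5 : S.dual.dual.adj (single₁ e) i j f = star (e (S.dual.invol f)) := rfl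
      rw [h5, h4, star_star]
      rfl
    · have h1 := (Complex.continuous_re.tendsto _).comp (hlimU (f 0 0))
      have h2 : pair (single₁ e) f = e (f 0 0) := by simp [pair, single₁]
      rw [h2]
      refine ge_of_tendsto' h1 fun i => ?_
      exact re_apply_nonneg hS (apply_mem_posCone hS.dual hf 0) (ha.1.mem_posCone i)
  have hlim : ∀ f ∈ S.dual.posCone, Tendsto (fun i => (f (a i)).re) atTop (𝓝 (e f).re) := by
    intro f hf
    have hmono : Monotone fun i => (f (a i)).re := fun i k hik => by
      have h2 := re_apply_nonneg hS hf (ha.1.mono i k hik)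
      rw [map_sub, Complex.sub_re] at h2
      change (f (a i)).re ≤ (f (a k)).re
      linarith
    have hbdd : BddAbove (Set.range fun i => (f (a i)).re) := by
      refine ⟨‖f‖, ?_⟩
      rintro _ ⟨i, rfl⟩
      refine (Complex.re_le_norm _).trans ((f.le_opNorm _).trans ?_)
      exact mul_le_of_le_one_right (norm_nonneg f) (ha.norm_le_one hS i)
    have h1 := tendsto_atTop_ciSup hmono hbdd
    have h2 := (Complex.continuous_re.tendsto _).comp (hlimU f)
    rwa [tendsto_nhds_unique (h1.mono_left hU) h2] at h1
  exact ⟨e, hn, fun n x => (weakNetNorm_eq_iff hS he hlim x).1 (ha.2 n x)⟩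

/-- An increasing net that converges to the unit of the bidual weakly defines the matrix norm. -/
theorem IsBidualUnit.isWeaklyMatrixNormDefining (hE : S.IsBidualUnit e) (hS : S.IsSMOS)
    (ha : S.IsIncreasingNet a)
    (hlim : ∀ f ∈ S.dual.posCone, Tendsto (fun i => (f (a i)).re) atTop (𝓝 (e f).re)) :
    S.IsWeaklyMatrixNormDefining a := by
  have := ha.nonempty
  have := ha.directed
  exact ⟨ha, fun n x => (weakNetNorm_eq_iff hS (hE.mem_posCone hS) hlim x).2
    (hE.matNorm_le_iff n x)⟩

end Net

end MatrixOrderedData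

/-! ### The open positive ball as an approximate unit -/

namespace MatrixOrderedData

open Matrix

variable {X : Type u} [NormedAddCommGroup X] [NormedSpace ℂ X] {S : MatrixOrderedData X}
  {e : StrongDual ℂ (StrongDual ℂ X)}

/-- The case of `1 × 1`-matrices of `IsSMOS.exists_mem_dual_cone`. -/
lemma exists_mem_dual_posCone (hS : S.IsSMOS) (ℓ : X →ₗ[ℝ] ℝ) (C : ℝ) (h : ∀ y, ℓ y ≤ C * ‖y‖)
    (hpos : ∀ y ∈ S.posCone, 0 ≤ ℓ y) :
    ∃ f ∈ S.dual.posCone, ∀ y, S.invol y = y → (f y).re = ℓ y := by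
  have hs : ∀ y : Matrix (Fin 1) (Fin 1) X, single₁ (y 0 0) = y := fun y => by
    ext i j
    obtain rfl := Subsingleton.elim i 0
    obtain rfl := Subsingleton.elim j 0
    rfl
  let ℓ' : Matrix (Fin 1) (Fin 1) X →ₗ[ℝ] ℝ := ℓ ∘ₗ Matrix.entryLinearMap ℝ X 0 0
  obtain ⟨F, hF, hFℓ⟩ := hS.exists_mem_dual_cone ℓ' C
    (fun y => by
      have := h (y 0 0)
      rwa [← hS.matNorm_one, hs] at this)
    (fun y hy => hpos (y 0 0) (by change single₁ (y 0 0) ∈ S.cone 1; rwa [hs]))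
  have hF' : single₁ (F 0 0) = F := by
    ext i j : 2
    obtain rfl := Subsingleton.elim i 0
    obtain rfl := Subsingleton.elim j 0
    rfl
  refine ⟨F 0 0, by change single₁ (F 0 0) ∈ S.dual.cone 1; rwa [hF'], fun y hy => ?_⟩
  have h1 := hFℓ (single₁ y)
  have h2 : S.adj (single₁ y) = single₁ y := by ext i j; exact hy
  rw [h2, add_self_div_two, ← hF', pair_single₁] at h1
  exact h1

lemma norm_invol (hS : S.IsSMOS) (x : X) : ‖S.invol x‖ = ‖x‖ := by
  rw [← hS.matNorm_one, ← hS.matNorm_one, ← hS.matNorm_adj 1 (single₁ x)]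
  rfl

lemma isClosed_posCone (hS : S.IsSMOS) : IsClosed S.posCone := by
  refine isClosed_of_closure_subset fun x hx => ?_
  refine hS.cone_closed 1 _ fun ε hε => ?_
  obtain ⟨y, hy, hxy⟩ := Metric.mem_closure_iff.1 hx ε hε
  refine ⟨single₁ y, hy, ?_⟩
  have h : single₁ x - single₁ y = single₁ (x - y) := rfl
  rwa [h, hS.matNorm_one, ← dist_eq_norm]

lemma sum_mem_posCone (hS : S.IsSMOS) {ι : Type*} (s : Finset ι) {p : ι → X}
    (hp : ∀ i ∈ s, p i ∈ S.posCone) : ∑ i ∈ s, p i ∈ S.posCone := by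
  classical
  induction s using Finset.induction_on with
  | empty => simpa using zero_mem_posCone hS
  | insert a s ha ih =>
    rw [Finset.sum_insert ha]
    exact add_mem_posCone hS (hp _ (Finset.mem_insert_self _ _))
      (ih fun i hi => hp i (Finset.mem_insert_of_mem hi))

lemma le_refl' (hS : S.IsSMOS) (x : X) : S.le x x := by
  unfold le
  rw [sub_self]
  exact zero_mem_posCone hS

lemma le_trans' (hS : S.IsSMOS) {x y z : X} (h : S.le x y) (h' : S.le y z) : S.le x z := by
  have := add_mem_posCone hS h h'
  rwa [sub_add_sub_cancel'] at this

/-- The norm of a positive functional is determined on self-adjoint elements. -/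
lemma norm_le_of_selfAdjoint (hS : S.IsSMOS) {f : StrongDual ℂ X} (hf : f ∈ S.dual.posCone) {c : ℝ}
    (hc : 0 ≤ c) (h : ∀ u, S.invol u = u → ‖u‖ ≤ 1 → (f u).re ≤ c) : ‖f‖ ≤ c := by
  have h1 : ∀ u, ‖u‖ ≤ 1 → (f u).re ≤ c := fun u hu => by
    have h2 := h ((1 / 2 : ℝ) • (u + S.invol u))
      (by
        rw [← Complex.coe_smul, map_smulₛₗ, map_add, hS.invol_invol, add_comm, Complex.conj_ofReal])
      (by
        rw [norm_smul]
        have := norm_add_le u (S.invol u)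
        rw [norm_invol hS] at this
        norm_num
        linarith)
    have h3 : f (S.invol u) = star (f u) := by
      have h4 : S.dual.invol f = f := invol_of_mem_posCone hS.dual hf
      have h5 : S.dual.invol f u = star (f (S.invol u)) := rfl
      rw [h4] at h5
      rw [h5, star_star]
    rw [← Complex.coe_smul, map_smul, map_add, h3, smul_eq_mul, Complex.re_ofReal_mul,
      Complex.add_re, Complex.star_def, Complex.conj_re] at h2
    linarith
  refine f.opNorm_le_of_unit_norm hc fun x hx => ?_
  obtain ⟨z, hz, hzx⟩ := Complex.exists_norm_eq_mul_self (f x)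
  have h2 := h1 (z • x) (by rw [norm_smul, hz, hx, one_mul])
  rw [map_smul, smul_eq_mul, ← hzx, Complex.ofReal_re] at h2
  exact h2

namespace IsBidualUnit

variable (hE : S.IsBidualUnit e) (hS : S.IsSMOS)
include hE hS

/-- The norm is additive on positive functionals.  By duality, two self-adjoint elements of the
ball of radius `r` have, up to a small error, a common upper bound in this ball. -/
lemma exists_approx_upper_bound {x y : X} {r d : ℝ} (hr : 0 < r) (hd : 0 < d)
    (hx : S.invol x = x) (hy : S.invol y = y) (hxr : ‖x‖ ≤ r) (hyr : ‖y‖ ≤ r) :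
    ∃ u, S.invol u = u ∧ ‖u‖ ≤ r ∧ ∃ p ∈ S.posCone, ∃ q ∈ S.posCone,
      ‖x - (u - p)‖ + ‖y - (u - q)‖ < d := by
  by_contra! hcon
  -- Otherwise `(x, y)` can be separated from the pairs `(u - p, u - q)` by functionals `F, G ≥ 0` with
  -- `(F + G)(u) + d ≤ F(x) + G(y)`, so that `r ‖F + G‖ + d ≤ r ‖F‖ + r ‖G‖`.
  let K : Set ((X × X) × ℝ) := {z | ∃ s : ℝ, 0 ≤ s ∧ ∃ u, S.invol u = u ∧ ‖u‖ ≤ s * r ∧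
    ∃ p ∈ S.posCone, ∃ q ∈ S.posCone,
      ‖z.1.1 - (u - p) + (s : ℂ) • x‖ + ‖z.1.2 - (u - q) + (s : ℂ) • y‖ - s * d ≤ z.2}
  obtain ⟨ℓ, hℓ⟩ : ∃ ℓ : X × X →ₗ[ℝ] ℝ, ∀ v c, (v, c) ∈ K → ℓ v ≤ c := by
    have h0 := zero_mem_posCone hS
    refine exists_linearMap_le_of_cone K ⟨0, le_rfl, 0, by simp, by simp, 0, h0, 0, h0, by simp⟩
      ?_ ?_ (fun v => ⟨‖v.1‖ + ‖v.2‖, 0, le_rfl, 0, by simp, by simp, 0, h0, 0, h0, by simp⟩) ?_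
    · rintro z ⟨s, hs, u, hu, hur, p, hp, q, hq, h⟩ z' ⟨s', hs', u', hu', hur', p', hp', q', hq', h'⟩
      refine ⟨s + s', add_nonneg hs hs', u + u', by rw [map_add, hu, hu'],
        (norm_add_le _ _).trans (by linarith), p + p', add_mem_posCone hS hp hp', q + q',
        add_mem_posCone hS hq hq', ?_⟩
      have e1 : (z + z').1.1 - (u + u' - (p + p')) + ((s + s' : ℝ) : ℂ) • x =
          (z.1.1 - (u - p) + (s : ℂ) • x) + (z'.1.1 - (u' - p') + (s' : ℂ) • x) := by
        simp only [Prod.fst_add, Complex.ofReal_add, add_smul]; abel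
      have e2 : (z + z').1.2 - (u + u' - (q + q')) + ((s + s' : ℝ) : ℂ) • y =
          (z.1.2 - (u - q) + (s : ℂ) • y) + (z'.1.2 - (u' - q') + (s' : ℂ) • y) := by
        simp only [Prod.fst_add, Prod.snd_add, Complex.ofReal_add, add_smul]; abel
      rw [e1, e2, Prod.snd_add]
      have := norm_add_le (z.1.1 - (u - p) + (s : ℂ) • x) (z'.1.1 - (u' - p') + (s' : ℂ) • x)
      have := norm_add_le (z.1.2 - (u - q) + (s : ℂ) • y) (z'.1.2 - (u' - q') + (s' : ℂ) • y)
      linarith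
    · rintro c hc z ⟨s, hs, u, hu, hur, p, hp, q, hq, h⟩
      have hcn : ‖(c : ℂ)‖ = c := by rw [Complex.norm_real, Real.norm_eq_abs, abs_of_pos hc]
      refine ⟨c * s, by positivity, (c : ℂ) • u, by rw [map_smulₛₗ, hu, Complex.conj_ofReal],
        by rw [norm_smul, hcn]; nlinarith, (c : ℂ) • p, smul_mem_posCone hS hp hc.le,
        (c : ℂ) • q, smul_mem_posCone hS hq hc.le, ?_⟩
      have e1 : (c • z).1.1 - ((c : ℂ) • u - (c : ℂ) • p) + ((c * s : ℝ) : ℂ) • x =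
          (c : ℂ) • (z.1.1 - (u - p) + (s : ℂ) • x) := by
        simp only [Prod.smul_fst, Complex.ofReal_mul, smul_add, smul_sub, mul_smul,
          Complex.coe_smul]
      have e2 : (c • z).1.2 - ((c : ℂ) • u - (c : ℂ) • q) + ((c * s : ℝ) : ℂ) • y =
          (c : ℂ) • (z.1.2 - (u - q) + (s : ℂ) • y) := by
        simp only [Prod.smul_fst, Prod.smul_snd, Complex.ofReal_mul, smul_add, smul_sub, mul_smul,
          Complex.coe_smul]
      rw [e1, e2, norm_smul, norm_smul, hcn, Prod.smul_snd, smul_eq_mul]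
      nlinarith
    · rintro c ⟨s, hs, u, hu, hur, p, hp, q, hq, h⟩
      rcases hs.eq_or_lt with rfl | hs
      · refine le_trans ?_ h
        simp only [zero_mul, sub_zero]
        positivity
      · have hsn : ‖(s : ℂ)‖ = s := by rw [Complex.norm_real, Real.norm_eq_abs, abs_of_pos hs]
        have hs' : (s : ℂ) ≠ 0 := by exact_mod_cast hs.ne'
        have h1 := hcon (((s⁻¹ : ℝ) : ℂ) • u) (by rw [map_smulₛₗ, hu, Complex.conj_ofReal])
          (by
            rw [norm_smul, Complex.norm_real, Real.norm_eq_abs, abs_of_pos (by positivity)]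
            rw [inv_mul_le_iff₀ hs]
            exact hur)
          _ (smul_mem_posCone hS hp (inv_nonneg.2 hs.le)) _
          (smul_mem_posCone hS hq (inv_nonneg.2 hs.le))
        have e1 : ∀ a b : X, (0 : X) - (u - a) + (s : ℂ) • b =
            (s : ℂ) • (b - (((s⁻¹ : ℝ) : ℂ) • u - ((s⁻¹ : ℝ) : ℂ) • a)) := fun a b => by
          rw [smul_sub, smul_sub, smul_smul, smul_smul, Complex.ofReal_inv, mul_inv_cancel₀ hs',
            one_smul, one_smul]
          abel
        simp only [Prod.fst_zero, Prod.snd_zero] at h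
        rw [e1, e1, norm_smul, norm_smul, hsn] at h
        nlinarith
  have h0 := zero_mem_posCone hS
  have hb : ∀ v : X × X, ℓ v ≤ ‖v.1‖ + ‖v.2‖ := fun v =>
    hℓ _ _ ⟨0, le_rfl, 0, by simp, by simp, 0, h0, 0, h0, by simp⟩
  have hp : ∀ p ∈ S.posCone, ∀ q ∈ S.posCone, 0 ≤ ℓ (p, q) := fun p hp q hq => by
    have h := hℓ (-(p, q)) 0 ⟨0, le_rfl, 0, by simp, by simp, p, hp, q, hq, by simp⟩
    rw [map_neg] at h
    linarith
  have hu : ∀ u, S.invol u = u → ‖u‖ ≤ r → ℓ (u, u) + d ≤ ℓ (x, y) := fun u hu hur => by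
    have h := hℓ ((u, u) - (x, y)) (-d) ⟨1, zero_le_one, u, hu, by simpa using hur, 0, h0, 0, h0,
      by simp⟩
    rw [map_sub] at h
    linarith
  have hsplit : ∀ a b : X, ℓ (a, b) = ℓ (a, 0) + ℓ (0, b) := fun a b => by
    rw [← map_add]; simp
  obtain ⟨F, hF, hFℓ⟩ := exists_mem_dual_posCone hS (ℓ ∘ₗ LinearMap.inl ℝ X X) 1
    (fun y => by simpa using hb (y, 0)) (fun p h => hp p h 0 h0)
  obtain ⟨G, hG, hGℓ⟩ := exists_mem_dual_posCone hS (ℓ ∘ₗ LinearMap.inr ℝ X X) 1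
    (fun y => by simpa using hb (0, y)) (fun p h => hp 0 h0 p h)
  simp only [LinearMap.comp_apply, LinearMap.inl_apply, LinearMap.inr_apply] at hFℓ hGℓ
  have hFG := add_mem_posCone hS.dual hF hG
  have hn : ‖F + G‖ = ‖F‖ + ‖G‖ := by
    rw [hE.norm_eq_of_mem_posCone hS hF, hE.norm_eq_of_mem_posCone hS hG,
      hE.norm_eq_of_mem_posCone hS hFG, map_add, Complex.add_re]
  have hxy : ℓ (x, y) ≤ r * ‖F‖ + r * ‖G‖ := by
    rw [hsplit, ← hFℓ x hx, ← hGℓ y hy]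
    have h1 := (Complex.re_le_norm (F x)).trans (F.le_opNorm x)
    have h2 := (Complex.re_le_norm (G y)).trans (G.le_opNorm y)
    nlinarith [mul_le_mul_of_nonneg_left hxr (norm_nonneg F),
      mul_le_mul_of_nonneg_left hyr (norm_nonneg G)]
  have h1 : ‖F + G‖ ≤ (ℓ (x, y) - d) / r := by
    refine norm_le_of_selfAdjoint hS hFG ?_ fun u hu' hu1 => ?_
    · have := hu 0 (map_zero _) (by simpa using hr.le)
      rw [Prod.mk_zero_zero, map_zero] at this
      exact div_nonneg (by linarith) hr.le
    · rw [le_div_iff₀ hr]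
      have h2 : S.invol ((r : ℂ) • u) = (r : ℂ) • u := by rw [map_smulₛₗ, hu', Complex.conj_ofReal]
      have h3 := hu ((r : ℂ) • u) h2 (by
        rw [norm_smul, Complex.norm_real, Real.norm_eq_abs, abs_of_pos hr]
        exact mul_le_of_le_one_right hr.le hu1)
      rw [hsplit, ← hFℓ _ h2, ← hGℓ _ h2, map_smul, map_smul, smul_eq_mul, smul_eq_mul,
        Complex.re_ofReal_mul, Complex.re_ofReal_mul] at h3
      have h4 : ((F + G) u).re = (F u).re + (G u).re := rfl
      rw [h4]
      linarith
  rw [le_div_iff₀ hr, hn] at h1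
  linarith

end IsBidualUnit

end MatrixOrderedData

namespace MatrixOrderedData

open Matrix

variable {X : Type u} [NormedAddCommGroup X] [NormedSpace ℂ X] {S : MatrixOrderedData X}
  {e : StrongDual ℂ (StrongDual ℂ X)}

/-- The order of `X`, on the open unit ball of the cone. -/
@[reducible] def openPosBallPreorder (hS : S.IsSMOS) : Preorder S.openPosBall where
  le u v := S.le u v
  le_refl u := le_refl' hS u
  le_trans _ _ _ := le_trans' hS

namespace IsBidualUnit

variable (hE : S.IsBidualUnit e) (hS : S.IsSMOS)
include hE hS

/-- The approximate upper bounds improve to an exact one, of norm at most `2 r`, by successive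
correction of the errors. -/
lemma exists_upper_bound_of_norm_le [CompleteSpace X] {x y : X} {r : ℝ} (hr : 0 < r)
    (hx : S.invol x = x) (hy : S.invol y = y) (hxr : ‖x‖ ≤ r) (hyr : ‖y‖ ≤ r) :
    ∃ u, S.invol u = u ∧ ‖u‖ ≤ 2 * r ∧ S.le x u ∧ S.le y u := by
  have step : ∀ (k : ℕ) (z : X × X), (S.invol z.1 = z.1 ∧ S.invol z.2 = z.2 ∧
      ‖z.1‖ ≤ r * (1 / 2) ^ k ∧ ‖z.2‖ ≤ r * (1 / 2) ^ k) → ∃ u p q : X, S.invol u = u ∧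
      ‖u‖ ≤ r * (1 / 2) ^ k ∧ p ∈ S.posCone ∧ q ∈ S.posCone ∧
      ‖z.1 - (u - p)‖ ≤ r * (1 / 2) ^ (k + 1) ∧ ‖z.2 - (u - q)‖ ≤ r * (1 / 2) ^ (k + 1) := by
    rintro k z ⟨h1, h2, h3, h4⟩
    obtain ⟨u, hu, hur, p, hp, q, hq, h⟩ := hE.exists_approx_upper_bound hS
      (r := r * (1 / 2) ^ k) (d := r * (1 / 2) ^ (k + 1)) (by positivity) (by positivity) h1 h2 h3 h4
    exact ⟨u, p, q, hu, hur, hp, hq, by linarith [norm_nonneg (z.2 - (u - q))],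
      by linarith [norm_nonneg (z.1 - (u - p))]⟩
  choose! U P Q hU hUr hP hQ h1 h2 using step
  -- the errors `z k` that remain after `k` corrections
  obtain ⟨z, hz0, hz⟩ : ∃ z : ℕ → X × X, z 0 = (x, y) ∧ ∀ k, z (k + 1) =
      ((z k).1 - (U k (z k) - P k (z k)), (z k).2 - (U k (z k) - Q k (z k))) :=
    ⟨fun k => Nat.rec (x, y) (fun k z => (z.1 - (U k z - P k z), z.2 - (U k z - Q k z))) k,
      rfl, fun k => rfl⟩
  have hinv : ∀ k, S.invol (z k).1 = (z k).1 ∧ S.invol (z k).2 = (z k).2 ∧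
      ‖(z k).1‖ ≤ r * (1 / 2) ^ k ∧ ‖(z k).2‖ ≤ r * (1 / 2) ^ k := fun k => by
    induction k with
    | zero => rw [hz0]; exact ⟨hx, hy, by simpa using hxr, by simpa using hyr⟩
    | succ k ih =>
      rw [hz]
      refine ⟨?_, ?_, h1 k _ ih, h2 k _ ih⟩
      · rw [map_sub, map_sub, ih.1, hU k _ ih, invol_of_mem_posCone hS (hP k _ ih)]
      · rw [map_sub, map_sub, ih.2.1, hU k _ ih, invol_of_mem_posCone hS (hQ k _ ih)]
  have hgeom : HasSum (fun k : ℕ => r * (1 / 2 : ℝ) ^ k) (2 * r) := by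
    rw [mul_comm 2 r]
    exact hasSum_geometric_two.mul_left r
  have hsum : Summable fun k => U k (z k) :=
    Summable.of_norm_bounded hgeom.summable fun k => hUr k _ (hinv k)
  have hlim := hsum.hasSum.tendsto_sum_nat
  have hpow : Tendsto (fun k : ℕ => r * (1 / 2 : ℝ) ^ k) atTop (𝓝 0) := by
    have := (tendsto_pow_atTop_nhds_zero_of_lt_one (r := (1 / 2 : ℝ)) (by norm_num)
      (by norm_num)).const_mul r
    rwa [mul_zero] at this
  have hz1 : Tendsto (fun k => (z k).1) atTop (𝓝 0) :=
    squeeze_zero_norm (fun k => (hinv k).2.2.1) hpow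
  have hz2 : Tendsto (fun k => (z k).2) atTop (𝓝 0) :=
    squeeze_zero_norm (fun k => (hinv k).2.2.2) hpow
  refine ⟨∑' k, U k (z k), ?_, ?_, ?_, ?_⟩
  · refine tendsto_nhds_unique (((S.invol.continuous.tendsto _).comp hlim)) (hlim.congr fun n => ?_)
    rw [Function.comp_apply, map_sum]
    exact Finset.sum_congr rfl fun k _ => (hU k _ (hinv k)).symm
  · exact tsum_of_norm_bounded hgeom fun k => hUr k _ (hinv k)
  · have e1 : ∀ n, ∑ k ∈ Finset.range n, P k (z k) =
        ∑ k ∈ Finset.range n, U k (z k) - x + (z n).1 := fun n => by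
      induction n with
      | zero => simp [hz0]
      | succ n ih =>
        rw [Finset.sum_range_succ, Finset.sum_range_succ, ih, hz]
        dsimp only
        abel
    have h3 := (hlim.sub_const x).add hz1
    rw [add_zero] at h3
    refine (isClosed_posCone hS).mem_of_tendsto h3 (Eventually.of_forall fun n => ?_)
    rw [← e1]
    exact sum_mem_posCone hS _ fun k _ => hP k _ (hinv k)
  · have e1 : ∀ n, ∑ k ∈ Finset.range n, Q k (z k) =
        ∑ k ∈ Finset.range n, U k (z k) - y + (z n).2 := fun n => by
      induction n with
      | zero => simp [hz0]
      | succ n ih =>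
        rw [Finset.sum_range_succ, Finset.sum_range_succ, ih, hz]
        dsimp only
        abel
    have h3 := (hlim.sub_const y).add hz2
    rw [add_zero] at h3
    refine (isClosed_posCone hS).mem_of_tendsto h3 (Eventually.of_forall fun n => ?_)
    rw [← e1]
    exact sum_mem_posCone hS _ fun k _ => hQ k _ (hinv k)

/-- In a complete space, two self-adjoint elements of the open unit ball have a common upper bound
in the open unit ball. -/
lemma exists_upper_bound [CompleteSpace X] {x y : X} (hx : S.invol x = x) (hy : S.invol y = y)
    (hx1 : ‖x‖ < 1) (hy1 : ‖y‖ < 1) :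
    ∃ u, ‖u‖ < 1 ∧ S.le x u ∧ S.le y u := by
  -- an approximate bound in the ball of radius `r < 1`, and an exact bound of its error; together they
  -- have norm at most `r + 2 (1 - r) / 3 < 1`
  obtain ⟨r, hr, hr1⟩ := exists_between (max_lt (max_lt hx1 hy1) zero_lt_one)
  have hxr : ‖x‖ ≤ r := (le_max_left _ _).trans ((le_max_left _ _).trans hr.le)
  have hyr : ‖y‖ ≤ r := (le_max_right _ _).trans ((le_max_left _ _).trans hr.le)
  have hr0 : 0 < r := (le_max_right _ _).trans_lt hr
  obtain ⟨u, hu, hur, p, hp, q, hq, h⟩ := hE.exists_approx_upper_bound hS (d := (1 - r) / 3) hr0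
    (by linarith) hx hy hxr hyr
  have hp' := invol_of_mem_posCone hS hp
  have hq' := invol_of_mem_posCone hS hq
  obtain ⟨v, -, hvr, hv1, hv2⟩ := hE.exists_upper_bound_of_norm_le hS
    (x := x - (u - p)) (y := y - (u - q)) (r := (1 - r) / 3) (by linarith)
    (by rw [map_sub, map_sub, hx, hu, hp']) (by rw [map_sub, map_sub, hy, hu, hq'])
    (by linarith [norm_nonneg (y - (u - q))]) (by linarith [norm_nonneg (x - (u - p))])
  refine ⟨u + v, (norm_add_le _ _).trans_lt (by linarith), ?_, ?_⟩
  · have := add_mem_posCone hS hv1 hp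
    unfold le
    convert this using 1
    abel
  · have := add_mem_posCone hS hv2 hq
    unfold le
    convert this using 1
    abel

/-- The open unit ball of the cone, directed by its order, is an approximate unit. -/
theorem hasWeaklyDefiningUnitInOpenPosBall [CompleteSpace X] :
    S.HasWeaklyDefiningUnitInOpenPosBall := by
  let _ : Preorder S.openPosBall := openPosBallPreorder hS
  let a : S.openPosBall → X := Subtype.val
  have h0 : (0 : X) ∈ S.openPosBall := ⟨zero_mem_posCone hS, by simp⟩
  -- common upper bounds of `x` and `-x` are positive
  have hpos : ∀ {x u : X}, S.le x u → S.le (-x) u → u ∈ S.posCone := fun {x u} h h' => by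
    have h1 := smul_mem_posCone hS (add_mem_posCone hS h h') (c := 1 / 2) (by norm_num)
    have h2 : ((1 / 2 : ℝ) : ℂ) • (u - x + (u - -x)) = u := by
      have : u - x + (u - -x) = (2 : ℂ) • u := by rw [two_smul]; abel
      rw [this, smul_smul]
      norm_num
    rwa [h2] at h1
  have hdir : ∀ {x y : X}, S.invol x = x → S.invol y = y → ‖x‖ < 1 → ‖y‖ < 1 →
      ∃ u : X, ‖u‖ < 1 ∧ S.le x u ∧ S.le y u := fun hx hy hx1 hy1 =>
    hE.exists_upper_bound hS hx hy hx1 hy1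
  have hdom : ∀ {x : X}, S.invol x = x → ‖x‖ < 1 → ∃ u : S.openPosBall, S.le x u ∧ S.le (-x) u :=
    fun {x} hx hx1 => by
      obtain ⟨u, hu1, hu2, hu3⟩ := hdir hx (by rw [map_neg, hx]) hx1 (by rwa [norm_neg])
      exact ⟨⟨u, hpos hu2 hu3, hu1⟩, hu2, hu3⟩
  have hnet : S.IsIncreasingNet a :=
    { nonempty := ⟨⟨0, h0⟩⟩
      directed := ⟨fun u v => by
        obtain ⟨w, hw1, hw2, hw3⟩ := hdir (invol_of_mem_posCone hS u.2.1)
          (invol_of_mem_posCone hS v.2.1) u.2.2 v.2.2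
        have hw : w ∈ S.posCone := by
          have := add_mem_posCone hS hw2 u.2.1
          rwa [sub_add_cancel] at this
        exact ⟨⟨w, hw, hw1⟩, hw2, hw3⟩⟩
      mem_posCone := fun u => u.2.1
      mono := fun _ _ h => h }
  refine ⟨S.openPosBall, inferInstance, a, ⟨hnet, fun x hx => ?_⟩, ⟨fun u => u.2, fun y hy =>
    ⟨⟨y, hy⟩, fun i hi => hi⟩⟩, hE.isWeaklyMatrixNormDefining hS hnet fun f hf => ?_⟩
  · have hc : 0 < ‖x‖ + 1 := by positivity
    have hcn : (((‖x‖ + 1 : ℝ)) : ℂ) ≠ 0 := by exact_mod_cast hc.ne'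
    obtain ⟨u, hu1, hu2⟩ := hdom (x := (((‖x‖ + 1)⁻¹ : ℝ) : ℂ) • x)
      (by rw [map_smulₛₗ, hx, Complex.conj_ofReal])
      (by
        rw [norm_smul, Complex.norm_real, Real.norm_eq_abs, abs_of_pos (by positivity),
          inv_mul_lt_iff₀ hc]
        linarith)
    have h1 := smul_mem_posCone hS hu1 hc.le
    have h2 := smul_mem_posCone hS hu2 hc.le
    rw [smul_sub, smul_smul, Complex.ofReal_inv, mul_inv_cancel₀ hcn, one_smul] at h1
    rw [smul_sub, smul_neg, smul_smul, Complex.ofReal_inv, mul_inv_cancel₀ hcn, one_smul] at h2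
    refine ⟨‖x‖ + 1, hc, u, ?_, h1⟩
    unfold le
    convert h2 using 1
    simp only [a]
    abel
  -- `e(f) = ‖f‖` is the supremum of `f` over the open unit ball of the cone
  · rw [← hE.norm_eq_of_mem_posCone hS hf]
    refine tendsto_atTop_isLUB (fun u v huv => ?_) ⟨?_, fun c hc => ?_⟩
    · have h1 := re_apply_nonneg hS hf huv
      rw [map_sub, Complex.sub_re] at h1
      exact sub_nonneg.1 h1
    · rintro _ ⟨u, rfl⟩
      exact (Complex.re_le_norm _).trans ((f.le_opNorm _).trans
        (mul_le_of_le_one_right (norm_nonneg f) u.2.2.le))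
    · have hc0 : 0 ≤ c := by
        have := hc ⟨⟨0, h0⟩, rfl⟩
        simpa [a] using this
      refine norm_le_of_selfAdjoint hS hf hc0 fun u hu hu1 => ?_
      refine sub_nonneg.1 (nonneg_of_forall_add_mul (b := c) fun ε hε => ?_)
      have hε1 : 0 < 1 + ε := by linarith
      obtain ⟨w, hw, -⟩ := hdom (x := (((1 + ε)⁻¹ : ℝ) : ℂ) • u)
        (by rw [map_smulₛₗ, hu, Complex.conj_ofReal])
        (by
          rw [norm_smul, Complex.norm_real, Real.norm_eq_abs, abs_of_pos (by positivity),
            inv_mul_lt_iff₀ hε1]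
          linarith)
      have h1 := re_apply_nonneg hS hf hw
      have h2 : (f (a w)).re ≤ c := hc ⟨w, rfl⟩
      rw [map_sub, map_smul, smul_eq_mul, Complex.sub_re, Complex.re_ofReal_mul] at h1
      have h3 : (1 + ε)⁻¹ * (f u).re ≤ c := by
        simp only [a] at h2
        linarith
      rw [inv_mul_le_iff₀ hε1] at h3
      linarith

end IsBidualUnit

end MatrixOrderedData

/-! ### Matrix norm defining nets -/

namespace MatrixOrderedData

open Matrix

variable {X : Type u} [NormedAddCommGroup X] [NormedSpace ℂ X] {S : MatrixOrderedData X} {n : ℕ}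

/-- The compression of `[t a, y; y*, t a]` to the diagonal `{(ξ, ξ)}`. -/
lemma sandwich_unitBlock (S : MatrixOrderedData X) (t : ℝ) (a : X) (y : Matrix (Fin n) (Fin n) X) :
    sandwich (inlMat n n + inrMat n n) (S.unitBlock t a y) (inlMat n n + inrMat n n)ᵀ =
      ((2 * t : ℝ) : ℂ) • (diagonal fun _ => a) + (y + S.adj y) := by
  have key : ∀ (x : Matrix (Fin (n + n)) (Fin (n + n)) X) (i j : Fin n),
      sandwich (inlMat n n + inrMat n n) x (inlMat n n + inrMat n n)ᵀ i j =
        x (Fin.castAdd n i) (Fin.castAdd n j) + x (Fin.castAdd n i) (Fin.natAdd n j) +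
        (x (Fin.natAdd n i) (Fin.castAdd n j) + x (Fin.natAdd n i) (Fin.natAdd n j)) := by
    intro x i j
    simp [sandwich_apply, inlMat, inrMat, Fin.sum_univ_add, Finset.sum_add_distrib, castAdd_ne_natAdd,
      (castAdd_ne_natAdd _ _).symm, -Fin.natAdd_eq_addNat]
    abel
  ext i j
  rw [key, unitBlock_castAdd_castAdd, unitBlock_castAdd_natAdd, unitBlock_natAdd_castAdd,
    unitBlock_natAdd_natAdd]
  by_cases h : i = j
  · subst h
    simp only [if_true, Matrix.add_apply, Matrix.smul_apply, diagonal_apply_eq, adj_apply,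
      Complex.ofReal_mul, Complex.ofReal_ofNat, mul_smul, two_smul]
    abel
  · simp [h]

lemma offDiag_smul (S : MatrixOrderedData X) (r : ℝ) (x : Matrix (Fin n) (Fin n) X) :
    S.offDiag ((r : ℂ) • x) = (r : ℂ) • S.offDiag x := by
  simp only [offDiag, adj_real_smul, sandwich_smul, smul_add]

section Net

variable {I : Type w} [Preorder I] {a : I → X}

lemma IsMatrixNormDefining.exists_of_lt (hS : S.IsSMOS) (ha : S.IsMatrixNormDefining a)
    {y : Matrix (Fin n) (Fin n) X} {s : ℝ} (h : S.matNorm n y < s) :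
    ∃ i, S.unitBlock s (a i) y ∈ S.cone (n + n) := by
  have h0 := hS.matNorm_nonneg y
  have h1 : ENNReal.ofReal (S.matNorm n y) < ENNReal.ofReal s :=
    (ENNReal.ofReal_lt_ofReal_iff (by linarith)).2 h
  rw [ha.2, netNorm, iInf_lt_iff] at h1
  obtain ⟨t, h1⟩ := h1
  rw [iInf_lt_iff] at h1
  obtain ⟨⟨i, hi⟩, h3⟩ := h1
  rw [← ENNReal.ofReal_coe_nnreal] at h3
  have h4 : (t : ℝ) < s := (ENNReal.ofReal_lt_ofReal_iff (by linarith)).1 h3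
  refine ⟨i, ?_⟩
  have h5 := hS.cone_add hi (hS.cone_smul (diagonal_mem_cone (n := n + n) hS (ha.1.mem_posCone i))
    (sub_nonneg.2 h4.le))
  rw [unitBlock_eq] at h5 ⊢
  convert h5 using 1
  rw [Complex.ofReal_sub, sub_smul]
  abel

lemma IsMatrixNormDefining.matNorm_le (ha : S.IsMatrixNormDefining a)
    {y : Matrix (Fin n) (Fin n) X} {s : ℝ} (hs : 0 ≤ s) {i : I}
    (h : S.unitBlock s (a i) y ∈ S.cone (n + n)) : S.matNorm n y ≤ s := by
  have h1 : ENNReal.ofReal (S.matNorm n y) ≤ ENNReal.ofReal s := by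
    rw [ha.2]
    exact (iInf₂_le (⟨s, hs⟩ : ℝ≥0) ⟨i, h⟩).trans (ENNReal.ofReal_eq_coe_nnreal hs).symm.le
  exact (ENNReal.ofReal_le_ofReal_iff hs).1 h1

/-- A matrix norm defining net is a matrix order unit. -/
lemma IsMatrixNormDefining.exists_le (hS : S.IsSMOS) (ha : S.IsMatrixNormDefining a)
    {y : Matrix (Fin n) (Fin n) X} (hy : S.adj y = y) {s : ℝ} (h : S.matNorm n y < s) :
    ∃ i, (s : ℂ) • (diagonal fun _ => a i) - y ∈ S.cone n := by
  rw [← hS.matNorm_neg] at h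
  obtain ⟨i, hi⟩ := ha.exists_of_lt hS h
  refine ⟨i, ?_⟩
  have h1 := hS.cone_sandwich hi (inlMat n n + inrMat n n)ᵀ
  have h2 : ((inlMat n n + inrMat n n)ᵀ)ᴴ = inlMat n n + inrMat n n := by
    rw [transpose_add, conjTranspose_add, transpose_inl_conj, transpose_inr_conj]
  rw [h2, sandwich_unitBlock, adj_neg, hy] at h1
  have h3 := hS.cone_smul h1 (c := 1 / 2) (by norm_num)
  have e1 : (1 / 2 : ℝ) * (2 * s) = s := by ring
  have e2 : ((1 / 2 : ℝ) : ℂ) • (-y + -y) = -y := by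
    rw [← two_smul ℂ, smul_smul]; norm_num
  rwa [smul_add, smul_smul, ← Complex.ofReal_mul, e1, e2, ← sub_eq_add_neg] at h3

/-- The functional at which `[t a_i, x; x*, t a_i]` stays negative for `t` less than the norm of
`x`. -/
lemma IsMatrixNormDefining.exists_functional (hS : S.IsSMOS) (ha : S.IsMatrixNormDefining a)
    (x : Matrix (Fin n) (Fin n) X) : ∃ f ∈ S.dual.cone (n + n), ∀ (t : ℝ) (i : I), 0 ≤ t →
      (pair f (S.unitBlock t (a i) x)).re ≤ t - S.matNorm n x := by
  let D : I → Matrix (Fin (n + n)) (Fin (n + n)) X := fun i => diagonal fun _ => a i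
  have hDadj : ∀ i, S.adj (D i) = D i := fun i =>
    adj_diagonal (invol_of_mem_posCone hS (ha.1.mem_posCone i))
  have hDmono : ∀ {i j : I} {s : ℝ}, 0 ≤ s → i ≤ j → (s : ℂ) • D j - (s : ℂ) • D i ∈
      S.cone (n + n) := fun {i j s} hs hij => by
    rw [← smul_sub]
    have h : D j - D i = diagonal fun _ => a j - a i := diagonal_sub _ _
    rw [h]
    exact hS.cone_smul (diagonal_mem_cone hS (ha.1.mono i j hij)) hs
  -- the bounds `ℓ(y) ≤ s - r ‖x‖` whenever `Re y ≤ s (I ⊗ a_i) + r [0, x; x*, 0]`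
  let K : Set (Matrix (Fin (n + n)) (Fin (n + n)) X × ℝ) := {z | ∃ r : ℝ, 0 ≤ r ∧ ∃ s : ℝ, 0 ≤ s ∧
    s - r * S.matNorm n x ≤ z.2 ∧ ∃ i,
      ((2 * s : ℝ) : ℂ) • D i - (z.1 + S.adj z.1) + ((2 * r : ℝ) : ℂ) • S.offDiag x ∈
        S.cone (n + n)}
  have hK : ∀ y (c : ℝ), S.matNorm (n + n) y < c → (y, c) ∈ K := fun y c hc => by
    have h1 : S.matNorm (n + n) (y + S.adj y) < 2 * c := by
      refine (hS.matNorm_add_le _ _ _).trans_lt ?_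
      rw [hS.matNorm_adj]
      linarith
    obtain ⟨i, hi⟩ := ha.exists_le hS (by simp only [adj_add, hS.adj_adj]; exact add_comm _ _) h1
    exact ⟨0, le_rfl, c, (hS.matNorm_nonneg y).trans hc.le, by simp, i, by simpa [D] using hi⟩
  obtain ⟨ℓ, hℓ⟩ : ∃ ℓ : Matrix (Fin (n + n)) (Fin (n + n)) X →ₗ[ℝ] ℝ,
      ∀ y c, (y, c) ∈ K → ℓ y ≤ c := by
    obtain ⟨i₀⟩ := ha.1.nonempty
    refine exists_linearMap_le_of_cone K ⟨0, le_rfl, 0, le_rfl, by simp, i₀,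
      by simpa using hS.zero_mem_cone _⟩ ?_ ?_ (fun y => ⟨_, hK y _ (lt_add_one _)⟩) ?_
    · rintro z ⟨r, hr, s, hs, hc, i, hi⟩ z' ⟨r', hr', s', hs', hc', i', hi'⟩
      have := ha.1.directed
      obtain ⟨k, hk, hk'⟩ := exists_ge_ge i i'
      refine ⟨r + r', add_nonneg hr hr', s + s', add_nonneg hs hs', ?_, k, ?_⟩
      · rw [Prod.snd_add]; linarith
      · have h1 := hS.cone_add (hS.cone_add hi (hDmono (s := 2 * s) (by positivity) hk))
          (hS.cone_add hi' (hDmono (s := 2 * s') (by positivity) hk'))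
        convert h1 using 1
        simp only [Prod.fst_add, adj_add, mul_add, Complex.ofReal_add, add_smul]
        abel
    · rintro c hc z ⟨r, hr, s, hs, h, i, hi⟩
      refine ⟨c * r, by positivity, c * s, by positivity, ?_, i, ?_⟩
      · rw [Prod.smul_snd, smul_eq_mul]; nlinarith
      · have h1 := hS.cone_smul hi hc.le
        convert h1 using 1
        rw [Prod.smul_fst, ← Complex.coe_smul, adj_real_smul, smul_add, smul_sub, smul_smul,
          smul_smul, smul_add, ← Complex.ofReal_mul, ← Complex.ofReal_mul, mul_left_comm 2 c,
          mul_left_comm 2 c]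
    · rintro c ⟨r, hr, s, hs, h, i, hi⟩
      refine le_trans (sub_nonneg.2 ?_) h
      have h1 : S.unitBlock s (a i) ((r : ℂ) • x) ∈ S.cone (n + n) := by
        have h2 := hS.cone_smul hi (c := 1 / 2) (by norm_num)
        have e1 : ∀ b : ℝ, (1 / 2 : ℝ) * (2 * b) = b := fun b => by ring
        simp only [adj_zero, add_zero, sub_zero] at h2
        rw [smul_add, smul_smul, smul_smul, ← Complex.ofReal_mul, ← Complex.ofReal_mul, e1, e1]
          at h2
        rwa [unitBlock_eq, offDiag_smul]
      have h2 := ha.matNorm_le hs h1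
      rwa [hS.matNorm_real_smul, abs_of_nonneg hr] at h2
  have hb : ∀ y, ℓ y ≤ 1 * S.matNorm (n + n) y := fun y => by
    rw [one_mul]
    exact le_of_forall_gt_imp_ge_of_dense fun c hc => hℓ _ _ (hK y c hc)
  have hpos : ∀ y ∈ S.cone (n + n), 0 ≤ ℓ y := fun y hy => by
    obtain ⟨i₀⟩ := ha.1.nonempty
    have h1 := hℓ (-y) 0 ⟨0, le_rfl, 0, le_rfl, by simp, i₀, by
      rw [adj_neg, hS.cone_sa _ y hy]
      simpa using hS.cone_add hy hy⟩
    rw [map_neg] at h1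
    linarith
  obtain ⟨f, hf, hfℓ⟩ := hS.exists_mem_dual_cone ℓ 1 hb hpos
  refine ⟨f, hf, fun t i ht => ?_⟩
  have hadj : S.adj (S.unitBlock t (a i) x) = S.unitBlock t (a i) x :=
    adj_unitBlock hS t (invol_of_mem_posCone hS (ha.1.mem_posCone i)) x
  rw [hfℓ, hadj, add_self_div_two]
  refine hℓ _ _ ⟨1, zero_le_one, t, ht, by simp, i, ?_⟩
  rw [hadj, unitBlock_eq]
  have h0 : ((2 * t : ℝ) : ℂ) • D i - ((t : ℂ) • (diagonal fun _ => a i) + S.offDiag x +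
      ((t : ℂ) • (diagonal fun _ => a i) + S.offDiag x)) + ((2 * 1 : ℝ) : ℂ) • S.offDiag x = 0 := by
    simp only [D, mul_one, Complex.ofReal_mul, Complex.ofReal_ofNat, mul_smul, two_smul]
    abel
  rw [h0]
  exact hS.zero_mem_cone _

/-- One inequality of the norms is formal, as the values at positive functionals increase; for the
other one, test on the separating functional of `IsMatrixNormDefining.exists_functional`. -/
theorem IsMatrixNormDefining.isWeaklyMatrixNormDefining (hS : S.IsSMOS)
    (ha : S.IsMatrixNormDefining a) : S.IsWeaklyMatrixNormDefining a := by
  have := ha.1.nonempty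
  have := ha.1.directed
  refine ⟨ha.1, fun n x => le_antisymm (le_iInf₂ fun t ht => ?_) ?_⟩
  · obtain ⟨f, hf, hft⟩ := ha.exists_functional hS x
    obtain ⟨L, hL, hlim⟩ := ht _ (isPosFunctional_pairLinearMap hS hf)
    have h1 : L ≤ ((t - S.matNorm n x : ℝ) : EReal) :=
      le_of_tendsto' hlim fun i => EReal.coe_le_coe_iff.2 (hft t i t.2)
    have h2 := EReal.coe_nonneg.1 (hL.trans h1)
    exact ENNReal.ofReal_le_of_le_toReal (by simpa using sub_nonneg.1 h2)
  · rw [ha.2]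
    refine le_iInf₂ fun t ⟨i, hi⟩ => iInf₂_le t fun F hF => ?_
    obtain ⟨f, hf, hfF⟩ := hF.exists_pair hS
    have hmono : Monotone fun i => (((F (S.unitBlock t (a i) x)).re : ℝ) : EReal) := fun i k hik => by
      refine EReal.coe_le_coe_iff.2 ?_
      rw [hfF, hfF, re_pair_unitBlock ((mem_dual_cone_iff hS f).1 hf).1,
        re_pair_unitBlock ((mem_dual_cone_iff hS f).1 hf).1]
      refine add_le_add (mul_le_mul_of_nonneg_left (Finset.sum_le_sum fun l _ => ?_) t.2) le_rfl
      have h2 := re_apply_nonneg hS (apply_mem_posCone hS.dual hf l) (ha.1.mono i k hik)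
      rw [map_sub, Complex.sub_re] at h2
      linarith
    exact ⟨_, (EReal.coe_nonneg.2 (hF.nonneg _ hi)).trans
      (le_iSup (fun i => (((F (S.unitBlock t (a i) x)).re : ℝ) : EReal)) i), tendsto_atTop_iSup hmono⟩

end Net

end MatrixOrderedData

/-! ### The completion -/

namespace MatrixOrderedData

open Matrix

open UniformSpace (Completion)

variable {X : Type u} [NormedAddCommGroup X] [NormedSpace ℂ X] {S : MatrixOrderedData X} {n m : ℕ}

lemma denseRange_toCompletion : DenseRange (toCompletion (X := X) (n := n)) :=
  DenseRange.piMap fun _ => DenseRange.piMap fun _ => Completion.denseRange_coe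

lemma isUniformInducing_toCompletion : IsUniformInducing (toCompletion (X := X) (n := n)) := by
  refine ⟨?_⟩
  rw [Matrix.uniformity, Matrix.uniformity]
  simp only [Filter.comap_iInf, Filter.comap_comap, ← (Completion.isUniformInducing_coe X).comap_uniformity]
  rfl

lemma uniformContinuous_apply (i j : Fin n) :
    UniformContinuous fun x : Matrix (Fin n) (Fin n) X => x i j :=
  (Matrix.uniformContinuous (Fin n) (Fin n) X).1 uniformContinuous_id i j

lemma uniformContinuous_matNorm (hS : S.IsSMOS) : UniformContinuous (S.matNorm n) := by
  refine tendsto_uniformity_iff_dist_tendsto_zero.2 ?_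
  have h1 : Tendsto (fun p : Matrix (Fin n) (Fin n) X × Matrix (Fin n) (Fin n) X =>
      ∑ i, ∑ j, dist (p.1 i j) (p.2 i j)) (uniformity _) (𝓝 (∑ i : Fin n, ∑ j : Fin n, 0)) :=
    tendsto_finsetSum _ fun i _ => tendsto_finsetSum _ fun j _ =>
      tendsto_uniformity_iff_dist_tendsto_zero.1 (uniformContinuous_apply i j)
  simp only [Finset.sum_const_zero] at h1
  refine squeeze_zero (fun _ => dist_nonneg) (fun p => ?_) h1
  rw [Real.dist_eq]
  have h2 : S.matNorm n (p.1 - p.2) ≤ ∑ i, ∑ j, dist (p.1 i j) (p.2 i j) := by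
    simp only [dist_eq_norm]
    exact hS.matNorm_le_sum _
  refine (abs_le.2 ⟨?_, ?_⟩).trans h2
  · have := hS.matNorm_sub_le p.1 (p.1 - p.2)
    rw [sub_sub_cancel] at this
    linarith
  · have := hS.matNorm_add_le _ (p.1 - p.2) p.2
    rw [sub_add_cancel] at this
    linarith

/-- The matrix norm of the completion is defined as an extension by continuity. -/
lemma completion_matNorm_eq : S.completion.matNorm n =
    (isUniformInducing_toCompletion.isDenseInducing denseRange_toCompletion).extend (S.matNorm n) :=
  rfl

lemma continuous_completion_matNorm (hS : S.IsSMOS) : Continuous (S.completion.matNorm n) := by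
  rw [completion_matNorm_eq]
  exact (uniformContinuous_uniformly_extend isUniformInducing_toCompletion denseRange_toCompletion
    (uniformContinuous_matNorm hS)).continuous

lemma completion_matNorm_toCompletion (hS : S.IsSMOS) (x : Matrix (Fin n) (Fin n) X) :
    S.completion.matNorm n (toCompletion x) = S.matNorm n x := by
  rw [completion_matNorm_eq]
  exact uniformly_extend_of_ind isUniformInducing_toCompletion denseRange_toCompletion
    (uniformContinuous_matNorm hS) x

lemma completion_invol_coe (x : X) : S.completion.invol (x : Completion X) = (S.invol x : X) := by
  have h1 : DenseRange (Completion.toComplL : X →L[ℂ] Completion X) := Completion.denseRange_coe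
  have h2 : IsUniformInducing (Completion.toComplL : X →L[ℂ] Completion X) :=
    Completion.isUniformInducing_coe X
  exact ContinuousLinearMap.extend_eq _ h1 h2 x

lemma completion_adj_toCompletion (x : Matrix (Fin m) (Fin m) X) :
    S.completion.adj (toCompletion x) = toCompletion (S.adj x) := by
  ext i j : 2
  exact completion_invol_coe _

lemma sandwich_toCompletion (α : Matrix (Fin n) (Fin m) ℂ) (x : Matrix (Fin m) (Fin m) X)
    (β : Matrix (Fin m) (Fin n) ℂ) :
    sandwich α (toCompletion x) β = toCompletion (sandwich α x β) :=
  (sandwich_map (Completion.toComplL : X →L[ℂ] Completion X).toLinearMap α x β).symm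

lemma toCompletion_add (x y : Matrix (Fin n) (Fin n) X) :
    toCompletion (x + y) = toCompletion x + toCompletion y := by
  ext i j : 2; exact Completion.coe_add _ _

lemma toCompletion_smul (c : ℂ) (x : Matrix (Fin n) (Fin n) X) :
    toCompletion (c • x) = c • toCompletion x := by
  ext i j : 2; exact Completion.coe_smul _ _

lemma continuous_sandwich {Y : Type v} [NormedAddCommGroup Y] [NormedSpace ℂ Y]
    (α : Matrix (Fin n) (Fin m) ℂ) (β : Matrix (Fin m) (Fin n) ℂ) :
    Continuous fun x : Matrix (Fin m) (Fin m) Y => sandwich α x β := by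
  refine continuous_matrix fun i j => ?_
  simp only [sandwich_apply]
  exact continuous_finsetSum _ fun k _ => continuous_finsetSum _ fun l _ =>
    (continuous_id.matrix_elem k l).const_smul _

lemma continuous_adj {Y : Type v} [NormedAddCommGroup Y] [NormedSpace ℂ Y]
    (T : MatrixOrderedData Y) : Continuous fun x : Matrix (Fin m) (Fin n) Y => T.adj x :=
  continuous_matrix fun i j => T.invol.continuous.comp (continuous_id.matrix_elem j i)

lemma continuous_pair {Y : Type v} [NormedAddCommGroup Y] [NormedSpace ℂ Y]
    (f : Matrix (Fin n) (Fin n) (StrongDual ℂ Y)) : Continuous (pair f) :=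
  continuous_finsetSum _ fun k _ => continuous_finsetSum _ fun l _ =>
    (f k l).continuous.comp (continuous_id.matrix_elem k l)

lemma single₁_coe (x : X) : single₁ (x : Completion X) = toCompletion (single₁ x) := rfl

lemma continuous_single₁ {Y : Type v} [NormedAddCommGroup Y] : Continuous (single₁ : Y → _) :=
  continuous_matrix fun _ _ => continuous_id

/-- The completion of a semi-matrix ordered operator space. -/
theorem IsSMOS.completion (hS : S.IsSMOS) : S.completion.IsSMOS := by
  have hN := fun n => continuous_completion_matNorm (n := n) hS
  have hadd : ∀ n (x y : Matrix (Fin n) (Fin n) (Completion X)),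
      S.completion.matNorm n (x + y) ≤ S.completion.matNorm n x + S.completion.matNorm n y :=
    fun n => denseRange_toCompletion.induction_on₂ (isClosed_le
      ((hN n).comp (continuous_fst.add continuous_snd))
      (((hN n).comp continuous_fst).add ((hN n).comp continuous_snd))) fun x y => by
      rw [← toCompletion_add]
      simp only [completion_matNorm_toCompletion hS]
      exact hS.matNorm_add_le n x y
  have happ : ∀ n (x : Matrix (Fin n) (Fin n) (Completion X)) i j,
      ‖x i j‖ ≤ S.completion.matNorm n x := fun n x i j =>
    denseRange_toCompletion.induction_on x (isClosed_le (continuous_id.matrix_elem i j).norm (hN n))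
      fun x => by
        rw [completion_matNorm_toCompletion hS]
        exact (Completion.norm_coe _).trans_le (hS.norm_apply_le_matNorm x i j)
  refine
  { invol_invol := fun x => Completion.denseRange_coe.induction_on x
      (isClosed_eq (S.completion.invol.continuous.comp S.completion.invol.continuous)
        continuous_id) fun x => by
        simp only [completion_invol_coe, hS.invol_invol]
    matNorm_one := fun x => Completion.denseRange_coe.induction_on x
      (isClosed_eq ((hN 1).comp continuous_single₁) continuous_norm) fun x => by
        rw [single₁_coe, completion_matNorm_toCompletion hS, hS.matNorm_one,
          Completion.norm_coe]
    matNorm_eq_zero_iff := fun n x => ⟨fun h => ?_, fun h => ?_⟩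
    matNorm_smul := fun n c x => denseRange_toCompletion.induction_on x
      (isClosed_eq ((hN n).comp (continuous_const_smul c)) ((hN n).const_mul _)) fun x => by
        rw [← toCompletion_smul, completion_matNorm_toCompletion hS,
          completion_matNorm_toCompletion hS, hS.matNorm_smul]
    matNorm_add_le := hadd
    ruan := fun n m k x y α β γ δ => ?_
    matNorm_adj := fun n x => denseRange_toCompletion.induction_on x
      (isClosed_eq ((hN n).comp (continuous_adj _)) (hN n)) fun x => by
        rw [completion_adj_toCompletion, completion_matNorm_toCompletion hS,
          completion_matNorm_toCompletion hS, hS.matNorm_adj]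
    cone_sa := fun n x hx => ?_
    zero_mem_cone := fun n => subset_closure ⟨0, hS.zero_mem_cone n, by ext i j : 2; rfl⟩
    cone_conj := fun n m k x hx y hy α β => ?_
    cone_closed := fun n x hx => ?_ }
  · ext i j : 2
    have := happ n x i j
    rw [h] at this
    exact norm_le_zero_iff.1 this
  · have h0 : (0 : Matrix (Fin n) (Fin n) (Completion X)) = toCompletion 0 := by ext i j : 2; rfl
    rw [h, h0, completion_matNorm_toCompletion hS, hS.matNorm_zero]
  · have h1 : ∀ (x : Matrix (Fin m) (Fin m) (Completion X)) (y : Matrix (Fin k) (Fin k) X),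
        S.completion.matNorm n (sandwich α x β + sandwich γ (toCompletion y) δ) ≤
        √(cstarNorm (α * αᴴ + γ * γᴴ)) * √(cstarNorm (βᴴ * β + δᴴ * δ)) *
          max (S.completion.matNorm m x) (S.completion.matNorm k (toCompletion y)) := fun x y =>
      denseRange_toCompletion.induction_on x (isClosed_le
        ((hN n).comp ((continuous_sandwich α β).add continuous_const))
        (((hN m).max continuous_const).const_mul _)) fun x => by
          simp only [sandwich_toCompletion, ← toCompletion_add,
            completion_matNorm_toCompletion hS]
          exact hS.ruan n m k x y α β γ δ
    exact denseRange_toCompletion.induction_on y (isClosed_le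
        ((hN n).comp (continuous_const.add (continuous_sandwich γ δ)))
        ((continuous_const.max (hN k)).const_mul _)) fun y => h1 x y
  · refine closure_minimal (t := {x | S.completion.adj x = x}) ?_
      (isClosed_eq (continuous_adj _) continuous_id) hx
    rintro _ ⟨y, hy, rfl⟩
    change S.completion.adj _ = _
    rw [completion_adj_toCompletion, hS.cone_sa n y hy]
  · refine map_mem_closure₂ (f := fun x y => sandwich αᴴ x α + sandwich βᴴ y β)
      (((continuous_sandwich _ _).comp continuous_fst).add
        ((continuous_sandwich _ _).comp continuous_snd)) hx hy ?_
    rintro _ ⟨x, hx, rfl⟩ _ ⟨y, hy, rfl⟩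
    refine ⟨_, hS.cone_conj n m k x hx y hy α β, ?_⟩
    rw [toCompletion_add, sandwich_toCompletion, sandwich_toCompletion]
  · choose! y hy hxy using hx
    have h1 : Tendsto (fun k : ℕ => y (1 / ((k : ℝ) + 1))) atTop (𝓝 x) := by
      refine tendsto_pi_nhds.2 fun i => tendsto_pi_nhds.2 fun j => ?_
      rw [tendsto_iff_norm_sub_tendsto_zero]
      refine squeeze_zero (fun _ => norm_nonneg _) (fun k => ?_)
        tendsto_one_div_add_atTop_nhds_zero_nat
      rw [norm_sub_rev]
      exact (happ n (x - y (1 / ((k : ℝ) + 1))) i j).trans (hxy _ (by positivity)).le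
    exact isClosed_closure.mem_of_tendsto h1 (Eventually.of_forall fun k => hy _ (by positivity))

end MatrixOrderedData

/-! ### The unit of the bidual of the completion -/

namespace MatrixOrderedData

open Matrix

open UniformSpace (Completion)

section DualCompletion

variable (X : Type u) [NormedAddCommGroup X] [NormedSpace ℂ X]

/-- Restriction identifies the dual of the completion with the dual. -/
def dualCompletionEquiv : StrongDual ℂ (Completion X) ≃ₗᵢ[ℂ] StrongDual ℂ X where
  toFun g := g.comp Completion.toComplL
  invFun f := f.extend (Completion.toComplL : X →L[ℂ] Completion X)
  map_add' _ _ := rfl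
  map_smul' _ _ := rfl
  left_inv g := by
    refine ContinuousLinearMap.coeFn_injective (Completion.denseRange_coe.equalizer
      (ContinuousLinearMap.continuous _) (ContinuousLinearMap.continuous _) (funext fun x => ?_))
    exact ContinuousLinearMap.extend_eq _ Completion.denseRange_coe
      (Completion.isUniformInducing_coe X) x
  right_inv f := by
    ext x
    exact ContinuousLinearMap.extend_eq _ Completion.denseRange_coe
      (Completion.isUniformInducing_coe X) x
  norm_map' g := by
    change ‖g.comp Completion.toComplL‖ = ‖g‖
    refine le_antisymm (ContinuousLinearMap.opNorm_le_bound _ (norm_nonneg _) fun x => ?_)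
      (g.opNorm_le_bound (norm_nonneg _) fun y => ?_)
    · exact (g.le_opNorm _).trans_eq (congrArg (‖g‖ * ·) (Completion.norm_coe x))
    · refine Completion.denseRange_coe.induction_on y
        (isClosed_le g.continuous.norm (continuous_norm.const_mul _)) fun x => ?_
      rw [Completion.norm_coe]
      exact (g.comp Completion.toComplL).le_opNorm x

end DualCompletion

variable {X : Type u} [NormedAddCommGroup X] [NormedSpace ℂ X] {S : MatrixOrderedData X} {n m : ℕ}
  {e : StrongDual ℂ (StrongDual ℂ X)}

lemma pair_toCompletion (g : Matrix (Fin n) (Fin n) (StrongDual ℂ (Completion X)))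
    (x : Matrix (Fin n) (Fin n) X) :
    pair g (toCompletion x) = pair (g.map (dualCompletionEquiv X)) x := rfl

lemma dualCompletionEquiv_invol (g : StrongDual ℂ (Completion X)) :
    dualCompletionEquiv X (S.completion.dual.invol g) = S.dual.invol (dualCompletionEquiv X g) := by
  ext x
  change star (g (S.completion.invol x)) = star (g (S.invol x : X))
  rw [completion_invol_coe]

lemma map_dualCompletionEquiv_injective : Function.Injective
    fun g : Matrix (Fin n) (Fin n) (StrongDual ℂ (Completion X)) =>
      g.map (dualCompletionEquiv X) :=
  Matrix.map_injective (dualCompletionEquiv X).injective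

lemma map_dualCompletionEquiv_adj (g : Matrix (Fin n) (Fin n) (StrongDual ℂ (Completion X))) :
    (S.completion.dual.adj g).map (dualCompletionEquiv X) =
      S.dual.adj (g.map (dualCompletionEquiv X)) := by
  ext i j : 1
  exact dualCompletionEquiv_invol _

/-- Restriction to `X` identifies the matrix cones of the duals as well. -/
lemma map_dualCompletionEquiv_mem_cone_iff (hS : S.IsSMOS)
    {g : Matrix (Fin n) (Fin n) (StrongDual ℂ (Completion X))} :
    g.map (dualCompletionEquiv X) ∈ S.dual.cone n ↔ g ∈ S.completion.dual.cone n := by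
  rw [mem_dual_cone_iff hS, mem_dual_cone_iff hS.completion, ← map_dualCompletionEquiv_adj,
    map_dualCompletionEquiv_injective.eq_iff]
  refine and_congr_right fun _ => ⟨fun h x hx => ?_, fun h x hx => ?_⟩
  · refine closure_minimal (t := {x | 0 ≤ (pair g x).re}) ?_
      (isClosed_le continuous_const (Complex.continuous_re.comp (continuous_pair g))) hx
    rintro _ ⟨y, hy, rfl⟩
    exact h y hy
  · exact h _ (subset_closure ⟨x, hx, rfl⟩)

lemma forall_mem_dual_cone_iff (hS : S.IsSMOS)
    {p : Matrix (Fin n) (Fin n) (StrongDual ℂ X) → Prop} :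
    (∀ f ∈ S.dual.cone n, p f) ↔
      ∀ g ∈ S.completion.dual.cone n, p (g.map (dualCompletionEquiv X)) := by
  refine ⟨fun h g hg => h _ ((map_dualCompletionEquiv_mem_cone_iff hS).2 hg), fun h f hf => ?_⟩
  have h1 : (f.map (dualCompletionEquiv X).symm).map (dualCompletionEquiv X) = f := by
    ext i j : 1; exact (dualCompletionEquiv X).apply_symm_apply _
  rw [← h1]
  exact h _ ((map_dualCompletionEquiv_mem_cone_iff hS).1 (by rwa [h1]))

/-- The element of the bidual of the completion that corresponds to `e`. -/
def bidualToCompletion (e : StrongDual ℂ (StrongDual ℂ X)) :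
    StrongDual ℂ (StrongDual ℂ (Completion X)) :=
  e.comp ((dualCompletionEquiv X : StrongDual ℂ (Completion X) ≃L[ℂ] StrongDual ℂ X) :
    StrongDual ℂ (Completion X) →L[ℂ] StrongDual ℂ X)

lemma norm_bidualToCompletion (e : StrongDual ℂ (StrongDual ℂ X)) :
    ‖bidualToCompletion e‖ = ‖e‖ :=
  ContinuousLinearMap.opNorm_comp_linearIsometryEquiv e (dualCompletionEquiv X)

lemma bidualToCompletion_surjective : Function.Surjective (bidualToCompletion (X := X)) := by
  intro e
  refine ⟨e.comp (((dualCompletionEquiv X).symm :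
    StrongDual ℂ X ≃L[ℂ] StrongDual ℂ (Completion X)) :
    StrongDual ℂ X →L[ℂ] StrongDual ℂ (Completion X)), ?_⟩
  ext g
  exact congrArg e ((dualCompletionEquiv X).symm_apply_apply g)

lemma bidualToCompletion_mem_posCone_iff (hS : S.IsSMOS) :
    bidualToCompletion e ∈ S.completion.bidual.posCone ↔ e ∈ S.bidual.posCone := by
  refine (mem_dual_cone_iff hS.completion.dual _).trans
    (Iff.trans (and_congr ?_ ?_) (mem_dual_cone_iff hS.dual _).symm)
  · rw [← Matrix.ext_iff, ← Matrix.ext_iff]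
    refine forall_congr' fun _ => forall_congr' fun _ => ?_
    change S.completion.bidual.invol (bidualToCompletion e) = bidualToCompletion e ↔
      S.bidual.invol e = e
    have h : S.completion.bidual.invol (bidualToCompletion e) =
        bidualToCompletion (S.bidual.invol e) := by
      ext g
      change star (e (dualCompletionEquiv X (S.completion.dual.invol g))) = star (e (S.dual.invol _))
      rw [dualCompletionEquiv_invol]
      rfl
    rw [h]
    refine ⟨fun h => ?_, fun h => by rw [h]⟩
    ext f
    have := congrArg (fun φ => φ ((dualCompletionEquiv X).symm f)) h
    change S.bidual.invol e (dualCompletionEquiv X _) = e (dualCompletionEquiv X _) at this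
    rwa [(dualCompletionEquiv X).apply_symm_apply] at this
  · rw [forall_mem_dual_cone_iff hS]
    rfl

lemma map_sandwich_dualCompletionEquiv (α : Matrix (Fin n) (Fin m) ℂ)
    (g : Matrix (Fin m) (Fin m) (StrongDual ℂ (Completion X))) (β : Matrix (Fin m) (Fin n) ℂ) :
    (sandwich α g β).map (dualCompletionEquiv X) =
      sandwich α (g.map (dualCompletionEquiv X)) β :=
  sandwich_map (dualCompletionEquiv X).toLinearEquiv.toLinearMap α g β

/-- `X` and its completion have the same units in their biduals, since the criterion
`IsBidualUnit.matNorm_le_iff'` only involves the dual. -/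
theorem isBidualUnit_completion_iff (hS : S.IsSMOS) :
    S.completion.IsBidualUnit (bidualToCompletion e) ↔ S.IsBidualUnit e := by
  have key : ∀ n (x : Matrix (Fin n) (Fin n) X) (t : ℝ), (∀ f ∈ S.dual.cone (n + n),
      0 ≤ t * ∑ i, (e (f i i)).re + 2 * (pair (sandwich (inlMat n n) f (inrMat n n)ᵀ) x).re) ↔
      ∀ g ∈ S.completion.dual.cone (n + n), 0 ≤ t * ∑ i, (bidualToCompletion e (g i i)).re +
        2 * (pair (sandwich (inlMat n n) g (inrMat n n)ᵀ) (toCompletion x)).re := fun n x t => by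
    rw [forall_mem_dual_cone_iff hS]
    simp only [pair_toCompletion, map_sandwich_dualCompletionEquiv]
    rfl
  constructor
  · intro hE
    have he := (bidualToCompletion_mem_posCone_iff hS).1 (hE.mem_posCone hS.completion)
    refine ⟨(norm_bidualToCompletion e).symm.trans_le hE.norm_le_one, fun n x t ht => ?_⟩
    rw [unitBlock_mem_bidual_cone_iff hS he, key, ← hE.matNorm_le_iff' hS.completion _ ht,
      completion_matNorm_toCompletion hS]
  · intro hE
    have he := (bidualToCompletion_mem_posCone_iff hS).2 (hE.mem_posCone hS)
    refine ⟨(norm_bidualToCompletion e).trans_le hE.norm_le_one, fun n z t ht => ?_⟩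
    rw [unitBlock_mem_bidual_cone_iff hS.completion he]
    have hN := continuous_completion_matNorm (n := n) hS
    -- the criterion for `z` follows by continuity in one direction, and by approximation with
    -- elements of `M_n(X)` in the other one
    have h0 : ∀ g ∈ S.completion.dual.cone (n + n),
        0 ≤ ∑ i, (bidualToCompletion e (g i i)).re := fun g hg =>
      Finset.sum_nonneg fun i _ => re_apply_nonneg hS.completion.dual he
        (apply_mem_posCone hS.completion.dual hg i)
    have h1 : ∀ (z : Matrix (Fin n) (Fin n) (Completion X)), ∀ g ∈ S.completion.dual.cone (n + n),
        0 ≤ S.completion.matNorm n z * ∑ i, (bidualToCompletion e (g i i)).re +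
          2 * (pair (sandwich (inlMat n n) g (inrMat n n)ᵀ) z).re := by
      intro z g hg
      refine denseRange_toCompletion.induction_on z (isClosed_le continuous_const
        ((hN.mul_const _).add ((Complex.continuous_re.comp (continuous_pair _)).const_mul _)))
        fun x => ?_
      rw [completion_matNorm_toCompletion hS]
      exact (key n x _).1 ((hE.matNorm_le_iff' hS x (hS.matNorm_nonneg x)).1 le_rfl) g hg
    refine ⟨fun h g hg => (h1 z g hg).trans ?_, fun h => le_of_forall_pos_le_add fun ε hε => ?_⟩
    · gcongr
      exact h0 g hg
    · obtain ⟨x, hx⟩ := denseRange_toCompletion.exists_mem_open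
        (s := {y | S.completion.matNorm n (y - z) < ε / 2})
        (isOpen_lt (hN.comp (continuous_id.sub continuous_const)) continuous_const)
        ⟨z, by simpa [hS.completion.matNorm_zero] using hε⟩
      have h2 : S.matNorm n x ≤ t + ε / 2 := by
        refine (hE.matNorm_le_iff' hS x (by positivity)).2 ((key n x _).2 fun g hg => ?_)
        have h3 := h g hg
        have h4 := h1 (toCompletion x - z) g hg
        have h5 := mul_le_mul_of_nonneg_right (le_of_lt hx) (h0 g hg)
        rw [pair_sub, Complex.sub_re] at h4
        linarith
      have h3 := hS.completion.matNorm_sub_le (toCompletion x) (toCompletion x - z)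
      rw [sub_sub_cancel, completion_matNorm_toCompletion hS] at h3
      have : S.completion.matNorm n (toCompletion x - z) < ε / 2 := hx
      linarith

end MatrixOrderedData

end

theorem mainTheorem6 {X : Type u} [NormedAddCommGroup X] [NormedSpace ℂ X]
    (S : MatrixOrderedData X) (hS : S.IsSMOS) :
    (S.IsApproximatelyUnital → S.bidual.IsUnitalOperatorSystem) ∧
    (S.bidual.IsUnitalOperatorSystem → S.completion.HasWeaklyDefiningUnitInOpenPosBall) ∧
    (S.completion.HasWeaklyDefiningUnitInOpenPosBall → S.completion.IsApproximatelyUnital) ∧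
    (CompleteSpace X →
      List.TFAE [S.IsApproximatelyUnital, S.bidual.IsUnitalOperatorSystem,
        S.completion.HasWeaklyDefiningUnitInOpenPosBall]) ∧
    (S.IsApproximatelyUnital → S.IsOperatorSystem) ∧
    (∀ (I : Type w) [Preorder I] (a : I → X), S.IsApproximateOrderUnit a →
      S.IsMatrixNormDefining a → S.IsWeaklyMatrixNormDefining a) := by
  have h12 : S.IsApproximatelyUnital → S.bidual.IsUnitalOperatorSystem := by
    rintro ⟨I, _, a, ha⟩
    obtain ⟨e, hE⟩ := ha.exists_isBidualUnit hS
    exact hE.isUnitalOperatorSystem hS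
  have h23 : S.bidual.IsUnitalOperatorSystem → S.completion.HasWeaklyDefiningUnitInOpenPosBall := by
    intro h
    obtain ⟨e, hE⟩ := MatrixOrderedData.exists_isBidualUnit hS h
    exact ((MatrixOrderedData.isBidualUnit_completion_iff hS).2 hE).hasWeaklyDefiningUnitInOpenPosBall hS.completion
  refine ⟨h12, h23, fun ⟨I, hI, a, _, _, ha⟩ => ⟨I, hI, a, ha⟩, fun _ => ?_,
    fun h => MatrixOrderedData.isOperatorSystem_of_bidual hS (h12 h),
    fun I _ a _ ha => ha.isWeaklyMatrixNormDefining hS⟩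
  have h31 : S.completion.HasWeaklyDefiningUnitInOpenPosBall → S.IsApproximatelyUnital := by
    rintro ⟨I, _, a, _, _, ha⟩
    obtain ⟨e', hE'⟩ := ha.exists_isBidualUnit hS.completion
    obtain ⟨e, rfl⟩ := MatrixOrderedData.bidualToCompletion_surjective e'
    obtain ⟨J, hJ, b, _, _, hb⟩ :=
      ((MatrixOrderedData.isBidualUnit_completion_iff hS).1 hE').hasWeaklyDefiningUnitInOpenPosBall hS
    exact ⟨J, hJ, b, hb⟩
  tfae_have 1 → 2 := h12
  tfae_have 2 → 3 := h23
  tfae_have 3 → 1 := h31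
  tfae_finish
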